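/- Let $q<0$, $p>4$ and $\sigma\in\{1,-1\}$, and let $I=(0,\tfrac12q^2)$ if $\sigma=1$ and $I=(\tfrac12q^2,\infty)$ if $\sigma=-1$. For $\omega\in I$ let $$Q_\omega(x)=\Bigl[\tfrac{(p+2)\omega}{2}\Bigr]^{1/p}\sinh^{-2/p}\Bigl[p\sqrt{\tfrac{\omega}{2}}\,|x|+\operatorname{arctanh}\tfrac{\sqrt{2\omega}}{|q|}\Bigr]\ (\sigma=1),\qquad Q_\omega(x)=\Bigl[\tfrac{(p+2)\omega}{2}\Bigr]^{1/p}\cosh^{-2/p}\Bigl[p\sqrt{\tfrac{\omega}{2}}\,|x|+\operatorname{arctanh}\tfrac{|q|}{\sqrt{2\omega}}\Bigr]\ (\sigma=-1).$$ Let $H=-\tfrac12\partial_x^2+q\delta_0$, that is, $H=-\tfrac12\partial_x^2$ for $x\neq0$ together with the jump condition $u'(0+)-u'(0-)=2qu(0)$, and $$\mathcal H=\begin{bmatrix}H+\omega&0\\0&-H-\omega\end{bmatrix}+\sigma Q_\omega^p\begin{bmatrix}\tfrac{p+2}{2}&\tfrac p2\\-\tfrac p2&-\tfrac{p+2}{2}\end{bmatrix}.$$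 For $\xi\in\mathbb R$, a solution of $\mathcal Hf=(\tfrac12\xi^2+\omega)f$ is a continuous function $f:\mathbb R\to\mathbb C^2$ that is twice differentiable and satisfies the equation for $x\ne0$, and obeys the jump condition at $x=0$. Write $\mu=\sqrt{\xi^2+4\omega}$, $\langle x\rangle=\sqrt{1+x^2}$ and $W[f,g]={}^tf'g-{}^tfg'$. For every $\omega\in I$ and $\xi\in\mathbb R$, the problem $\mathcal Hf=(\tfrac12\xi^2+\omega)f$ admits four solutions $f_1,f_2,f_3,\tilde f_4$ (functions of $x$, depending also on $\xi$ and $\omega$) with the following properties. There are $\gamma=\gamma(\omega)>0$ and constants $C_{\ell,k}(\omega)$, depending continuously on $\omega\in I$ (and depending on $q,p,\sigma$, but not on $x,\xi$), such that for all $x\ge0$, $\xi\in\mathbb R$, $\ell\in\{0,1,2,\dots\}$ and $k\in\{0,1\}$ the derivatives below exist ($x$-derivatives at $x=0$ being one-sided) and $$\Bigl|\partial_\xi^\ell\partial_x^k\Bigl\{e^{-ix\xi}f_1(x,\xi)-\begin{bmatrix}1\\0\end{bmatrix}\Bigr\}\Bigr|\le C_{\ell,k}(\omega)\,\mu^{-1}\langle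 x\rangle^{\ell+1}e^{-\min\{\gamma,\mu\}x},$$ $$\Bigl|\partial_\xi^\ell\partial_x^k\Bigl\{e^{ix\xi}f_2(x,\xi)-\begin{bmatrix}1\\0\end{bmatrix}\Bigr\}\Bigr|\le C_{\ell,k}(\omega)\,\mu^{-1}\langle x\rangle^{\ell+1}e^{-\min\{\gamma,\mu\}x},$$ $$\Bigl|\partial_\xi^\ell\partial_x^k\Bigl\{e^{\mu x}f_3(x,\xi)-\begin{bmatrix}0\\1\end{bmatrix}\Bigr\}\Bigr|\le C_{\ell,k}(\omega)\begin{cases}\mu^{-1}e^{-\gamma x}&(\ell=k=0),\\ \mu^{-\ell-1}e^{-2\gamma x}&(\ell+k\ge1),\end{cases}$$ $$\Bigl|\partial_\xi^\ell\partial_x^k\Bigl\{e^{-\mu x}\tilde f_4(x,\xi)-\begin{bmatrix}0\\1\end{bmatrix}\Bigr\}\Bigr|\le C_{\ell,k}(\omega)\begin{cases}\mu^{-1}\langle x\rangle^{2}e^{-\min\{\gamma,\mu\}x}&(\ell=0),\\ \mu^{-2}\langle x\rangle^{2+\ell}e^{-\min\{\gamma,\mu\}x}&(\ell\ge1).\end{cases}$$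 Furthermore, for all $x,\xi\in\mathbb R$, $$f_1(x,-\xi)=\overline{f_1(x,\xi)}=f_2(x,\xi),\qquad f_2(x,-\xi)=\overline{f_2(x,\xi)}=f_1(x,\xi),$$ $$f_3(x,-\xi)=\overline{f_3(x,\xi)}=f_3(x,\xi),\qquad \tilde f_4(x,-\xi)=\overline{\tilde f_4(x,\xi)}=\tilde f_4(x,\xi),$$ and, for all $\xi\in\mathbb R$ and at every $x\neq0$, $$W[f_1,f_2]=2i\xi,\qquad W[f_1,f_3]=W[f_2,f_3]=0,\qquad W[f_3,\tilde f_4]=-2\mu .$$ -/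

import Mathlib

open Set Filter Topology
open scoped Matrix

noncomputable section

/-- Admissible frequencies: `(0, q²/2)` in the defocusing case `σ = 1`,
`(q²/2, ∞)` in the focusing case `σ = -1`. -/
def frequencySet (q σ : ℝ) : Set ℝ :=
  if 0 < σ then Ioo 0 (q ^ 2 / 2) else Ioi (q ^ 2 / 2)

/-- The solitary wave profile `Q_ω`, with a `sinh` in the defocusing case and a `cosh` in the
focusing case. -/
def solitaryWave (q p σ ω x : ℝ) : ℝ :=
  if 0 < σ then
    ((p + 2) * ω / 2) ^ (1 / p) *
      Real.sinh (p * √(ω / 2) * |x| + Real.artanh (√(2 * ω) / |q|)) ^ (-(2 / p))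
  else
    ((p + 2) * ω / 2) ^ (1 / p) *
      Real.cosh (p * √(ω / 2) * |x| + Real.artanh (|q| / √(2 * ω))) ^ (-(2 / p))

/-- The constant matrix multiplying `σ Q_ω^p` in the potential. -/
def potentialMatrix (p : ℝ) : Matrix (Fin 2) (Fin 2) ℂ :=
  !![((p : ℂ) + 2) / 2, (p : ℂ) / 2; -((p : ℂ) / 2), -(((p : ℂ) + 2) / 2)]

/-- The action, at a point `x ≠ 0`, of
`𝓗 = diag(H + ω, -H - ω) + σ Q_ω^p [[(p+2)/2, p/2], [-p/2, -(p+2)/2]]`,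
where `H = -½ ∂ₓ²` away from the origin. The point interaction `q δ₀` at the origin is the jump
condition in `IsGeneralizedEigenfunction`. -/
def matrixHamiltonian (q p σ ω : ℝ) (f : ℝ → Fin 2 → ℂ) (x : ℝ) : Fin 2 → ℂ :=
  ![-(1 / 2) * deriv (deriv f) x 0 + ω * f x 0,
    -(-(1 / 2) * deriv (deriv f) x 1) - ω * f x 1] +
  ((σ * solitaryWave q p σ ω x ^ p : ℝ) : ℂ) • (potentialMatrix p *ᵥ f x)

/-- `f` solves `𝓗 f = (ξ²/2 + ω) f` on the whole line (no integrability at infinity is required):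
it is continuous, twice differentiable and a solution away from the origin, and satisfies the
jump condition `f'(0+) - f'(0-) = 2 q f(0)`. -/
structure IsGeneralizedEigenfunction (q p σ ω ξ : ℝ) (f : ℝ → Fin 2 → ℂ) : Prop where
  continuous : Continuous f
  differentiableAt : ∀ x, x ≠ 0 → DifferentiableAt ℝ f x
  differentiableAt_deriv : ∀ x, x ≠ 0 → DifferentiableAt ℝ (deriv f) x
  jump : ∃ a b : Fin 2 → ℂ,
    Tendsto (deriv f) (𝓝[>] 0) (𝓝 a) ∧ Tendsto (deriv f) (𝓝[<] 0) (𝓝 b) ∧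
      a - b = (2 * q) • f 0
  equation : ∀ x, x ≠ 0 → matrixHamiltonian q p σ ω f x = (ξ ^ 2 / 2 + ω) • f x

/-- The Wronskian `W[f, g](x) = ᵗf'(x) g(x) - ᵗf(x) g'(x)`. -/
def wronskian (f g : ℝ → Fin 2 → ℂ) (x : ℝ) : ℂ :=
  deriv f x ⬝ᵥ g x - f x ⬝ᵥ deriv g x

/-- `μ = √(ξ² + 4ω)`. -/
def decayRate (ω ξ : ℝ) : ℝ := √(ξ ^ 2 + 4 * ω)

/-- The Japanese bracket `⟨x⟩ = √(1 + x²)`. -/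
def japaneseBracket (x : ℝ) : ℝ := √(1 + x ^ 2)

/-- `∂ₓᵏ R(x, ξ)` for `x ≥ 0`, one-sided at `x = 0`. -/
def derivX (k : ℕ) (R : ℝ → ℝ → Fin 2 → ℂ) (x ξ : ℝ) : Fin 2 → ℂ :=
  iteratedDerivWithin k (fun y => R y ξ) (Ici 0) x

/-- For `x ≥ 0`, `ξ ∈ ℝ`, `ℓ ≥ 0` and `k ∈ {0, 1}`, the derivatives `∂_ξ^ℓ ∂_x^k R(x, ξ)` exist
and are bounded in absolute value by `C ℓ k * B ℓ k x ξ`. -/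
def DerivativeBounds (R : ℝ → ℝ → Fin 2 → ℂ) (C : ℕ → ℕ → ℝ) (B : ℕ → ℕ → ℝ → ℝ → ℝ) : Prop :=
  (∀ ξ, DifferentiableOn ℝ (fun x => R x ξ) (Ici 0)) ∧
  (∀ x, 0 ≤ x → ∀ k ≤ 1, ContDiff ℝ ((⊤ : ℕ∞) : WithTop ℕ∞) (fun ξ => derivX k R x ξ)) ∧
  ∀ x, 0 ≤ x → ∀ ξ ℓ, ∀ k ≤ 1,
    ‖iteratedDeriv ℓ (fun η => derivX k R x η) ξ‖ ≤ C ℓ k * B ℓ k x ξ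

/-- The weight for the oscillating solutions `f₁`, `f₂`. -/
def oscillatingWeight (ω γ : ℝ) (ℓ _k : ℕ) (x ξ : ℝ) : ℝ :=
  (decayRate ω ξ)⁻¹ * japaneseBracket x ^ (ℓ + 1) * Real.exp (-min γ (decayRate ω ξ) * x)

/-- The weight for the exponentially decaying solution `f₃`. -/
def decayingWeight (ω γ : ℝ) (ℓ k : ℕ) (x ξ : ℝ) : ℝ :=
  if ℓ + k = 0 then (decayRate ω ξ)⁻¹ * Real.exp (-γ * x)
  else (decayRate ω ξ)⁻¹ ^ (ℓ + 1) * Real.exp (-(2 * γ) * x)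

/-- The weight for the exponentially growing solution `f̃₄`. -/
def growingWeight (ω γ : ℝ) (ℓ _k : ℕ) (x ξ : ℝ) : ℝ :=
  if ℓ = 0 then
    (decayRate ω ξ)⁻¹ * japaneseBracket x ^ 2 * Real.exp (-min γ (decayRate ω ξ) * x)
  else
    (decayRate ω ξ)⁻¹ ^ 2 * japaneseBracket x ^ (2 + ℓ) *
      Real.exp (-min γ (decayRate ω ξ) * x)

end

noncomputable section

/-! ### Holomorphic functions restricted to the real line -/

section RealRestriction

variable {F : Type*} [NormedAddCommGroup F] [NormedSpace ℂ F] [CompleteSpace F]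

/-! The closed form of the solitary wave makes `σ Q_ω^p` a power series in `e^{-κ|x|}` with `κ =
p√(2ω)`: it is `2(p+2)ω ∑ n θⁿ e^{-nκ|x|}`, where `θ = nome` satisfies `|θ| < 1` and carries the
sign of `σ`, so that both cases become one (`potential_eq`). For `x > 0` the eigenvalue problem
reads `f'' = diag(-ξ², ξ²+4ω) f + V M f` with `V` this potential and `M` a symmetric matrix.
Inserting `f = e^{λx} ∑ e^{-nκx} c n` with `λ = ±iξ` or `λ = -μ` gives a recursion with denominators
`(λ-nκ)² - s i`. As `p > 4` forces `κ ≥ 5√ω`, these are never small, and their quadratic growth in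
`n` makes the series converge down to `x = 0` (`exists_frobenius_majorant`,
`exists_solutionCoeff_bound`). This produces `f₁`, `f₂`, `f₃` with remainders of size `μ⁻¹ e^{-κx}`.

The estimates persist when `ξ` is replaced by a complex `z` in a disc around the real point `ξ`, of
radius of order `√ω` for `f₁`, `f₂` and of order `μ` for `f₃`. The bounds on derivatives in `ξ` are
then Cauchy estimates (`derivativeBounds_of_holomorphic`), and the larger discs yield the factors
`μ^{-ℓ}`.

The exponent `λ = +μ` can be resonant (`nκ = 2μ`), so `f₄` is not a Frobenius series. It is launched
from Cauchy data at `0`, explicit in those of `f₃`, for which `W[f₃, f₄] = -2μ`. In the variables of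
`isDampedSystem_propagator`, `e^{-μx} f₄` solves a system in which all components but one are damped
(`exists_damped_bound`); the undamped one converges, and the constancy of the Wronskian identifies
its limit as `1` (`tendsto_growing`). The data contain the quotient by `seedNorm`, which must be
bounded below on complex discs: it is near `2` at high energy, a sum of real squares at real `ξ`,
and the Schwarz lemma carries the bound off the axis (`exists_le_norm_seedNorm`).

Each solution is extended to `x < 0` by applying the jump to its data and solving backwards. The
remaining Wronskians are read off at `+∞` (`dataWronskian_frobeniusData`). The symmetries hold
because the system has real coefficients and depends on `ξ` through `ξ²` only. Finally the constants
are locally uniform in `ω`, and the admissible ones form a convex set, so a partition of unity makes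
them continuous (`exists_continuousOn_asymptoticBounds`). -/

theorem iteratedDeriv_comp_ofReal {f : ℂ → F} {U : Set ℂ} (hU : IsOpen U)
    (hf : DifferentiableOn ℂ f U) (hR : ∀ x : ℝ, (x : ℂ) ∈ U) (n : ℕ) :
    iteratedDeriv n (fun x : ℝ => f x) = fun x : ℝ => iteratedDeriv n f x := by
  induction n with
  | zero => simp
  | succ n ih =>
    ext x
    rw [iteratedDeriv_succ, ih, iteratedDeriv_succ]
    have h : DifferentiableAt ℂ (iteratedDeriv n f) x := by
      rw [iteratedDeriv_eq_iterate]
      exact (((hf.analyticOnNhd hU).iterated_deriv n) x (hR x)).differentiableAt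
    have h2 := h.hasDerivAt.scomp x (Complex.ofRealCLM.hasDerivAt (x := x))
    simpa [Function.comp_def] using h2.deriv

theorem contDiff_comp_ofReal {f : ℂ → F} {U : Set ℂ} (hU : IsOpen U)
    (hf : DifferentiableOn ℂ f U) (hR : ∀ x : ℝ, (x : ℂ) ∈ U) :
    ContDiff ℝ ((⊤ : ℕ∞) : WithTop ℕ∞) (fun x : ℝ => f x) := by
  rw [contDiff_iff_contDiffAt]
  intro x
  have h : ContDiffAt ℂ ((⊤ : ℕ∞) : WithTop ℕ∞) f x :=
    (hf.contDiffOn hU).contDiffAt (hU.mem_nhds (hR x))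
  exact (h.restrict_scalars ℝ).comp x Complex.ofRealCLM.contDiff.contDiffAt

/-- Cauchy's estimate, the only source of bounds on derivatives in `ξ`. A disc of radius
proportional to `μ` gains one power of `μ⁻¹` per derivative. -/
theorem norm_iteratedDeriv_comp_ofReal_le {f : ℂ → F} {U : Set ℂ} (hU : IsOpen U)
    (hf : DifferentiableOn ℂ f U) (hR : ∀ x : ℝ, (x : ℂ) ∈ U) {ξ r B : ℝ} (hr : 0 < r)
    (hball : Metric.closedBall (ξ : ℂ) r ⊆ U)
    (hB : ∀ z ∈ Metric.closedBall (ξ : ℂ) r, ‖f z‖ ≤ B) (n : ℕ) :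
    ‖iteratedDeriv n (fun x : ℝ => f x) ξ‖ ≤ n.factorial * B / r ^ n := by
  rw [iteratedDeriv_comp_ofReal hU hf hR]
  exact Complex.norm_iteratedDeriv_le_of_forall_mem_sphere_norm_le n hr
    (hf.diffContOnCl_ball hball)
    fun z hz => hB z (Metric.sphere_subset_closedBall hz)

end RealRestriction

/-! ### Damped scalar equations -/

/-- Variation of constants: forcing that decays more slowly than the damping passes its rate on to
`y`, at the price of `1 / (ν - γ)`. In the application this factor is of order `1 / μ`. -/
theorem norm_le_of_damped {y g : ℝ → ℂ} {lam : ℂ} {ν γ H : ℝ} (hγ : γ < ν) (hν : ν ≤ lam.re)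
    (hH : 0 ≤ H) (hy : ∀ x, 0 ≤ x → HasDerivAt y (-lam * y x + g x) x)
    (hg : ∀ x, 0 ≤ x → ‖g x‖ ≤ H * Real.exp (-γ * x)) (x : ℝ) (hx : 0 ≤ x) :
    ‖y x‖ ≤ (‖y 0‖ + H / (ν - γ)) * Real.exp (-γ * x) := by
  have hpos : 0 < lam.re - γ := by linarith
  set Y : ℝ → ℂ := fun x => Complex.exp (lam * x) * y x with hY
  have hYd : ∀ x : ℝ, 0 ≤ x → HasDerivAt Y (Complex.exp (lam * x) * g x) x := by
    intro x hx
    have h1 : HasDerivAt (fun x : ℝ => Complex.exp (lam * x)) (Complex.exp (lam * x) * lam) x := by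
      have : HasDerivAt (fun x : ℂ => Complex.exp (lam * x)) (Complex.exp (lam * x) * lam) (x : ℂ) := by
        simpa using ((hasDerivAt_id (x : ℂ)).const_mul lam).cexp
      exact this.comp_ofReal
    refine (h1.mul (hy x hx)).congr_deriv ?_
    ring
  -- The derivative of `e^{λx} y` has norm at most `H e^{(Re λ - γ)x}`; the barrier is the integral
  -- of this bound.
  have hB : ∀ x : ℝ, HasDerivAt (fun x : ℝ => ‖y 0‖ + H / (lam.re - γ) *
      (Real.exp ((lam.re - γ) * x) - 1)) (H * Real.exp ((lam.re - γ) * x)) x := by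
    intro x
    have := ((((hasDerivAt_id x).const_mul (lam.re - γ)).exp.sub_const 1).const_mul
      (H / (lam.re - γ))).const_add ‖y 0‖
    refine this.congr_deriv ?_
    field_simp
    simp
  have key := image_norm_le_of_norm_deriv_right_le_deriv_boundary (a := 0) (b := x)
    (f := Y) (f' := fun x => Complex.exp (lam * x) * g x)
    (fun t ht => (hYd t ht.1).continuousAt.continuousWithinAt)
    (fun t ht => (hYd t ht.1).hasDerivWithinAt) (by simp [hY]) hB
    (by
      intro t ht
      rw [norm_mul, Complex.norm_exp]
      have h2 := hg t ht.1
      have : (lam * (t : ℂ)).re = lam.re * t := by simp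
      rw [this]
      calc Real.exp (lam.re * t) * ‖g t‖
          ≤ Real.exp (lam.re * t) * (H * Real.exp (-γ * t)) := by gcongr
        _ = H * Real.exp ((lam.re - γ) * t) := by
          rw [mul_left_comm, ← Real.exp_add]; ring_nf) (⟨hx, le_rfl⟩ : x ∈ Icc 0 x)
  have hn : ‖Y x‖ = Real.exp (lam.re * x) * ‖y x‖ := by
    simp [hY, Complex.norm_exp]
  rw [hn] at key
  have e1 : ‖y x‖ ≤ Real.exp (-(lam.re * x)) * (‖y 0‖ + H / (lam.re - γ) *
      (Real.exp ((lam.re - γ) * x) - 1)) := by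
    rw [Real.exp_neg, ← div_eq_inv_mul, le_div_iff₀ (Real.exp_pos _), mul_comm]
    exact key
  refine e1.trans ?_
  have e2 : Real.exp (-γ * x) = Real.exp (-(lam.re * x)) * Real.exp ((lam.re - γ) * x) := by
    rw [← Real.exp_add]; ring_nf
  rw [e2]
  have e3 : 1 ≤ Real.exp ((lam.re - γ) * x) := Real.one_le_exp (by positivity)
  have e4 : H / (lam.re - γ) ≤ H / (ν - γ) := by
    apply div_le_div_of_nonneg_left hH <;> linarith
  have e5 : 0 ≤ H / (lam.re - γ) := by positivity
  rw [mul_left_comm]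
  gcongr
  nlinarith [norm_nonneg (y 0)]

/-! ### Linear differential equations depending holomorphically on a parameter -/

section Fundamental

variable {F : Type*} [NormedAddCommGroup F] [NormedSpace ℂ F] [CompleteSpace F]

/-- The domination needed to differentiate under the integral comes from Cauchy's estimate on unit
circles, so a bound of `G` itself on a compact set is enough. -/
theorem differentiable_intervalIntegral_of_continuous {G : ℝ → ℂ → F}
    (hc : Continuous (Function.uncurry G)) (hd : ∀ s, Differentiable ℂ (G s)) (a b : ℝ) :
    Differentiable ℂ (fun w => ∫ s in a..b, G s w) := by
  intro w₀
  obtain ⟨K, hK⟩ := ((isCompact_uIcc (a := a) (b := b)).prod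
    (isCompact_closedBall w₀ 2)).exists_bound_of_continuousOn hc.continuousOn
  have hG : ∀ w, Continuous (fun s => G s w) := fun w =>
    hc.comp (continuous_id.prodMk continuous_const)
  have := intervalIntegral.hasDerivAt_integral_of_dominated_loc_of_deriv_le
    (μ := MeasureTheory.volume) (a := a) (b := b)
    (F := fun w s => G s w) (F' := fun w s => deriv (G s) w) (x₀ := w₀)
    (s := Metric.ball w₀ 1) (bound := fun _ => K) (Metric.ball_mem_nhds w₀ one_pos)
    (Eventually.of_forall fun w => (hG w).aestronglyMeasurable)
    ((hG w₀).intervalIntegrable _ _)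
    (((stronglyMeasurable_deriv_with_param hc).comp_measurable
      (measurable_id.prodMk measurable_const)).aestronglyMeasurable)
    (Eventually.of_forall fun s hs w hw => by
      have h1 : ∀ z ∈ Metric.sphere w 1, ‖G s z‖ ≤ K := by
        intro z hz
        refine hK (s, z) ⟨uIoc_subset_uIcc hs, ?_⟩
        rw [Metric.mem_closedBall]
        rw [Metric.mem_sphere] at hz
        rw [Metric.mem_ball] at hw
        linarith [dist_triangle z w w₀]
      simpa using Complex.norm_deriv_le_of_forall_mem_sphere_norm_le one_pos
        (hd s).diffContOnCl h1)
    intervalIntegrable_const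
    (Eventually.of_forall fun s _ w _ => (hd s w).hasDerivAt)
  exact this.2.differentiableAt

variable {R : Type*} [NormedRing R] [NormedAlgebra ℂ R]

/-- The terms of the Picard series of the fundamental solution of `Y' = A Y`. -/
def picardTerm (A : ℝ → ℂ → R) : ℕ → ℝ → ℂ → R
  | 0 => fun _ _ => 1
  | n + 1 => fun x w => ∫ s in (0 : ℝ)..x, A s w * picardTerm A n s w

/-- The fundamental solution of `Y' = A Y`, `Y 0 = 1`. -/
def fundamentalSolution (A : ℝ → ℂ → R) (x : ℝ) (w : ℂ) : R :=
  ∑' n, picardTerm A n x w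

theorem fundamentalSolution_zero (A : ℝ → ℂ → R) (w : ℂ) :
    fundamentalSolution A 0 w = 1 := by
  unfold fundamentalSolution
  rw [tsum_eq_single 0]
  · rfl
  · intro n hn
    obtain ⟨k, rfl⟩ := Nat.exists_eq_succ_of_ne_zero hn
    simp [picardTerm]

theorem picardTerm_regular [CompleteSpace R] {A : ℝ → ℂ → R} (hA : Continuous (Function.uncurry A))
    (hA' : ∀ s, Differentiable ℂ (A s)) (n : ℕ) :
    Continuous (Function.uncurry (picardTerm A n)) ∧
      ∀ x, Differentiable ℂ (picardTerm A n x) := by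
  induction n with
  | zero => exact ⟨continuous_const, fun _ => differentiable_const _⟩
  | succ n ih =>
    have h1 : Continuous (Function.uncurry fun s w => A s w * picardTerm A n s w) :=
      hA.mul ih.1
    constructor
    · have h2 : Continuous (Function.uncurry fun (q : ℝ × ℂ) (s : ℝ) =>
          A s q.2 * picardTerm A n s q.2) :=
        h1.comp (continuous_snd.prodMk (continuous_snd.comp continuous_fst))
      exact intervalIntegral.continuous_parametric_intervalIntegral_of_continuous
        h2 continuous_fst
    · intro x
      exact differentiable_intervalIntegral_of_continuous h1
        (fun s => (hA' s).mul (ih.2 s)) 0 x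

theorem norm_picardTerm_le [NormOneClass R] {A : ℝ → ℂ → R} {X L : ℝ} {w : ℂ} (hL : 0 ≤ L)
    (hA : ∀ s, |s| ≤ X → ‖A s w‖ ≤ L) (n : ℕ) (x : ℝ) (hx : |x| ≤ X) :
    ‖picardTerm A n x w‖ ≤ (L * |x|) ^ n / n.factorial := by
  induction n generalizing x with
  | zero => simp [picardTerm]
  | succ n ih =>
    have h1 : ∀ s ∈ uIoc (0 : ℝ) x, ‖A s w * picardTerm A n s w‖ ≤
        L ^ (n + 1) / n.factorial * |s - 0| ^ n := by
      intro s hs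
      have hs' : |s| ≤ X := by
        have := abs_sub_left_of_mem_uIcc (uIoc_subset_uIcc hs)
        simp only [sub_zero] at this
        exact this.trans hx
      calc ‖A s w * picardTerm A n s w‖ ≤ ‖A s w‖ * ‖picardTerm A n s w‖ := norm_mul_le _ _
        _ ≤ L * ((L * |s|) ^ n / n.factorial) :=
          mul_le_mul (hA s hs') (ih s hs') (norm_nonneg _) hL
        _ = _ := by rw [sub_zero]; ring
    calc ‖picardTerm A (n + 1) x w‖
        = ‖∫ s in (0 : ℝ)..x, A s w * picardTerm A n s w‖ := rfl
      _ ≤ |∫ s in (0 : ℝ)..x, L ^ (n + 1) / n.factorial * |s - 0| ^ n| := by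
          refine intervalIntegral.norm_integral_le_abs_of_norm_le ?_ ?_
          · exact (MeasureTheory.ae_restrict_iff' measurableSet_uIoc).2 (Eventually.of_forall h1)
          · exact (by fun_prop : Continuous fun s : ℝ =>
              L ^ (n + 1) / n.factorial * |s - 0| ^ n).intervalIntegrable _ _
      _ = (L * |x|) ^ (n + 1) / (n + 1).factorial := by
          rw [intervalIntegral.integral_const_mul, abs_mul,
            intervalIntegral.abs_intervalIntegral_eq, integral_pow_abs_sub_uIoc,
            abs_of_nonneg (by positivity), abs_of_nonneg (by positivity), Nat.factorial_succ]
          push_cast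
          rw [sub_zero]
          rw [mul_pow]
          field_simp

theorem exists_norm_picardTerm_le [NormOneClass R] {A : ℝ → ℂ → R} (hA : Continuous (Function.uncurry A))
    (X W : ℝ) : ∃ L, 0 ≤ L ∧ (∀ s w, |s| ≤ X → ‖w‖ ≤ W → ‖A s w‖ ≤ L) ∧
      ∀ n x w, |x| ≤ X → ‖w‖ ≤ W → ‖picardTerm A n x w‖ ≤ (L * X) ^ n / n.factorial := by
  obtain ⟨L, hL⟩ := ((isCompact_Icc (a := -X) (b := X)).prod
    (isCompact_closedBall (0 : ℂ) W)).exists_bound_of_continuousOn hA.continuousOn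
  have hL' : ∀ s w, |s| ≤ X → ‖w‖ ≤ W → ‖A s w‖ ≤ max L 0 := by
    intro s w hs hw
    exact (hL (s, w) ⟨abs_le.1 hs, by simpa using hw⟩).trans (le_max_left _ _)
  refine ⟨max L 0, le_max_right _ _, hL', fun n x w hx hw => ?_⟩
  refine (norm_picardTerm_le (le_max_right _ _) (fun s hs => hL' s w hs hw) n x hx).trans ?_
  have : 0 ≤ max L 0 := le_max_right _ _
  gcongr

/-- The Picard terms are entire in `w` and are dominated, locally uniformly in `w`, by an
exponential series. Holomorphy of the growing solution in the energy rests on this. -/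
theorem differentiable_fundamentalSolution [CompleteSpace R] [NormOneClass R] {A : ℝ → ℂ → R}
    (hA : Continuous (Function.uncurry A)) (hA' : ∀ s, Differentiable ℂ (A s)) (x : ℝ) :
    Differentiable ℂ (fundamentalSolution A x) := by
  intro w
  obtain ⟨L, -, -, hL⟩ := exists_norm_picardTerm_le hA |x| (‖w‖ + 1)
  have := Complex.differentiableOn_tsum_of_summable_norm
    (U := Metric.ball 0 (‖w‖ + 1)) (F := fun n w => picardTerm A n x w)
    (Real.summable_pow_div_factorial (L * |x|))
    (fun n => ((picardTerm_regular hA hA' n).2 x).differentiableOn) Metric.isOpen_ball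
    (fun n w hw => hL n x w le_rfl (by simpa using (Metric.mem_ball.1 hw).le))
  exact this.differentiableAt (Metric.isOpen_ball.mem_nhds (by simp))

theorem summable_picardTerm [CompleteSpace R] [NormOneClass R] {A : ℝ → ℂ → R} (hA : Continuous (Function.uncurry A))
    (x : ℝ) (w : ℂ) : Summable fun n => picardTerm A n x w := by
  obtain ⟨L, -, -, hL⟩ := exists_norm_picardTerm_le hA |x| ‖w‖
  exact Summable.of_norm_bounded (Real.summable_pow_div_factorial (L * |x|))
    fun n => hL n x w le_rfl le_rfl

theorem hasDerivAt_fundamentalSolution [CompleteSpace R] [NormOneClass R] {A : ℝ → ℂ → R}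
    (hA : Continuous (Function.uncurry A)) (hA' : ∀ s, Differentiable ℂ (A s)) (x : ℝ) (w : ℂ) :
    HasDerivAt (fun x => fundamentalSolution A x w) (A x w * fundamentalSolution A x w) x := by
  set X := |x| + 1 with hXdef
  obtain ⟨L, hL0, hL1, hL⟩ := exists_norm_picardTerm_le hA X ‖w‖
  have hxm : x ∈ Ioo (-X) X := by
    rw [mem_Ioo, ← abs_lt]; simp [hXdef]
  have hderiv : ∀ n y, HasDerivAt (fun y => picardTerm A (n + 1) y w)
      (A y w * picardTerm A n y w) y := by
    intro n y
    have hc : Continuous fun s => A s w * picardTerm A n s w :=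
      (hA.mul (picardTerm_regular hA hA' n).1).comp (continuous_id.prodMk continuous_const)
    exact intervalIntegral.integral_hasDerivAt_right (hc.intervalIntegrable _ _)
      (hc.stronglyMeasurableAtFilter _ _) hc.continuousAt
  have hbound : ∀ n y, y ∈ Ioo (-X) X →
      ‖A y w * picardTerm A n y w‖ ≤ L * ((L * X) ^ n / n.factorial) := by
    intro n y hy
    have hy' := (abs_lt.2 hy).le
    exact (norm_mul_le _ _).trans (mul_le_mul (hL1 y w hy' le_rfl) (hL n y w hy' le_rfl)
      (norm_nonneg _) hL0)
  have key := hasDerivAt_tsum_of_isPreconnected (g := fun n y => picardTerm A (n + 1) y w)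
    (g' := fun n y => A y w * picardTerm A n y w) (y₀ := x) (y := x)
    ((Real.summable_pow_div_factorial (L * X)).mul_left L) isOpen_Ioo isPreconnected_Ioo
    (fun n y _ => hderiv n y) hbound hxm
    ((summable_nat_add_iff 1).2 (summable_picardTerm hA x w)) hxm
  rw [(summable_picardTerm hA x w).tsum_mul_left (A x w)] at key
  have heq : (fun x => fundamentalSolution A x w) =
      fun x => 1 + ∑' n, picardTerm A (n + 1) x w := by
    funext y
    exact (summable_picardTerm hA y w).tsum_eq_zero_add
  rw [heq]
  exact key.const_add 1

end Fundamental

/-! ### A majorant for the Frobenius recursion -/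

/-- Convolution with `m ρ₀^m` costs only a constant factor on sequences of growth `ρⁿ`, `ρ > ρ₀`,
and the prefactors `K / (n+1)²` are summable, so the accumulated losses form a convergent product.
-/
theorem exists_frobenius_majorant (K : ℝ) (hK : 0 ≤ K) {ρ₀ ρ : ℝ} (h0 : 0 ≤ ρ₀) (h1 : ρ₀ < ρ) :
    ∃ B, 0 < B ∧ ∀ t : ℕ → ℝ, (∀ n, 0 ≤ t n) → t 0 ≤ 1 →
      (∀ n, t (n + 1) ≤ K / ((n : ℝ) + 1) ^ 2 *
        ∑ j ∈ Finset.range (n + 1), ((n + 1 - j : ℕ) : ℝ) * ρ₀ ^ (n + 1 - j) * t j) →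
      ∀ n, t n ≤ B * ρ ^ n ∧
        ∑ j ∈ Finset.range n, ((n - j : ℕ) : ℝ) * ρ₀ ^ (n - j) * t j ≤ B * ρ ^ n := by
  have hρ : 0 < ρ := h0.trans_lt h1
  set s := ρ₀ / ρ with hs
  have hs0 : 0 ≤ s := by positivity
  have hs1 : s < 1 := (div_lt_one hρ).2 h1
  have hsum : Summable fun m : ℕ => (m : ℝ) * s ^ m := by
    simpa using summable_pow_mul_geometric_of_norm_lt_one 1
      (by rwa [Real.norm_of_nonneg hs0] : ‖s‖ < 1)
  set S := ∑' m : ℕ, (m : ℝ) * s ^ m with hS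
  have hS0 : 0 ≤ S := tsum_nonneg fun m => by positivity
  have hpart : ∀ n, ∑ j ∈ Finset.range n, ((n - j : ℕ) : ℝ) * s ^ (n - j) ≤ S := by
    intro n
    have e := Finset.sum_range_reflect (fun m : ℕ => ((m + 1 : ℕ) : ℝ) * s ^ (m + 1)) n
    have e2 : ∑ j ∈ Finset.range n, ((n - j : ℕ) : ℝ) * s ^ (n - j) =
        ∑ j ∈ Finset.range n, ((n - 1 - j + 1 : ℕ) : ℝ) * s ^ (n - 1 - j + 1) := by
      refine Finset.sum_congr rfl fun j hj => ?_
      have : n - j = n - 1 - j + 1 := by have := Finset.mem_range.1 hj; omega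
      rw [this]
    rw [e2, e]
    have e3 := Finset.sum_range_succ' (fun m : ℕ => (m : ℝ) * s ^ m) n
    have e4 : ∑ m ∈ Finset.range (n + 1), (m : ℝ) * s ^ m ≤ S :=
      hsum.sum_le_tsum _ fun m _ => by positivity
    simp only [Nat.cast_zero, zero_mul, add_zero] at e3
    linarith
  have hz : Summable fun i : ℕ => 1 / ((i : ℝ) + 1) ^ 2 := by
    simpa using (summable_nat_add_iff 1).2 (Real.summable_one_div_nat_pow.2 one_lt_two)
  set Z := ∑' i : ℕ, 1 / ((i : ℝ) + 1) ^ 2 with hZ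
  -- Majorant of the product of the factors `1 + K S / (i+1)²`, by `1 + y ≤ e^y`; it is monotone and
  -- bounded.
  let P : ℕ → ℝ := fun n => Real.exp (K * S * ∑ i ∈ Finset.range n, 1 / ((i : ℝ) + 1) ^ 2)
  have hPZ : ∀ n, P n ≤ Real.exp (K * S * Z) := by
    intro n
    apply Real.exp_le_exp.2
    gcongr
    exact hz.sum_le_tsum _ fun m _ => by positivity
  have hPm : Monotone P := by
    refine monotone_nat_of_le_succ fun n => Real.exp_le_exp.2 ?_
    gcongr
    omega
  have hconv : ∀ (n : ℕ) (C : ℝ) (t : ℕ → ℝ), (∀ j < n, t j ≤ C * ρ ^ j) → 0 ≤ C →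
      ∑ j ∈ Finset.range n, ((n - j : ℕ) : ℝ) * ρ₀ ^ (n - j) * t j ≤ S * C * ρ ^ n := by
    intro n C t ht hC
    calc ∑ j ∈ Finset.range n, ((n - j : ℕ) : ℝ) * ρ₀ ^ (n - j) * t j
        ≤ ∑ j ∈ Finset.range n, ((n - j : ℕ) : ℝ) * s ^ (n - j) * (C * ρ ^ n) := by
          refine Finset.sum_le_sum fun j hj => ?_
          have hj' := Finset.mem_range.1 hj
          have e : ρ₀ ^ (n - j) = s ^ (n - j) * ρ ^ (n - j) := by
            rw [← mul_pow, hs, div_mul_cancel₀ _ hρ.ne']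
          have e2 : ρ ^ n = ρ ^ (n - j) * ρ ^ j := by
            rw [← pow_add]; congr 1; omega
          rw [e, e2]
          calc ((n - j : ℕ) : ℝ) * (s ^ (n - j) * ρ ^ (n - j)) * t j
              ≤ ((n - j : ℕ) : ℝ) * (s ^ (n - j) * ρ ^ (n - j)) * (C * ρ ^ j) := by
                gcongr; exact ht j hj'
            _ = _ := by ring
      _ = (∑ j ∈ Finset.range n, ((n - j : ℕ) : ℝ) * s ^ (n - j)) * (C * ρ ^ n) := by
          rw [Finset.sum_mul]
      _ ≤ S * (C * ρ ^ n) := by gcongr; exact hpart n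
      _ = _ := by ring
  refine ⟨max 1 S * Real.exp (K * S * Z), by positivity, fun t ht0 ht1 hrec => ?_⟩
  have main : ∀ n, t n ≤ P n * ρ ^ n := by
    intro n
    induction n using Nat.strong_induction_on with
    | _ n ih =>
      cases n with
      | zero => simpa [P] using ht1
      | succ n =>
        have hb := hconv (n + 1) (P n) t (fun j hj => (ih j hj).trans (by
          gcongr; exact hPm (Nat.lt_succ_iff.1 hj))) (Real.exp_pos _).le
        have e : P (n + 1) = P n * Real.exp (K * S * (1 / ((n : ℝ) + 1) ^ 2)) := by
          simp only [P, Finset.sum_range_succ, mul_add, Real.exp_add]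
        have e2 := Real.add_one_le_exp (K * S * (1 / ((n : ℝ) + 1) ^ 2))
        calc t (n + 1) ≤ K / ((n : ℝ) + 1) ^ 2 * (S * P n * ρ ^ (n + 1)) :=
              (hrec n).trans (by gcongr)
          _ = P n * (K * S * (1 / ((n : ℝ) + 1) ^ 2)) * ρ ^ (n + 1) := by ring
          _ ≤ P n * Real.exp (K * S * (1 / ((n : ℝ) + 1) ^ 2)) * ρ ^ (n + 1) := by
              gcongr; linarith
          _ = _ := by rw [e]
  have main' : ∀ n, t n ≤ Real.exp (K * S * Z) * ρ ^ n := fun n =>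
    (main n).trans (by gcongr; exact hPZ n)
  intro n
  constructor
  · refine (main' n).trans ?_
    gcongr
    exact le_mul_of_one_le_left (Real.exp_pos _).le (le_max_left _ _)
  · refine (hconv n _ t (fun j _ => main' j) (Real.exp_pos _).le).trans ?_
    gcongr
    exact le_max_right _ _

/-! ### Exponential series -/

section ExpSeries

variable {W : Type*} [NormedAddCommGroup W] [NormedSpace ℂ W]

/-- The `k`-th formal derivative of the exponential series `∑ n, e^{-nκx} c n`. -/
def expSeries (κ : ℝ) (c : ℕ → W) (k : ℕ) (x : ℝ) : W :=
  ∑' n : ℕ, ((-(n * κ : ℝ) : ℂ) ^ k * (Real.exp (-(n * κ * x)) : ℝ)) • c n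

theorem norm_expSeries_term_le {κ : ℝ} (hκ : 0 ≤ κ) {c : ℕ → W} {B ρ ε : ℝ} (hρ : 0 ≤ ρ)
    (hB : 0 ≤ B) (hc : ∀ n, ‖c n‖ ≤ B * ρ ^ n) (k n : ℕ) {x : ℝ} (hx : -ε ≤ x) :
    ‖((-(n * κ : ℝ) : ℂ) ^ k * (Real.exp (-(n * κ * x)) : ℝ)) • c n‖ ≤
      B * κ ^ k * ((n : ℝ) ^ k * (ρ * Real.exp (κ * ε)) ^ n) := by
  have e1 : Real.exp (-(n * κ * x)) ≤ Real.exp (κ * ε) ^ n := by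
    rw [← Real.exp_nat_mul]
    apply Real.exp_le_exp.2
    have : 0 ≤ n * κ := by positivity
    nlinarith
  rw [norm_smul, norm_mul, norm_pow, norm_neg, Complex.norm_real, Complex.norm_real,
    Real.norm_of_nonneg (by positivity), Real.norm_of_nonneg (by positivity)]
  calc ((n : ℝ) * κ) ^ k * Real.exp (-(n * κ * x)) * ‖c n‖
      ≤ ((n : ℝ) * κ) ^ k * Real.exp (κ * ε) ^ n * (B * ρ ^ n) := by
        gcongr; exact hc n
    _ = _ := by rw [mul_pow, mul_pow]; ring

/-- The strict inequality `ρ < 1` leaves room to the left of the origin. The exponential series can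
therefore be differentiated on an open half line containing `0`. -/
theorem exists_margin (κ : ℝ) {ρ : ℝ} (hρ1 : ρ < 1) :
    ∃ ε, 0 < ε ∧ ρ * Real.exp (κ * ε) < 1 := by
  have h : Tendsto (fun ε : ℝ => ρ * Real.exp (κ * ε)) (𝓝[>] 0) (𝓝 ρ) := by
    have : Continuous fun ε : ℝ => ρ * Real.exp (κ * ε) := by fun_prop
    have h2 := (this.tendsto 0).mono_left (nhdsWithin_le_nhds (s := Ioi 0))
    simpa using h2
  obtain ⟨ε, h1, h2⟩ := ((h.eventually (gt_mem_nhds hρ1)).and self_mem_nhdsWithin).exists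
  exact ⟨ε, h2, h1⟩

theorem summable_norm_expSeries {κ : ℝ} (hκ : 0 ≤ κ) {c : ℕ → W} {B ρ : ℝ}
    (hρ : 0 ≤ ρ) (hρ1 : ρ < 1) (hB : 0 ≤ B) (hc : ∀ n, ‖c n‖ ≤ B * ρ ^ n) (k : ℕ) {x : ℝ}
    (hx : 0 ≤ x) :
    Summable fun n : ℕ => ‖((-(n * κ : ℝ) : ℂ) ^ k * (Real.exp (-(n * κ * x)) : ℝ)) • c n‖ := by
  refine Summable.of_nonneg_of_le (fun _ => norm_nonneg _)
    (fun n => norm_expSeries_term_le hκ (ε := 0) hρ hB hc k n (by simpa using hx)) ?_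
  simp only [mul_zero, Real.exp_zero, mul_one]
  exact (summable_pow_mul_geometric_of_norm_lt_one k
    (by rwa [Real.norm_of_nonneg hρ] : ‖ρ‖ < 1)).mul_left _

variable [CompleteSpace W]

theorem hasDerivAt_expSeries {κ : ℝ} (hκ : 0 < κ) {c : ℕ → W} {B ρ : ℝ}
    (hρ : 0 ≤ ρ) (hρ1 : ρ < 1) (hB : 0 ≤ B) (hc : ∀ n, ‖c n‖ ≤ B * ρ ^ n) (k : ℕ) {x : ℝ}
    (hx : 0 ≤ x) : HasDerivAt (expSeries κ c k) (expSeries κ c (k + 1) x) x := by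
  obtain ⟨ε, hε, hε1⟩ := exists_margin κ hρ1
  have hs : ∀ k : ℕ, Summable fun n : ℕ =>
      B * κ ^ k * ((n : ℝ) ^ k * (ρ * Real.exp (κ * ε)) ^ n) := fun k =>
    (summable_pow_mul_geometric_of_norm_lt_one k
      (by rwa [Real.norm_of_nonneg (by positivity)] : ‖ρ * Real.exp (κ * ε)‖ < 1)).mul_left _
  have hxm : x ∈ Ioi (-ε) := by simp only [mem_Ioi]; linarith
  refine hasDerivAt_tsum_of_isPreconnected (t := Ioi (-ε)) (y₀ := x)
    (g := fun (n : ℕ) (y : ℝ) => ((-(n * κ : ℝ) : ℂ) ^ k * (Real.exp (-(n * κ * y)) : ℝ)) • c n)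
    (g' := fun (n : ℕ) (y : ℝ) =>
      ((-(n * κ : ℝ) : ℂ) ^ (k + 1) * (Real.exp (-(n * κ * y)) : ℝ)) • c n)
    (hs (k + 1)) isOpen_Ioi isPreconnected_Ioi ?_ ?_ hxm ?_ hxm
  · intro n y _
    have h1 : HasDerivAt (fun y : ℝ => Real.exp (-(n * κ * y)))
        (Real.exp (-(n * κ * y)) * (-(n * κ))) y := by
      simpa using (((hasDerivAt_id y).const_mul (n * κ : ℝ)).neg).exp
    have h2 := ((h1.ofReal_comp).const_mul ((-(n * κ : ℝ) : ℂ) ^ k)).smul_const (c n)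
    refine h2.congr_deriv ?_
    congr 1
    push_cast
    ring
  · intro n y hy
    exact norm_expSeries_term_le hκ.le hρ hB hc (k + 1) n (le_of_lt hy)
  · exact (summable_norm_expSeries hκ.le hρ hρ1 hB hc k hx).of_norm

/-- All terms with `n ≥ 1` contain a factor `e^{-κx}`, and the term `n = 0` survives only for `k =
0`. The bound is assumed for `n ≥ 1` only, because those coefficients are small in `μ` while `c 0`
is not. -/
theorem norm_expSeries_sub_le {κ : ℝ} (hκ : 0 ≤ κ) {c : ℕ → W} {Q ρ : ℝ}
    (hρ : 0 ≤ ρ) (hρ1 : ρ < 1) (hQ : 0 ≤ Q) (hc : ∀ n, ‖c (n + 1)‖ ≤ Q * ρ ^ (n + 1)) (k : ℕ)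
    {x : ℝ} (hx : 0 ≤ x) :
    ‖expSeries κ c k x - (if k = 0 then c 0 else 0)‖ ≤
      Q * κ ^ k * (∑' n : ℕ, (n : ℝ) ^ k * ρ ^ n) * Real.exp (-(κ * x)) := by
  have hs : Summable fun n : ℕ => (n : ℝ) ^ k * ρ ^ n :=
    summable_pow_mul_geometric_of_norm_lt_one k (by rwa [Real.norm_of_nonneg hρ] : ‖ρ‖ < 1)
  have hterm : ∀ n : ℕ, ‖((-((n + 1 : ℕ) * κ : ℝ) : ℂ) ^ k *
      (Real.exp (-((n + 1 : ℕ) * κ * x)) : ℝ)) • c (n + 1)‖ ≤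
      Q * κ ^ k * Real.exp (-(κ * x)) * (((n + 1 : ℕ) : ℝ) ^ k * ρ ^ (n + 1)) := by
    intro n
    rw [norm_smul, norm_mul, norm_pow, norm_neg, Complex.norm_real, Complex.norm_real,
      Real.norm_of_nonneg (by positivity), Real.norm_of_nonneg (by positivity)]
    have e1 : Real.exp (-((n + 1 : ℕ) * κ * x)) ≤ Real.exp (-(κ * x)) := by
      apply Real.exp_le_exp.2
      push_cast
      have : 0 ≤ (n : ℝ) * (κ * x) := by positivity
      nlinarith
    calc (((n + 1 : ℕ) : ℝ) * κ) ^ k * Real.exp (-((n + 1 : ℕ) * κ * x)) * ‖c (n + 1)‖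
        ≤ (((n + 1 : ℕ) : ℝ) * κ) ^ k * Real.exp (-(κ * x)) * (Q * ρ ^ (n + 1)) := by
          gcongr; exact hc n
      _ = _ := by rw [mul_pow]; ring
  have hs1 := ((summable_nat_add_iff 1).2 hs).mul_left (Q * κ ^ k * Real.exp (-(κ * x)))
  have hsn := Summable.of_nonneg_of_le (fun _ => norm_nonneg _) hterm hs1
  have hsw := (summable_nat_add_iff (f := fun n : ℕ =>
    ((-(n * κ : ℝ) : ℂ) ^ k * (Real.exp (-(n * κ * x)) : ℝ)) • c n) 1).1 hsn.of_norm
  have h0 : ((-((0 : ℕ) * κ : ℝ) : ℂ) ^ k * (Real.exp (-((0 : ℕ) * κ * x)) : ℝ)) • c 0 =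
      if k = 0 then c 0 else 0 := by
    by_cases hk : k = 0
    · simp [hk]
    · simp [hk]
  unfold expSeries
  rw [hsw.tsum_eq_zero_add, h0, add_sub_cancel_left]
  refine (norm_tsum_le_tsum_norm hsn).trans ((hsn.tsum_le_tsum hterm hs1).trans ?_)
  have hshift : ∑' n : ℕ, ((n + 1 : ℕ) : ℝ) ^ k * ρ ^ (n + 1) ≤ ∑' n : ℕ, (n : ℝ) ^ k * ρ ^ n := by
    rw [hs.tsum_eq_zero_add]
    have : 0 ≤ ((0 : ℕ) : ℝ) ^ k * ρ ^ 0 := by positivity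
    linarith
  rw [tsum_mul_left, mul_right_comm (Q * κ ^ k) (∑' n : ℕ, (n : ℝ) ^ k * ρ ^ n)]
  exact mul_le_mul_of_nonneg_left hshift (by positivity)

end ExpSeries

/-! ### Frobenius solutions -/

/-- Coefficients of the Frobenius series: `c 0 = c₀` and
`c n = d n * ∑_{j < n} v (n - j) • T (c j)`. -/
def frobeniusCoeff (v : ℕ → ℂ) (T : (Fin 2 → ℂ) →ₗ[ℂ] (Fin 2 → ℂ)) (d : ℕ → Fin 2 → ℂ)
    (c₀ : Fin 2 → ℂ) : ℕ → Fin 2 → ℂ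
  | 0 => c₀
  | n + 1 => d (n + 1) *
      ∑ j : Fin (n + 1), v (n + 1 - j) • T (frobeniusCoeff v T d c₀ j)

theorem frobeniusCoeff_zero (v : ℕ → ℂ) (T : (Fin 2 → ℂ) →ₗ[ℂ] (Fin 2 → ℂ)) (d : ℕ → Fin 2 → ℂ)
    (c₀ : Fin 2 → ℂ) : frobeniusCoeff v T d c₀ 0 = c₀ := by
  rw [frobeniusCoeff]

theorem frobeniusCoeff_succ (v : ℕ → ℂ) (T : (Fin 2 → ℂ) →ₗ[ℂ] (Fin 2 → ℂ)) (d : ℕ → Fin 2 → ℂ)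
    (c₀ : Fin 2 → ℂ) (n : ℕ) : frobeniusCoeff v T d c₀ (n + 1) = d (n + 1) *
      ∑ j ∈ Finset.range (n + 1), v (n + 1 - j) • T (frobeniusCoeff v T d c₀ j) := by
  rw [frobeniusCoeff, Finset.sum_range]

theorem differentiableOn_frobeniusCoeff {v : ℕ → ℂ} {T : (Fin 2 → ℂ) →ₗ[ℂ] (Fin 2 → ℂ)}
    {d : ℂ → ℕ → Fin 2 → ℂ} {c₀ : Fin 2 → ℂ} {U : Set ℂ}
    (hd : ∀ n i, DifferentiableOn ℂ (fun z => d z (n + 1) i) U) (n : ℕ) :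
    DifferentiableOn ℂ (fun z => frobeniusCoeff v T (d z) c₀ n) U := by
  induction n using Nat.strong_induction_on with
  | _ n ih =>
    cases n with
    | zero => simp only [frobeniusCoeff_zero]; exact differentiableOn_const _
    | succ n =>
      simp only [frobeniusCoeff_succ]
      have h1 : DifferentiableOn ℂ (fun z => d z (n + 1)) U :=
        differentiableOn_pi.2 fun i => hd n i
      refine h1.mul (DifferentiableOn.fun_sum fun j hj => ?_)
      have h2 := ih j (Finset.mem_range.1 hj)
      have h3 : DifferentiableOn ℂ (fun z => T (frobeniusCoeff v T (d z) c₀ j)) U :=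
        (LinearMap.toContinuousLinearMap T).differentiable.comp_differentiableOn h2
      exact h3.const_smul (v (n + 1 - j))

theorem expSeries_apply {κ : ℝ} (hκ : 0 ≤ κ) {c : ℕ → Fin 2 → ℂ} {B ρ : ℝ}
    (hρ : 0 ≤ ρ) (hρ1 : ρ < 1) (hB : 0 ≤ B) (hc : ∀ n, ‖c n‖ ≤ B * ρ ^ n) (k : ℕ) {x : ℝ}
    (hx : 0 ≤ x) (i : Fin 2) :
    expSeries κ c k x i = expSeries κ (fun n => c n i) k x := by
  unfold expSeries
  rw [tsum_apply (summable_norm_expSeries hκ hρ hρ1 hB hc k hx).of_norm]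
  rfl

/-- An exponential series whose coefficients satisfy the Frobenius recursion solves the
differential equation conjugated by `e^{λx}`. -/
theorem expSeries_equation {κ : ℝ} (hκ : 0 ≤ κ) {c : ℕ → Fin 2 → ℂ} {B ρ : ℝ}
    (hρ : 0 ≤ ρ) (hρ1 : ρ < 1) (hB : 0 ≤ B) (hc : ∀ n, ‖c n‖ ≤ B * ρ ^ n)
    {v : ℕ → ℂ} (hv0 : v 0 = 0) {x : ℝ} (hx : 0 ≤ x)
    (hv : Summable fun n : ℕ => ‖v n * (Real.exp (-(n * κ * x)) : ℝ)‖)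
    (T : (Fin 2 → ℂ) →ₗ[ℂ] (Fin 2 → ℂ)) {lam : ℂ} {s : Fin 2 → ℂ}
    (hrec : ∀ n i, ((lam - n * κ) ^ 2 - s i) * c n i =
      ∑ j ∈ Finset.range n, v (n - j) * T (c j) i) (i : Fin 2) :
    lam ^ 2 * expSeries κ c 0 x i + 2 * lam * expSeries κ c 1 x i + expSeries κ c 2 x i =
      s i * expSeries κ c 0 x i +
        (∑' n : ℕ, v n * (Real.exp (-(n * κ * x)) : ℝ)) * T (expSeries κ c 0 x) i := by
  set T' := LinearMap.toContinuousLinearMap T with hT'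
  have hTc : ∀ n, ‖T (c n)‖ ≤ ‖T'‖ * B * ρ ^ n := fun n => by
    have := (T'.le_opNorm (c n)).trans (mul_le_mul_of_nonneg_left (hc n) (norm_nonneg _))
    rw [mul_assoc]; exact this
  have hsm := fun k => (summable_norm_expSeries hκ hρ hρ1 hB hc k hx)
  have hTs := summable_norm_expSeries hκ hρ hρ1 (by positivity) hTc 0 hx
  have hT0 : T (expSeries κ c 0 x) = expSeries κ (fun n => T (c n)) 0 x := by
    unfold expSeries
    have := T'.map_tsum (hsm 0).of_norm
    simpa [hT'] using this
  have hTs' : Summable fun n : ℕ => ‖((Real.exp (-(n * κ * x)) : ℝ) : ℂ) * T (c n) i‖ := by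
    refine Summable.of_nonneg_of_le (fun _ => norm_nonneg _) (fun n => ?_) hTs
    rw [pow_zero, one_mul, norm_smul, norm_mul]
    gcongr
    exact norm_le_pi_norm (T (c n)) i
  have hTi : T (expSeries κ c 0 x) i =
      ∑' n : ℕ, ((Real.exp (-(n * κ * x)) : ℝ) : ℂ) * T (c n) i := by
    rw [hT0, expSeries_apply hκ hρ hρ1 (by positivity) hTc 0 hx]
    simp [expSeries]
  have hcauchy := tsum_mul_tsum_eq_tsum_sum_range_of_summable_norm hTs' hv
  have hsi : ∀ k, Summable fun n : ℕ =>
      ((-(n * κ : ℝ) : ℂ) ^ k * (Real.exp (-(n * κ * x)) : ℝ)) * c n i := fun k => by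
    have := (Pi.summable.1 (hsm k).of_norm) i
    simpa using this
  have hsi0 := hsi 0
  simp only [pow_zero, one_mul] at hsi0
  have e : ∀ k, expSeries κ c k x i =
      ∑' n : ℕ, ((-(n * κ : ℝ) : ℂ) ^ k * (Real.exp (-(n * κ * x)) : ℝ)) * c n i := fun k => by
    rw [expSeries_apply hκ hρ hρ1 hB hc k hx]; rfl
  rw [hTi, mul_comm (∑' n : ℕ, v n * _), hcauchy, e 0, e 1, e 2, ← tsum_mul_left, ← tsum_mul_left,
    ← tsum_mul_left, ← ((hsi 0).mul_left _).tsum_add ((hsi 1).mul_left _),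
    ← (((hsi 0).mul_left _).add ((hsi 1).mul_left _)).tsum_add (hsi 2), ← sub_eq_iff_eq_add',
    ← ((((hsi 0).mul_left _).add ((hsi 1).mul_left _)).add (hsi 2)).tsum_sub ((hsi 0).mul_left _)]
  refine tsum_congr fun n => ?_
  -- The Cauchy product collects the coefficient of `e^{-nκx}`. Since `v 0 = 0`, the summand with
  -- index `n` drops out and only earlier coefficients remain, as in the recursion.
  have h1 : ∑ k ∈ Finset.range (n + 1), ((Real.exp (-(k * κ * x)) : ℝ) : ℂ) * T (c k) i *
      (v (n - k) * (Real.exp (-((n - k : ℕ) * κ * x)) : ℝ)) =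
      (Real.exp (-(n * κ * x)) : ℝ) * ∑ j ∈ Finset.range n, v (n - j) * T (c j) i := by
    rw [Finset.sum_range_succ, Nat.sub_self, hv0, zero_mul, mul_zero, add_zero, Finset.mul_sum]
    refine Finset.sum_congr rfl fun j hj => ?_
    have hj' := (Finset.mem_range.1 hj).le
    have : Real.exp (-(n * κ * x)) = Real.exp (-(j * κ * x)) * Real.exp (-((n - j : ℕ) * κ * x)) := by
      rw [← Real.exp_add, Nat.cast_sub hj']
      ring_nf
    rw [this]
    push_cast
    ring
  rw [h1, ← hrec]
  push_cast
  ring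

/-! ### The linearized system on the half line -/

/-- The exponential rate `κ` such that `Q_ω^p` is a power series in `e^{-κ|x|}`. -/
def potentialRate (p ω : ℝ) : ℝ := p * √(2 * ω)

/-- The coupling matrix `[[p + 2, p], [p, p + 2]]` as a linear map. -/
def coupling (p : ℝ) : (Fin 2 → ℂ) →ₗ[ℂ] (Fin 2 → ℂ) :=
  Matrix.mulVecLin !![(p : ℂ) + 2, (p : ℂ); (p : ℂ), (p : ℂ) + 2]

/-- The coefficients of the potential as a power series in `e^{-κ|x|}`. -/
def potentialCoeff (p ω θ : ℝ) (n : ℕ) : ℝ := 2 * (p + 2) * ω * (n * θ ^ n)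

/-- The potential `σ Q_ω^p` in closed form. -/
def potential (p ω θ x : ℝ) : ℝ :=
  2 * (p + 2) * ω * (θ * Real.exp (-(potentialRate p ω * |x|)) /
    (1 - θ * Real.exp (-(potentialRate p ω * |x|))) ^ 2)

theorem coupling_apply_zero (p : ℝ) (u : Fin 2 → ℂ) :
    coupling p u 0 = (p + 2) * u 0 + p * u 1 := by
  simp [coupling, Matrix.mulVec, dotProduct, Fin.sum_univ_two]

theorem coupling_apply_one (p : ℝ) (u : Fin 2 → ℂ) :
    coupling p u 1 = p * u 0 + (p + 2) * u 1 := by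
  simp [coupling, Matrix.mulVec, dotProduct, Fin.sum_univ_two]

theorem norm_coupling_le {p : ℝ} (hp : 0 ≤ p) (u : Fin 2 → ℂ) :
    ‖coupling p u‖ ≤ (2 * p + 2) * ‖u‖ := by
  have h0 := norm_le_pi_norm u 0
  have h1 := norm_le_pi_norm u 1
  have e1 : ‖(p : ℂ) + 2‖ = p + 2 := by
    rw [show (p : ℂ) + 2 = ((p + 2 : ℝ) : ℂ) by push_cast; rfl, Complex.norm_real,
      Real.norm_of_nonneg (by linarith)]
  have e2 : ‖(p : ℂ)‖ = p := by rw [Complex.norm_real, Real.norm_of_nonneg hp]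
  refine (pi_norm_le_iff_of_nonneg (by positivity)).2 fun i => ?_
  fin_cases i
  · simp only [Fin.zero_eta, coupling_apply_zero]
    refine (norm_add_le _ _).trans ?_
    rw [norm_mul, norm_mul, e1, e2]
    nlinarith
  · simp only [Fin.mk_one, coupling_apply_one]
    refine (norm_add_le _ _).trans ?_
    rw [norm_mul, norm_mul, e1, e2]
    nlinarith

theorem potentialRate_sq {p ω : ℝ} (hω : 0 < ω) : potentialRate p ω ^ 2 = 2 * p ^ 2 * ω := by
  rw [potentialRate, mul_pow, Real.sq_sqrt (by positivity)]; ring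

/-- Here the size of `p` matters: at `ξ = 0` the exponents `0` and `-2√ω` differ by `2√ω`, and
keeping `κ` well above this gap prevents the oscillating series from resonating. -/
theorem potentialRate_lower {p ω : ℝ} (hp : 4 < p) (hω : 0 < ω) :
    5 * √ω ≤ potentialRate p ω := by
  have h1 : (5 * √ω) ^ 2 ≤ potentialRate p ω ^ 2 := by
    rw [potentialRate_sq hω, mul_pow, Real.sq_sqrt hω.le]
    have : 16 ≤ p ^ 2 := by nlinarith
    nlinarith
  exact le_of_sq_le_sq h1 (by unfold potentialRate; positivity)

theorem potentialRate_pos {p ω : ℝ} (hp : 4 < p) (hω : 0 < ω) : 0 < potentialRate p ω := by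
  unfold potentialRate; positivity

/-- This is `∑ n yⁿ = y / (1 - y)²` at `y = θ e^{-κx}`. -/
theorem hasSum_potential {p ω θ : ℝ} (hp : 4 < p) (hω : 0 < ω) (hθ : |θ| < 1) {x : ℝ}
    (hx : 0 ≤ x) : Summable (fun n : ℕ => ‖((potentialCoeff p ω θ n : ℝ) : ℂ) *
        (Real.exp (-(n * potentialRate p ω * x)) : ℝ)‖) ∧
      ∑' n : ℕ, ((potentialCoeff p ω θ n : ℝ) : ℂ) *
        (Real.exp (-(n * potentialRate p ω * x)) : ℝ) = (potential p ω θ x : ℝ) := by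
  set y := θ * Real.exp (-(potentialRate p ω * x)) with hy
  have hκ := potentialRate_pos hp hω
  have hy1 : ‖y‖ < 1 := by
    rw [hy, norm_mul, Real.norm_eq_abs, Real.norm_of_nonneg (Real.exp_pos _).le]
    have : Real.exp (-(potentialRate p ω * x)) ≤ 1 := Real.exp_le_one_iff.2 (by
      have : 0 ≤ potentialRate p ω * x := by positivity
      linarith)
    calc |θ| * Real.exp (-(potentialRate p ω * x)) ≤ |θ| * 1 := by gcongr
      _ < 1 := by simpa using hθ
  have hterm : ∀ n : ℕ, potentialCoeff p ω θ n * Real.exp (-(n * potentialRate p ω * x)) =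
      2 * (p + 2) * ω * (n * y ^ n) := by
    intro n
    rw [hy, mul_pow, ← Real.exp_nat_mul, potentialCoeff]
    ring_nf
  have hs : HasSum (fun n : ℕ => 2 * (p + 2) * ω * (n * y ^ n))
      (2 * (p + 2) * ω * (y / (1 - y) ^ 2)) :=
    (hasSum_coe_mul_geometric_of_norm_lt_one hy1).mul_left _
  have hpot : potential p ω θ x = 2 * (p + 2) * ω * (y / (1 - y) ^ 2) := by
    rw [potential, abs_of_nonneg hx]
  constructor
  · have := hs.summable.norm
    refine this.congr fun n => ?_
    rw [← hterm, ← Complex.ofReal_mul, Complex.norm_real]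
  · simp_rw [← Complex.ofReal_mul, hterm]
    rw [← Complex.ofReal_tsum, hs.tsum_eq, hpot]

theorem abs_potential_le {p ω θ ρ₀ : ℝ} (hp : 4 < p) (hω : 0 < ω) (hθ : |θ| ≤ ρ₀) (hρ : ρ₀ < 1)
    (x : ℝ) : |potential p ω θ x| ≤
      2 * (p + 2) * ω / (1 - ρ₀) ^ 2 * Real.exp (-(potentialRate p ω * |x|)) := by
  have hκ := potentialRate_pos hp hω
  set e := Real.exp (-(potentialRate p ω * |x|)) with he
  have he0 : 0 < e := Real.exp_pos _
  have he1 : e ≤ 1 := Real.exp_le_one_iff.2 (by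
    have : 0 ≤ potentialRate p ω * |x| := by positivity
    linarith)
  have h1 : 1 - ρ₀ ≤ 1 - θ * e := by
    have : θ * e ≤ |θ| * 1 := by
      calc θ * e ≤ |θ| * e := by gcongr; exact le_abs_self θ
        _ ≤ |θ| * 1 := by gcongr
    linarith
  have h2 : 0 < 1 - ρ₀ := by linarith
  unfold potential
  have e2 : 2 * (p + 2) * ω / (1 - ρ₀) ^ 2 * e = 2 * (p + 2) * ω * (e / (1 - ρ₀) ^ 2) := by ring
  rw [← he, abs_mul, abs_div, abs_mul θ e, abs_of_nonneg he0.le, abs_of_nonneg (by positivity),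
    abs_of_nonneg (sq_nonneg (1 - θ * e)), e2]
  gcongr
  calc |θ| * e ≤ 1 * e := by gcongr; linarith
    _ = e := one_mul e

theorem continuous_potential {p ω θ : ℝ} (hp : 4 < p) (hω : 0 < ω) (hθ : |θ| < 1) :
    Continuous (potential p ω θ) := by
  have hκ := potentialRate_pos hp hω
  unfold potential
  refine continuous_const.mul (Continuous.div (by fun_prop) (by fun_prop) fun x => ?_)
  have he1 : Real.exp (-(potentialRate p ω * |x|)) ≤ 1 := Real.exp_le_one_iff.2 (by
    have : 0 ≤ potentialRate p ω * |x| := by positivity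
    linarith)
  have : θ * Real.exp (-(potentialRate p ω * |x|)) < 1 := by
    calc θ * Real.exp (-(potentialRate p ω * |x|))
        ≤ |θ| * Real.exp (-(potentialRate p ω * |x|)) := by gcongr; exact le_abs_self θ
      _ ≤ |θ| * 1 := by gcongr
      _ < 1 := by simpa using hθ
  have : 0 < 1 - θ * Real.exp (-(potentialRate p ω * |x|)) := by linarith
  positivity

/-! ### Lower bounds for the Frobenius denominators -/

theorem decayRate_sq {ω : ℝ} (hω : 0 < ω) (ξ : ℝ) : decayRate ω ξ ^ 2 = ξ ^ 2 + 4 * ω :=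
  Real.sq_sqrt (by positivity)

theorem decayRate_lower {ω : ℝ} (hω : 0 < ω) (ξ : ℝ) : 2 * √ω ≤ decayRate ω ξ := by
  apply Real.le_sqrt_of_sq_le
  rw [mul_pow, Real.sq_sqrt hω.le]
  nlinarith [sq_nonneg ξ]

theorem decayRate_pos {ω : ℝ} (hω : 0 < ω) (ξ : ℝ) : 0 < decayRate ω ξ :=
  lt_of_lt_of_le (by positivity) (decayRate_lower hω ξ)

theorem abs_le_decayRate {ω : ℝ} (hω : 0 < ω) (ξ : ℝ) : |ξ| ≤ decayRate ω ξ := by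
  apply Real.le_sqrt_of_sq_le
  rw [sq_abs]
  linarith

theorem decayRate_le {ω : ℝ} (hω : 0 < ω) (ξ : ℝ) : decayRate ω ξ ≤ |ξ| + 2 * √ω := by
  apply Real.sqrt_le_iff.2 ⟨by positivity, ?_⟩
  have := Real.sq_sqrt hω.le
  nlinarith [sq_abs ξ, abs_nonneg ξ, Real.sqrt_nonneg ω, mul_nonneg (abs_nonneg ξ) (Real.sqrt_nonneg ω)]

/-- The expression factors as `N (N - 2iz)`; the real part of the second factor is close to `N` and
its imaginary part is close to `-2ξ`. A disc of radius of order `√ω` suffices, since the weight for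
`f₁`, `f₂` asks for no gain in `μ` from derivatives in `ξ`. -/
theorem oscillating_denominator_zero {ω N ξ : ℝ} (hω : 0 < ω) (hN : 5 * √ω ≤ N) {z : ℂ}
    (hz : ‖z - ξ‖ ≤ √ω / 10) :
    N * (N + decayRate ω ξ) / 6 ≤ ‖(Complex.I * z - N) ^ 2 + z ^ 2‖ := by
  have hs : 0 < √ω := Real.sqrt_pos.2 hω
  have hN0 : 0 < N := by linarith
  have hμ := decayRate_le hω ξ
  have e : (Complex.I * z - N) ^ 2 + z ^ 2 = N * (N - 2 * Complex.I * z) := by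
    ring_nf
    simp only [Complex.I_sq]
    ring
  rw [e, norm_mul, Complex.norm_real, Real.norm_of_nonneg hN0.le, mul_div_assoc]
  gcongr
  have hre := (Complex.abs_re_le_norm (z - ξ)).trans hz
  have him := (Complex.abs_im_le_norm (z - ξ)).trans hz
  simp only [Complex.sub_re, Complex.sub_im, Complex.ofReal_re, Complex.ofReal_im, sub_zero]
    at hre him
  have h1 := Complex.abs_re_le_norm ((N : ℂ) - 2 * Complex.I * z)
  have h2 := Complex.abs_im_le_norm ((N : ℂ) - 2 * Complex.I * z)
  simp only [Complex.sub_re, Complex.sub_im, Complex.ofReal_re, Complex.ofReal_im,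
    Complex.mul_re, Complex.mul_im, Complex.I_re, Complex.I_im, Complex.re_ofNat,
    Complex.im_ofNat] at h1 h2
  norm_num at h1 h2
  have h3 := (le_abs_self _).trans h1
  have h4 : |ξ| ≤ |z.re| + √ω / 10 := by
    have := abs_sub_abs_le_abs_sub ξ z.re
    rw [abs_sub_comm] at this
    linarith
  have h5 := neg_abs_le z.im
  linarith

/-- At `z = ξ` the squared modulus is `N⁴ - 8ωN² + Y²` with `Y = 2ξ² + 4ω`, and `N² ≥ 25ω` absorbs
the negative term. Moving `z` inside the disc changes the value by at most a quarter of the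
resulting lower bound. -/
theorem oscillating_denominator_one {ω N ξ : ℝ} (hω : 0 < ω) (hN : 5 * √ω ≤ N) {z : ℂ}
    (hz : ‖z - ξ‖ ≤ √ω / 10) :
    N * (N + decayRate ω ξ) / 6 ≤ ‖(Complex.I * z - N) ^ 2 - (z ^ 2 + 4 * ω)‖ := by
  have hs : 0 < √ω := Real.sqrt_pos.2 hω
  have hN0 : 0 < N := by linarith
  have hμ := decayRate_sq hω ξ
  have hsq := Real.sq_sqrt hω.le
  set s := √ω with hsdef
  set Y := 2 * ξ ^ 2 + 4 * ω with hY
  have hXω : 25 * ω ≤ N ^ 2 := by nlinarith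
  set P : ℂ := (Complex.I * ξ - N) ^ 2 - (ξ ^ 2 + 4 * ω) with hP
  have hPn : (N ^ 2 + Y) / 2 ≤ ‖P‖ := by
    have e : P = ((N ^ 2 - 2 * ξ ^ 2 - 4 * ω : ℝ) : ℂ) + ((-2 * N * ξ : ℝ) : ℂ) * Complex.I := by
      rw [hP]
      push_cast
      ring_nf
      simp only [Complex.I_sq]
      ring
    have e2 : ‖P‖ ^ 2 = (N ^ 2 - 2 * ξ ^ 2 - 4 * ω) ^ 2 + (-2 * N * ξ) ^ 2 := by
      rw [e, ← Complex.normSq_eq_norm_sq, Complex.normSq_add_mul_I]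
    refine le_of_sq_le_sq ?_ (norm_nonneg _)
    rw [e2]
    have hY0 : 0 ≤ Y := by positivity
    have e3 : (N ^ 2 - 2 * ξ ^ 2 - 4 * ω) ^ 2 + (-2 * N * ξ) ^ 2 =
      (N ^ 2) ^ 2 - 8 * ω * N ^ 2 + Y ^ 2 := by rw [hY]; ring
    rw [e3]
    nlinarith [sq_nonneg (N ^ 2 - Y), sq_nonneg (N ^ 2), sq_nonneg N]
  have hdiff : ‖((Complex.I * z - N) ^ 2 - (z ^ 2 + 4 * ω)) - P‖ ≤ (N ^ 2 + Y) / 8 := by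
    have e : ((Complex.I * z - N) ^ 2 - (z ^ 2 + 4 * ω)) - P =
        -(z - ξ) * (2 * (z - ξ) + 4 * ξ + 2 * N * Complex.I) := by
      rw [hP]
      ring_nf
      simp only [Complex.I_sq]
      ring
    have h1 : ‖2 * (z - ξ) + 4 * ξ + 2 * N * Complex.I‖ ≤ 2 * (s / 10) + 4 * |ξ| + 2 * N := by
      refine (norm_add₃_le).trans ?_
      rw [norm_mul, norm_mul, norm_mul, norm_mul, Complex.norm_I, Complex.norm_real,
        Complex.norm_real, Real.norm_of_nonneg hN0.le, Real.norm_eq_abs, Complex.norm_ofNat,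
        Complex.norm_ofNat]
      linarith
    rw [e, norm_mul, norm_neg]
    calc ‖z - ξ‖ * ‖2 * (z - ξ) + 4 * ξ + 2 * N * Complex.I‖
        ≤ s / 10 * (2 * (s / 10) + 4 * |ξ| + 2 * N) := by gcongr
      _ ≤ _ := by
        rw [hY]
        nlinarith [sq_nonneg (|ξ| - s), sq_abs ξ, sq_nonneg (N - 5 * s)]
  have h3 := norm_sub_norm_le P (P - ((Complex.I * z - N) ^ 2 - (z ^ 2 + 4 * ω)))
  rw [sub_sub_cancel, norm_sub_rev P] at h3
  have h4 : N * (N + decayRate ω ξ) / 6 ≤ (N ^ 2 + Y) / 4 := by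
    nlinarith [sq_nonneg (N - decayRate ω ξ), sq_nonneg ξ]
  have : 0 ≤ N ^ 2 + Y := by positivity
  linarith

/-- The holomorphic continuation of `decayRate`. -/
def complexRate (ω : ℝ) (z : ℂ) : ℂ := Complex.sqrt (z ^ 2 + 4 * ω)

theorem complexRate_sq (ω : ℝ) (z : ℂ) : complexRate ω z ^ 2 = z ^ 2 + 4 * ω := by
  unfold complexRate Complex.sqrt
  have h := Complex.cpow_nat_inv_pow (z ^ 2 + 4 * (ω : ℂ)) (n := 2) two_ne_zero
  rwa [Nat.cast_ofNat] at h

theorem complexRate_ofReal {ω : ℝ} (hω : 0 < ω) (ξ : ℝ) :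
    complexRate ω ξ = decayRate ω ξ := by
  have h : (0 : ℝ) ≤ ξ ^ 2 + 4 * ω := by positivity
  unfold complexRate decayRate Complex.sqrt
  rw [Real.sqrt_eq_rpow, Complex.ofReal_cpow h]
  push_cast
  norm_num

theorem norm_sq_sub_le {ω ξ : ℝ} (hω : 0 < ω) {z : ℂ} (hz : ‖z - ξ‖ ≤ decayRate ω ξ / 16) :
    ‖(z ^ 2 + 4 * ω) - ((decayRate ω ξ ^ 2 : ℝ) : ℂ)‖ ≤ decayRate ω ξ ^ 2 / 7 := by
  have hμ := decayRate_pos hω ξ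
  have hξ := abs_le_decayRate hω ξ
  have e : (z ^ 2 + 4 * ω) - ((decayRate ω ξ ^ 2 : ℝ) : ℂ) = (z - ξ) * ((z - ξ) + 2 * ξ) := by
    rw [decayRate_sq hω]
    push_cast
    ring
  have h1 : ‖(z - ξ) + 2 * ξ‖ ≤ decayRate ω ξ / 16 + 2 * decayRate ω ξ := by
    refine (norm_add_le _ _).trans ?_
    rw [norm_mul, Complex.norm_real, Real.norm_eq_abs, Complex.norm_ofNat]
    linarith
  rw [e, norm_mul]
  calc ‖z - ξ‖ * ‖(z - ξ) + 2 * ξ‖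
      ≤ decayRate ω ξ / 16 * (decayRate ω ξ / 16 + 2 * decayRate ω ξ) := by gcongr
    _ ≤ _ := by nlinarith

/-- On this disc `z² + 4ω` stays within `μ²/7` of `μ²`, hence off the branch cut, and its root is
comparable to `μ`. -/
theorem complexRate_bounds {ω ξ : ℝ} (hω : 0 < ω) {z : ℂ} (hz : ‖z - ξ‖ ≤ decayRate ω ξ / 16) :
    9 / 10 * decayRate ω ξ ≤ (complexRate ω z).re ∧ ‖complexRate ω z‖ ≤ 2 * decayRate ω ξ ∧
      z ^ 2 + 4 * ω ∈ Complex.slitPlane := by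
  have hμ := decayRate_pos hω ξ
  have h := norm_sq_sub_le hω hz
  set a := z ^ 2 + 4 * (ω : ℂ) with ha
  have hre := (Complex.abs_re_le_norm _).trans h
  rw [Complex.sub_re, Complex.ofReal_re] at hre
  have hre' := (abs_le.1 hre).1
  have hare : 6 / 7 * decayRate ω ξ ^ 2 ≤ a.re := by linarith
  have hnorm : ‖a‖ ≤ 8 / 7 * decayRate ω ξ ^ 2 := by
    have := norm_le_norm_sub_add a ((decayRate ω ξ ^ 2 : ℝ) : ℂ)
    rw [Complex.norm_real, Real.norm_of_nonneg (by positivity)] at this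
    linarith
  refine ⟨?_, ?_, ?_⟩
  · unfold complexRate Complex.sqrt
    rw [← ha, Complex.cpow_inv_two_re]
    apply Real.le_sqrt_of_sq_le
    have := Complex.re_le_norm a
    nlinarith
  · have h2 : ‖complexRate ω z‖ ^ 2 = ‖a‖ := by rw [← norm_pow, complexRate_sq]
    refine le_of_sq_le_sq ?_ (by positivity)
    rw [h2]
    nlinarith
  · left
    have : 0 < decayRate ω ξ ^ 2 := by positivity
    linarith

theorem complexRate_differentiableAt {ω ξ : ℝ} (hω : 0 < ω) {z : ℂ}
    (hz : ‖z - ξ‖ ≤ decayRate ω ξ / 16) : DifferentiableAt ℂ (complexRate ω) z := by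
  unfold complexRate Complex.sqrt
  exact DifferentiableAt.cpow_const (by fun_prop) (complexRate_bounds hω hz).2.2

theorem complexRate_re_add {ω ξ : ℝ} (hω : 0 < ω) {z : ℂ} (hz : ‖z - ξ‖ ≤ decayRate ω ξ / 16) :
    4 / 5 * decayRate ω ξ ≤ (complexRate ω z + Complex.I * z).re ∧
      4 / 5 * decayRate ω ξ ≤ (complexRate ω z - Complex.I * z).re := by
  have h1 := (complexRate_bounds hω hz).1
  have him := (Complex.abs_im_le_norm (z - ξ)).trans hz
  simp only [Complex.sub_im, Complex.ofReal_im, sub_zero] at him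
  have hμ := decayRate_pos hω ξ
  obtain ⟨h2, h3⟩ := abs_le.1 him
  simp only [Complex.add_re, Complex.sub_re, Complex.mul_re, Complex.I_re, Complex.I_im]
  constructor <;> linarith

/-- With `m` the complex rate this is `(N + m + iz)(N + m - iz)`, and both factors have real part at
least `N + 4μ/5`. The bound is at least of order `μ²` for every `N`, which later gives the first
component of `f₃` an extra factor `μ⁻¹`. -/
theorem decaying_denominator_zero {ω N ξ : ℝ} (hω : 0 < ω) (hN : 0 ≤ N) {z : ℂ}
    (hz : ‖z - ξ‖ ≤ decayRate ω ξ / 16) :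
    (N + 4 / 5 * decayRate ω ξ) ^ 2 ≤ ‖(-complexRate ω z - N) ^ 2 + z ^ 2‖ := by
  obtain ⟨h1, h2⟩ := complexRate_re_add hω hz
  have hμ := decayRate_pos hω ξ
  set m := complexRate ω z
  have e : (-m - N) ^ 2 + z ^ 2 = (N + (m + Complex.I * z)) * (N + (m - Complex.I * z)) := by
    ring_nf
    simp only [Complex.I_sq]
    ring
  rw [e, norm_mul, sq]
  have h3 := Complex.re_le_norm ((N : ℂ) + (m + Complex.I * z))
  have h4 := Complex.re_le_norm ((N : ℂ) + (m - Complex.I * z))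
  rw [Complex.add_re, Complex.ofReal_re] at h3 h4
  gcongr <;> linarith

theorem decaying_denominator_one {ω N ξ : ℝ} (hω : 0 < ω) (hN : 0 ≤ N) {z : ℂ}
    (hz : ‖z - ξ‖ ≤ decayRate ω ξ / 16) :
    N * (N + decayRate ω ξ) ≤ ‖(-complexRate ω z - N) ^ 2 - (z ^ 2 + 4 * ω)‖ := by
  have h1 := (complexRate_bounds hω hz).1
  have hμ := decayRate_pos hω ξ
  rw [← complexRate_sq]
  set m := complexRate ω z
  have e : (-m - N) ^ 2 - m ^ 2 = N * (N + 2 * m) := by ring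
  rw [e, norm_mul, Complex.norm_real, Real.norm_of_nonneg hN]
  gcongr
  have h3 := Complex.re_le_norm ((N : ℂ) + 2 * m)
  simp only [Complex.add_re, Complex.ofReal_re, Complex.mul_re, Complex.re_ofNat,
    Complex.im_ofNat, zero_mul, sub_zero] at h3
  linarith

/-! ### The Frobenius solutions of the linearized system -/

/-- The symbol `(-w, w + 4ω)` of the unperturbed system `f'' = (-w, w + 4ω) f`. -/
def symbol (ω : ℝ) (w : ℂ) : Fin 2 → ℂ := ![-w, w + 4 * ω]

/-- Denominators of the Frobenius recursion with exponent `lam`. -/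
def frobeniusDenominator (p ω : ℝ) (lam z : ℂ) (n : ℕ) (i : Fin 2) : ℂ :=
  (lam - n * potentialRate p ω) ^ 2 - symbol ω (z ^ 2) i

/-- Coefficients of the Frobenius solution `e^{lam x} ∑ n, e^{-nκx} c n`. -/
def solutionCoeff (p ω θ : ℝ) (lam z : ℂ) (c₀ : Fin 2 → ℂ) : ℕ → Fin 2 → ℂ :=
  frobeniusCoeff (fun n => (potentialCoeff p ω θ n : ℂ)) (coupling p)
    (fun n i => (frobeniusDenominator p ω lam z n i)⁻¹) c₀

/-- The exponent `lam` solves the indicial equation for `c₀` and is not in resonance, in a way that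
is quantified by `μ`. -/
structure IsFrobeniusExponent (p ω μ : ℝ) (lam z : ℂ) (c₀ : Fin 2 → ℂ) : Prop where
  norm_le : ‖c₀‖ ≤ 1
  indicial : ∀ i, (lam ^ 2 - symbol ω (z ^ 2) i) * c₀ i = 0
  denominator : ∀ (n : ℕ) i, ((n : ℝ) + 1) * potentialRate p ω *
    (((n : ℝ) + 1) * potentialRate p ω + μ) / 6 ≤ ‖frobeniusDenominator p ω lam z (n + 1) i‖

theorem solutionCoeff_recursion {p ω θ μ : ℝ} (hp : 4 < p) (hω : 0 < ω) (hμ : 0 < μ) {lam z : ℂ}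
    {c₀ : Fin 2 → ℂ} (h : IsFrobeniusExponent p ω μ lam z c₀) (n : ℕ) (i : Fin 2) :
    ((lam - n * potentialRate p ω) ^ 2 - symbol ω (z ^ 2) i) * solutionCoeff p ω θ lam z c₀ n i =
      ∑ j ∈ Finset.range n, (potentialCoeff p ω θ (n - j) : ℂ) *
        coupling p (solutionCoeff p ω θ lam z c₀ j) i := by
  have hκ := potentialRate_pos hp hω
  cases n with
  | zero => simpa [solutionCoeff, frobeniusCoeff_zero] using h.indicial i
  | succ n =>
    have h1 := h.denominator n i
    have h2 : 0 < ((n : ℝ) + 1) * potentialRate p ω *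
      (((n : ℝ) + 1) * potentialRate p ω + μ) / 6 := by positivity
    have h3 : frobeniusDenominator p ω lam z (n + 1) i ≠ 0 := norm_pos_iff.1 (h2.trans_le h1)
    rw [solutionCoeff, frobeniusCoeff_succ, Pi.mul_apply, ← mul_assoc]
    change frobeniusDenominator p ω lam z (n + 1) i * _ * _ = _
    rw [mul_inv_cancel₀ h3, one_mul, Finset.sum_apply]
    rfl

/-- Three ways to spend the denominators: `(nκ)²` feeds the majorant, `κμ` gives smallness in `μ`
for `n ≥ 1`, and a separate lower bound `D` improves the first component. In the majorant the ratio
`ω / κ²` depends on `p` alone, so `B` is uniform in `ω`. -/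
theorem exists_solutionCoeff_bound {p ρ₀ : ℝ} (hp : 4 < p) (hρ0 : 0 ≤ ρ₀) (hρ1 : ρ₀ < 1) :
    ∃ B, 0 < B ∧ ∀ ω θ μ : ℝ, 0 < ω → |θ| ≤ ρ₀ → 0 < μ → ∀ (lam z : ℂ) (c₀ : Fin 2 → ℂ),
      IsFrobeniusExponent p ω μ lam z c₀ →
      (∀ n, ‖solutionCoeff p ω θ lam z c₀ n‖ ≤ B * ((1 + ρ₀) / 2) ^ n) ∧
      (∀ n, ‖solutionCoeff p ω θ lam z c₀ (n + 1)‖ ≤ B * √ω / μ * ((1 + ρ₀) / 2) ^ (n + 1)) ∧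
      ∀ D, 0 < D → (∀ n : ℕ, D ≤ ‖frobeniusDenominator p ω lam z (n + 1) 0‖) →
        ∀ n, ‖solutionCoeff p ω θ lam z c₀ (n + 1) 0‖ ≤ B * ω / D * ((1 + ρ₀) / 2) ^ (n + 1) := by
  set A := (2 * p + 2) * (2 * (p + 2)) with hA
  have hA1 : 1 ≤ A := by nlinarith
  have hp0 : 0 < p := by linarith
  obtain ⟨B, hB, hmaj⟩ := exists_frobenius_majorant (3 * A / p ^ 2) (by positivity) hρ0
    (by linarith : ρ₀ < (1 + ρ₀) / 2)
  refine ⟨6 * A * B, by positivity, fun ω θ μ hω hθ hμ lam z c₀ h => ?_⟩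
  set c := solutionCoeff p ω θ lam z c₀ with hc
  have hκ := potentialRate_pos hp hω
  have hκ2 := potentialRate_sq (p := p) hω
  set κ := potentialRate p ω with hκdef
  have hcoef : ∀ m : ℕ, ‖(potentialCoeff p ω θ m : ℂ)‖ ≤ 2 * (p + 2) * ω * (m * ρ₀ ^ m) := by
    intro m
    rw [Complex.norm_real, potentialCoeff, norm_mul (2 * (p + 2) * ω), norm_mul (m : ℝ), norm_pow, Real.norm_eq_abs θ,
      Real.norm_of_nonneg (by positivity : (0:ℝ) ≤ 2 * (p + 2) * ω), Real.norm_natCast]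
    gcongr
  set S : ℕ → ℝ := fun n => ∑ j ∈ Finset.range n, ((n - j : ℕ) : ℝ) * ρ₀ ^ (n - j) * ‖c j‖ with hS
  have hS0 : ∀ n, 0 ≤ S n := fun n => Finset.sum_nonneg fun j _ => by positivity
  have hsrc : ∀ n, ‖∑ j ∈ Finset.range n, (potentialCoeff p ω θ (n - j) : ℂ) • coupling p (c j)‖ ≤
      A * ω * S n := by
    intro n
    refine (norm_sum_le _ _).trans ?_
    rw [hS, Finset.mul_sum]
    refine Finset.sum_le_sum fun j _ => ?_
    rw [norm_smul]
    calc ‖(potentialCoeff p ω θ (n - j) : ℂ)‖ * ‖coupling p (c j)‖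
        ≤ 2 * (p + 2) * ω * ((n - j : ℕ) * ρ₀ ^ (n - j)) * ((2 * p + 2) * ‖c j‖) :=
          mul_le_mul (hcoef _) (norm_coupling_le hp0.le _) (norm_nonneg _) (by positivity)
      _ = _ := by rw [hA]; ring
  have hsucc : ∀ n i, ‖c (n + 1) i‖ ≤
      ‖frobeniusDenominator p ω lam z (n + 1) i‖⁻¹ * (A * ω * S (n + 1)) := by
    intro n i
    rw [hc, solutionCoeff, frobeniusCoeff_succ, Pi.mul_apply, norm_mul, norm_inv]
    gcongr
    exact (norm_le_pi_norm _ i).trans (hsrc (n + 1))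
  have hden : ∀ (n : ℕ) i, ‖frobeniusDenominator p ω lam z (n + 1) i‖⁻¹ ≤
      6 / (((n : ℝ) + 1) * κ * (((n : ℝ) + 1) * κ + μ)) := by
    intro n i
    have h1 := h.denominator n i
    rw [← hκdef] at h1
    have h2 : 0 < ((n : ℝ) + 1) * κ * (((n : ℝ) + 1) * κ + μ) / 6 := by positivity
    have := inv_anti₀ h2 h1
    rwa [inv_div] at this
  have hrec : ∀ n : ℕ, ‖c (n + 1)‖ ≤ 3 * A / p ^ 2 / ((n : ℝ) + 1) ^ 2 * S (n + 1) := by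
    intro n
    refine (pi_norm_le_iff_of_nonneg (mul_nonneg (by positivity) (hS0 _))).2 fun i => ?_
    have hd2 : ‖frobeniusDenominator p ω lam z (n + 1) i‖⁻¹ ≤ 6 / (((n : ℝ) + 1) ^ 2 * κ ^ 2) := by
      refine (hden n i).trans ?_
      apply div_le_div_of_nonneg_left (by norm_num) (by positivity)
      have : 0 ≤ ((n : ℝ) + 1) * κ * μ := by positivity
      nlinarith
    calc ‖c (n + 1) i‖ ≤ 6 / (((n : ℝ) + 1) ^ 2 * κ ^ 2) * (A * ω * S (n + 1)) :=
          (hsucc n i).trans (mul_le_mul_of_nonneg_right hd2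
            (mul_nonneg (by positivity) (hS0 _)))
      _ = _ := by
        rw [hκ2]
        field_simp
        ring
  have hm := hmaj (fun n => ‖c n‖) (fun n => norm_nonneg _)
    (by simpa [hc, solutionCoeff, frobeniusCoeff_zero] using h.norm_le) hrec
  have hSb : ∀ n, S n ≤ B * ((1 + ρ₀) / 2) ^ n := fun n => (hm n).2
  refine ⟨fun n => (hm n).1.trans ?_, fun n => ?_, fun D hD hDle n => ?_⟩
  · gcongr
    nlinarith
  · refine (pi_norm_le_iff_of_nonneg (by positivity)).2 fun i => ?_
    have hd2 : ‖frobeniusDenominator p ω lam z (n + 1) i‖⁻¹ ≤ 6 / (κ * μ) := by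
      refine (hden n i).trans ?_
      apply div_le_div_of_nonneg_left (by norm_num) (by positivity)
      have h1 : 0 ≤ (n : ℝ) * (κ * μ) := by positivity
      have h2 : 0 ≤ ((n : ℝ) + 1) * κ * (((n : ℝ) + 1) * κ) := by positivity
      nlinarith
    have hωκ : ω / κ ≤ √ω := by
      rw [div_le_iff₀ hκ]
      have := potentialRate_lower hp hω
      have h3 := Real.mul_self_sqrt hω.le
      have h4 := Real.sqrt_nonneg ω
      nlinarith
    calc ‖c (n + 1) i‖ ≤ 6 / (κ * μ) * (A * ω * (B * ((1 + ρ₀) / 2) ^ (n + 1))) := by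
          refine (hsucc n i).trans (mul_le_mul hd2 ?_ (mul_nonneg (by positivity) (hS0 _))
            (by positivity))
          gcongr
          exact hSb (n + 1)
      _ = 6 * A * B * (ω / κ) / μ * ((1 + ρ₀) / 2) ^ (n + 1) := by
          field_simp
      _ ≤ _ := by gcongr
  · calc ‖c (n + 1) 0‖ ≤ D⁻¹ * (A * ω * (B * ((1 + ρ₀) / 2) ^ (n + 1))) := by
          refine (hsucc n 0).trans (mul_le_mul (inv_anti₀ hD (hDle n)) ?_
            (mul_nonneg (by positivity) (hS0 _)) (by positivity))
          gcongr
          exact hSb (n + 1)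
      _ = 1 * A * B * ω / D * ((1 + ρ₀) / 2) ^ (n + 1) := by field_simp
      _ ≤ _ := by gcongr; norm_num

theorem isFrobeniusExponent_oscillating {p ω ξ : ℝ} (hp : 4 < p) (hω : 0 < ω) {z : ℂ}
    (hz : ‖z - ξ‖ ≤ √ω / 10) :
    IsFrobeniusExponent p ω (decayRate ω ξ) (Complex.I * z) z ![1, 0] where
  norm_le := (pi_norm_le_iff_of_nonneg zero_le_one).2 fun i => by fin_cases i <;> simp
  indicial i := by
    fin_cases i
    · simp [symbol, mul_pow]
    · simp
  denominator n i := by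
    have hN : 5 * √ω ≤ ((n : ℝ) + 1) * potentialRate p ω := by
      have h1 := potentialRate_lower hp hω
      have h2 : 0 ≤ (n : ℝ) * potentialRate p ω :=
        mul_nonneg n.cast_nonneg (potentialRate_pos hp hω).le
      linarith
    fin_cases i
    · have := oscillating_denominator_zero hω hN hz
      simpa [frobeniusDenominator, symbol] using this
    · have := oscillating_denominator_one hω hN hz
      simpa [frobeniusDenominator, symbol] using this

theorem isFrobeniusExponent_decaying {p ω ξ : ℝ} (hp : 4 < p) (hω : 0 < ω) {z : ℂ}
    (hz : ‖z - ξ‖ ≤ decayRate ω ξ / 16) :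
    IsFrobeniusExponent p ω (decayRate ω ξ) (-complexRate ω z) z ![0, 1] where
  norm_le := (pi_norm_le_iff_of_nonneg zero_le_one).2 fun i => by fin_cases i <;> simp
  indicial i := by
    fin_cases i
    · simp
    · simp [symbol, complexRate_sq]
  denominator n i := by
    have hκ := potentialRate_pos hp hω
    have hμ := decayRate_pos hω ξ
    have hN : 0 ≤ ((n : ℝ) + 1) * potentialRate p ω := by positivity
    fin_cases i
    · have h := decaying_denominator_zero hω hN hz
      refine le_trans ?_ (le_of_le_of_eq h ?_)
      · set N := ((n : ℝ) + 1) * potentialRate p ω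
        nlinarith [mul_nonneg hN hμ.le]
      · simp [frobeniusDenominator, symbol]
    · have h := decaying_denominator_one hω hN hz
      refine le_trans ?_ (le_of_le_of_eq h ?_)
      · set N := ((n : ℝ) + 1) * potentialRate p ω
        nlinarith [mul_nonneg hN hμ.le]
      · simp [frobeniusDenominator, symbol]

theorem decaying_denominator_lower {p ω ξ : ℝ} (hp : 4 < p) (hω : 0 < ω) {z : ℂ}
    (hz : ‖z - ξ‖ ≤ decayRate ω ξ / 16) (n : ℕ) :
    decayRate ω ξ ^ 2 / 2 ≤ ‖frobeniusDenominator p ω (-complexRate ω z) z (n + 1) 0‖ := by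
  have hκ := potentialRate_pos hp hω
  have hμ := decayRate_pos hω ξ
  have hN : 0 ≤ ((n : ℝ) + 1) * potentialRate p ω := by positivity
  have h := decaying_denominator_zero hω hN hz
  refine le_trans ?_ (le_of_le_of_eq h ?_)
  · set N := ((n : ℝ) + 1) * potentialRate p ω
    nlinarith [mul_nonneg hN hμ.le]
  · simp [frobeniusDenominator, symbol]

/-! ### The first-order system -/

/-- Cauchy data `(f, f')`. -/
abbrev CauchyData : Type := (Fin 2 → ℂ) × (Fin 2 → ℂ)

/-- The first-order system equivalent to `f'' = (-w, w + 4ω) f + V M f`. -/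
def systemOp (p ω θ x : ℝ) (w : ℂ) : CauchyData →L[ℂ] CauchyData :=
  LinearMap.toContinuousLinearMap
      ((LinearMap.snd ℂ (Fin 2 → ℂ) (Fin 2 → ℂ)).prod
        ((LinearMap.mulLeft ℂ (![0, 4 * ω] : Fin 2 → ℂ)) ∘ₗ LinearMap.fst ℂ _ _)) +
    w • LinearMap.toContinuousLinearMap
      ((0 : CauchyData →ₗ[ℂ] Fin 2 → ℂ).prod
        ((LinearMap.mulLeft ℂ (![-1, 1] : Fin 2 → ℂ)) ∘ₗ LinearMap.fst ℂ _ _)) +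
    (potential p ω θ x : ℂ) • LinearMap.toContinuousLinearMap
      ((0 : CauchyData →ₗ[ℂ] Fin 2 → ℂ).prod (coupling p ∘ₗ LinearMap.fst ℂ _ _))

theorem systemOp_apply (p ω θ x : ℝ) (w : ℂ) (e : CauchyData) :
    systemOp p ω θ x w e =
      (e.2, symbol ω w * e.1 + (potential p ω θ x : ℂ) • coupling p e.1) := by
  refine Prod.ext ?_ ?_
  · simp [systemOp]
  · ext i
    fin_cases i <;> simp [systemOp, symbol] <;> ring

theorem continuous_systemOp {p ω θ : ℝ} (hp : 4 < p) (hω : 0 < ω) (hθ : |θ| < 1) :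
    Continuous (Function.uncurry (systemOp p ω θ)) := by
  have := continuous_potential hp hω hθ
  unfold systemOp Function.uncurry
  fun_prop

theorem differentiable_systemOp (p ω θ x : ℝ) : Differentiable ℂ (systemOp p ω θ x) := by
  unfold systemOp
  fun_prop

/-- The Cauchy data of the Frobenius solution. -/
def frobeniusData (p ω θ : ℝ) (lam z : ℂ) (c₀ : Fin 2 → ℂ) (x : ℝ) : CauchyData :=
  (Complex.exp (lam * x) • expSeries (potentialRate p ω) (solutionCoeff p ω θ lam z c₀) 0 x,
    Complex.exp (lam * x) • (lam • expSeries (potentialRate p ω) (solutionCoeff p ω θ lam z c₀) 0 x +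
      expSeries (potentialRate p ω) (solutionCoeff p ω θ lam z c₀) 1 x))

theorem hasDerivAt_cexp_mul (lam : ℂ) (x : ℝ) :
    HasDerivAt (fun x : ℝ => Complex.exp (lam * x)) (Complex.exp (lam * x) * lam) x := by
  have : HasDerivAt (fun x : ℂ => Complex.exp (lam * x)) (Complex.exp (lam * x) * lam) (x : ℂ) := by
    simpa using ((hasDerivAt_id (x : ℂ)).const_mul lam).cexp
  exact this.comp_ofReal

theorem hasDerivAt_frobeniusData {p ω θ μ : ℝ} (hp : 4 < p) (hω : 0 < ω) (hθ : |θ| < 1)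
    (hμ : 0 < μ) {lam z : ℂ} {c₀ : Fin 2 → ℂ} (h : IsFrobeniusExponent p ω μ lam z c₀)
    {x : ℝ} (hx : 0 ≤ x) :
    HasDerivAt (frobeniusData p ω θ lam z c₀)
      (systemOp p ω θ x (z ^ 2) (frobeniusData p ω θ lam z c₀ x)) x := by
  obtain ⟨B, hB, hbound⟩ := exists_solutionCoeff_bound hp (abs_nonneg θ) hθ
  obtain ⟨hb, -, -⟩ := hbound ω θ μ hω le_rfl hμ lam z c₀ h
  have hκ := potentialRate_pos hp hω
  have hρ : 0 ≤ (1 + |θ|) / 2 := by positivity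
  have hρ1 : (1 + |θ|) / 2 < 1 := by linarith
  have hd := fun k => hasDerivAt_expSeries hκ hρ hρ1 hB.le hb k hx
  have hV := hasSum_potential hp hω hθ hx
  have heq := expSeries_equation hκ.le hρ hρ1 hB.le hb (v := fun n => (potentialCoeff p ω θ n : ℂ))
    (by simp [potentialCoeff]) hx hV.1 (coupling p) (solutionCoeff_recursion hp hω hμ h)
  rw [hV.2] at heq
  have he := hasDerivAt_cexp_mul lam x
  have h1 := he.smul (hd 0)
  have h2 := he.smul (((hd 0).const_smul lam).add (hd 1))
  refine (h1.prodMk h2).congr_deriv ?_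
  rw [systemOp_apply]
  refine Prod.ext ?_ ?_
  · ext i
    simp [frobeniusData]
    ring
  · ext i
    have := heq i
    simp [frobeniusData]
    linear_combination (Complex.exp (lam * x)) * this

/-! ### Propagation, Wronskians and the extension to the line -/

/-- The solution operator of the first-order system, starting from `x = 0`. -/
def propagator (p ω θ x : ℝ) (w : ℂ) : CauchyData →L[ℂ] CauchyData :=
  fundamentalSolution (systemOp p ω θ) x w

theorem propagator_zero (p ω θ : ℝ) (w : ℂ) (e : CauchyData) : propagator p ω θ 0 w e = e := by
  rw [propagator, fundamentalSolution_zero]; rfl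

theorem differentiable_propagator {p ω θ : ℝ} (hp : 4 < p) (hω : 0 < ω) (hθ : |θ| < 1) (x : ℝ) :
    Differentiable ℂ (propagator p ω θ x) :=
  differentiable_fundamentalSolution (continuous_systemOp hp hω hθ) (differentiable_systemOp p ω θ) x

/-- `e` is a solution of the first-order system at the point `x`. -/
def SolvesAt (p ω θ : ℝ) (w : ℂ) (e : ℝ → CauchyData) (x : ℝ) : Prop :=
  HasDerivAt e (systemOp p ω θ x w (e x)) x

theorem solvesAt_propagator {p ω θ : ℝ} (hp : 4 < p) (hω : 0 < ω) (hθ : |θ| < 1) (w : ℂ)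
    (e : CauchyData) (x : ℝ) : SolvesAt p ω θ w (fun x => propagator p ω θ x w e) x := by
  have h := hasDerivAt_fundamentalSolution (continuous_systemOp hp hω hθ)
    (differentiable_systemOp p ω θ) x w
  exact ((ContinuousLinearMap.apply ℂ CauchyData e).restrictScalars ℝ).hasFDerivAt.comp_hasDerivAt x h

theorem norm_systemOp_apply_le {p ω θ ρ₀ : ℝ} (hp : 4 < p) (hω : 0 < ω) (hθ : |θ| ≤ ρ₀)
    (hρ : ρ₀ < 1) (x : ℝ) (w : ℂ) (e : CauchyData) :
    ‖systemOp p ω θ x w e‖ ≤ (1 + ‖w‖ + 4 * ω +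
      2 * (p + 2) * ω / (1 - ρ₀) ^ 2 * (2 * p + 2)) * ‖e‖ := by
  have hκ := potentialRate_pos hp hω
  have hρ' : 0 < 1 - ρ₀ := by linarith
  have h1 : ‖e.1‖ ≤ ‖e‖ := norm_fst_le e
  have h2 : ‖e.2‖ ≤ ‖e‖ := norm_snd_le e
  have hV : ‖(potential p ω θ x : ℂ)‖ ≤ 2 * (p + 2) * ω / (1 - ρ₀) ^ 2 := by
    rw [Complex.norm_real, Real.norm_eq_abs]
    refine (abs_potential_le hp hω hθ hρ x).trans (mul_le_of_le_one_right (by positivity) ?_)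
    exact Real.exp_le_one_iff.2 (by
      have : 0 ≤ potentialRate p ω * |x| := by positivity
      linarith)
  have hsym : ‖symbol ω w‖ ≤ ‖w‖ + 4 * ω := by
    refine (pi_norm_le_iff_of_nonneg (by positivity)).2 fun i => ?_
    fin_cases i
    · simp [symbol]; positivity
    · simp only [symbol, Fin.mk_one, Matrix.cons_val_one, Matrix.cons_val_fin_one]
      refine (norm_add_le _ _).trans ?_
      rw [norm_mul, Complex.norm_real, Real.norm_of_nonneg hω.le, Complex.norm_ofNat]
  rw [systemOp_apply, Prod.norm_def, max_le_iff]
  have hc0 : 0 ≤ 2 * (p + 2) * ω / (1 - ρ₀) ^ 2 * (2 * p + 2) := by positivity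
  constructor
  · simp only
    have : 0 ≤ (‖w‖ + 4 * ω + 2 * (p + 2) * ω / (1 - ρ₀) ^ 2 * (2 * p + 2)) * ‖e‖ := by positivity
    linarith
  · simp only
    calc ‖symbol ω w * e.1 + (potential p ω θ x : ℂ) • coupling p e.1‖
        ≤ ‖symbol ω w‖ * ‖e.1‖ + ‖(potential p ω θ x : ℂ)‖ * ‖coupling p e.1‖ := by
          refine (norm_add_le _ _).trans ?_
          rw [norm_smul]
          gcongr
          exact norm_mul_le _ _
      _ ≤ (‖w‖ + 4 * ω) * ‖e‖ + 2 * (p + 2) * ω / (1 - ρ₀) ^ 2 * ((2 * p + 2) * ‖e‖) := by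
          gcongr
          exact (norm_coupling_le (by linarith) _).trans (by gcongr)
      _ ≤ _ := by nlinarith [norm_nonneg e]

theorem lipschitz_systemOp {p ω θ : ℝ} (hp : 4 < p) (hω : 0 < ω) (hθ : |θ| < 1) (w : ℂ) :
    ∃ K : NNReal, ∀ x, LipschitzWith K (systemOp p ω θ x w) := by
  refine ⟨Real.toNNReal (1 + ‖w‖ + 4 * ω + 2 * (p + 2) * ω / (1 - |θ|) ^ 2 * (2 * p + 2)),
    fun x => ?_⟩
  refine (systemOp p ω θ x w).lipschitz.weaken ?_
  rw [← NNReal.coe_le_coe, coe_nnnorm]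
  refine ContinuousLinearMap.opNorm_le_bound _ (NNReal.coe_nonneg _) fun e => ?_
  refine (norm_systemOp_apply_le hp hω le_rfl hθ x w e).trans ?_
  gcongr
  exact Real.le_coe_toNNReal _

/-- Uniqueness identifies the Frobenius series, which is controlled only for `x ≥ 0`, with the
propagated Cauchy data that define the solution on the line. -/
theorem eq_propagator_of_solvesAt {p ω θ : ℝ} (hp : 4 < p) (hω : 0 < ω) (hθ : |θ| < 1) {w : ℂ}
    {e : ℝ → CauchyData} (he : ∀ x, 0 ≤ x → SolvesAt p ω θ w e x) (x : ℝ) (hx : 0 ≤ x) :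
    e x = propagator p ω θ x w (e 0) := by
  obtain ⟨K, hK⟩ := lipschitz_systemOp hp hω hθ w
  have := ODE_solution_unique_of_mem_Icc_right (v := fun x => systemOp p ω θ x w)
    (s := fun _ => univ) (K := K) (f := e) (g := fun x => propagator p ω θ x w (e 0))
    (a := 0) (b := x) (fun t _ => (hK t).lipschitzOnWith)
    (fun t ht => (he t ht.1).continuousAt.continuousWithinAt)
    (fun t ht => (he t ht.1).hasDerivWithinAt) (fun _ _ => mem_univ _)
    (fun t _ => (solvesAt_propagator hp hω hθ w (e 0) t).continuousAt.continuousWithinAt)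
    (fun t _ => (solvesAt_propagator hp hω hθ w (e 0) t).hasDerivWithinAt) (fun _ _ => mem_univ _)
    (by simp [propagator_zero])
  exact this ⟨hx, le_rfl⟩

theorem coupling_star (p : ℝ) (u : Fin 2 → ℂ) : star (coupling p u) = coupling p (star u) := by
  ext i
  fin_cases i
  · simp [coupling_apply_zero]
  · simp [coupling_apply_one]

theorem symbol_star (ω : ℝ) (w : ℂ) : star (symbol ω w) = symbol ω (star w) := by
  ext i
  fin_cases i <;> simp [symbol]

theorem systemOp_star (p ω θ x : ℝ) (w : ℂ) (e : CauchyData) :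
    star (systemOp p ω θ x w e) = systemOp p ω θ x (star w) (star e) := by
  rw [systemOp_apply, systemOp_apply]
  refine Prod.ext rfl ?_
  simp only [Prod.snd_star, Prod.fst_star, star_add, star_mul', star_smul, coupling_star,
    symbol_star]
  simp

/-- For real `w` the system has real coefficients, so the conjugate of a solution solves the same
initial value problem with conjugate data. -/
theorem propagator_star {p ω θ : ℝ} (hp : 4 < p) (hω : 0 < ω) (hθ : |θ| < 1) (x : ℝ) {w : ℂ}
    (hw : star w = w) (e : CauchyData) :
    star (propagator p ω θ x w e) = propagator p ω θ x w (star e) := by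
  obtain ⟨K, hK⟩ := lipschitz_systemOp hp hω hθ w
  have := ODE_solution_unique_univ (v := fun x => systemOp p ω θ x w)
    (s := fun _ => univ) (K := K) (f := fun x => star (propagator p ω θ x w e))
    (g := fun x => propagator p ω θ x w (star e)) (t₀ := 0)
    (fun t => (hK t).lipschitzOnWith)
    (fun t => ⟨by
      have h := (solvesAt_propagator hp hω hθ w e t).star
      rwa [systemOp_star, hw] at h, mem_univ _⟩)
    (fun t => ⟨solvesAt_propagator hp hω hθ w (star e) t, mem_univ _⟩)
    (by simp [propagator_zero])
  exact congrFun this x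

/-- The Wronskian of Cauchy data. -/
def dataWronskian (e e' : CauchyData) : ℂ := e.2 ⬝ᵥ e'.1 - e.1 ⬝ᵥ e'.2

theorem dataWronskian_eq (e e' : CauchyData) :
    dataWronskian e e' = e.2 0 * e'.1 0 + e.2 1 * e'.1 1 - (e.1 0 * e'.2 0 + e.1 1 * e'.2 1) := by
  simp [dataWronskian, dotProduct, Fin.sum_univ_two]

/-- The symbol is diagonal and the coupling matrix is symmetric, so the second-derivative terms
cancel in pairs. -/
theorem hasDerivAt_dataWronskian {p ω θ : ℝ} {w : ℂ} {e e' : ℝ → CauchyData} {x : ℝ}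
    (he : SolvesAt p ω θ w e x) (he' : SolvesAt p ω θ w e' x) :
    HasDerivAt (fun x => dataWronskian (e x) (e' x)) 0 x := by
  unfold SolvesAt at he he'
  rw [systemOp_apply] at he he'
  have h1 := fun i => hasDerivAt_pi.1 he.fst i
  have h2 := fun i => hasDerivAt_pi.1 he.snd i
  have h3 := fun i => hasDerivAt_pi.1 he'.fst i
  have h4 := fun i => hasDerivAt_pi.1 he'.snd i
  simp only [dataWronskian_eq]
  refine ((((h2 0).mul (h3 0)).add ((h2 1).mul (h3 1))).sub
    (((h1 0).mul (h4 0)).add ((h1 1).mul (h4 1)))).congr_deriv ?_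
  simp [coupling_apply_zero, coupling_apply_one]
  ring

theorem dataWronskian_const {p ω θ : ℝ} {w : ℂ} {e e' : ℝ → CauchyData}
    (he : ∀ x, 0 ≤ x → SolvesAt p ω θ w e x) (he' : ∀ x, 0 ≤ x → SolvesAt p ω θ w e' x) {x : ℝ}
    (hx : 0 ≤ x) : dataWronskian (e x) (e' x) = dataWronskian (e 0) (e' 0) :=
  constant_of_has_deriv_right_zero (a := 0) (b := x)
    (f := fun x => dataWronskian (e x) (e' x))
    (fun t ht => (hasDerivAt_dataWronskian (he t ht.1) (he' t ht.1)).continuousAt.continuousWithinAt)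
    (fun t ht => (hasDerivAt_dataWronskian (he t ht.1) (he' t ht.1)).hasDerivWithinAt) x
    ⟨hx, le_rfl⟩

theorem dataWronskian_propagator {p ω θ : ℝ} (hp : 4 < p) (hω : 0 < ω) (hθ : |θ| < 1) (w : ℂ)
    (e e' : CauchyData) (x : ℝ) :
    dataWronskian (propagator p ω θ x w e) (propagator p ω θ x w e') = dataWronskian e e' := by
  have h := fun x => hasDerivAt_dataWronskian (solvesAt_propagator hp hω hθ w e x)
    (solvesAt_propagator hp hω hθ w e' x)
  have := is_const_of_deriv_eq_zero (fun x => (h x).differentiableAt) (fun x => (h x).deriv) x 0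
  simpa [propagator_zero] using this

/-- The data to the left of the origin which correspond to `e` under the jump condition. -/
def leftData (q : ℝ) (e : CauchyData) : CauchyData := (e.1, e.2 - ((2 * q : ℝ) : ℂ) • e.1)

/-- The function on the line with right data `e` at the origin. -/
def lineSolution (q p ω θ : ℝ) (w : ℂ) (e : CauchyData) (x : ℝ) : Fin 2 → ℂ :=
  if 0 ≤ x then (propagator p ω θ x w e).1 else (propagator p ω θ x w (leftData q e)).1

/-- The jump subtracts the same multiple of the value from each derivative, and these contributions
cancel; the Wronskian is thus the same on both sides of the origin. -/
theorem dataWronskian_leftData (q : ℝ) (e e' : CauchyData) :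
    dataWronskian (leftData q e) (leftData q e') = dataWronskian e e' := by
  simp only [dataWronskian_eq, leftData, Pi.sub_apply, Pi.smul_apply, smul_eq_mul]
  ring

section Line

variable {q p ω θ : ℝ} {w : ℂ} {e : CauchyData}

theorem lineSolution_eventuallyEq_right {x : ℝ} (hx : 0 < x) :
    lineSolution q p ω θ w e =ᶠ[𝓝 x] fun x => (propagator p ω θ x w e).1 := by
  filter_upwards [lt_mem_nhds hx] with y hy
  simp [lineSolution, hy.le]

theorem lineSolution_eventuallyEq_left {x : ℝ} (hx : x < 0) :
    lineSolution q p ω θ w e =ᶠ[𝓝 x] fun x => (propagator p ω θ x w (leftData q e)).1 := by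
  filter_upwards [gt_mem_nhds hx] with y hy
  simp [lineSolution, hy.not_ge]

theorem hasDerivAt_propagator_fst (x : ℝ) (hp : 4 < p) (hω : 0 < ω) (hθ : |θ| < 1) :
    HasDerivAt (fun x => (propagator p ω θ x w e).1) (propagator p ω θ x w e).2 x := by
  have h := solvesAt_propagator hp hω hθ w e x
  unfold SolvesAt at h
  rw [systemOp_apply] at h
  exact h.fst

theorem hasDerivAt_propagator_snd (x : ℝ) (hp : 4 < p) (hω : 0 < ω) (hθ : |θ| < 1) :
    HasDerivAt (fun x => (propagator p ω θ x w e).2)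
      (symbol ω w * (propagator p ω θ x w e).1 +
        (potential p ω θ x : ℂ) • coupling p (propagator p ω θ x w e).1) x := by
  have h := solvesAt_propagator hp hω hθ w e x
  unfold SolvesAt at h
  rw [systemOp_apply] at h
  exact h.snd

theorem deriv_lineSolution_right (hp : 4 < p) (hω : 0 < ω) (hθ : |θ| < 1) {x : ℝ} (hx : 0 < x) :
    deriv (lineSolution q p ω θ w e) x = (propagator p ω θ x w e).2 := by
  rw [(lineSolution_eventuallyEq_right hx).deriv_eq]
  exact (hasDerivAt_propagator_fst x hp hω hθ).deriv

theorem deriv_lineSolution_left (hp : 4 < p) (hω : 0 < ω) (hθ : |θ| < 1) {x : ℝ} (hx : x < 0) :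
    deriv (lineSolution q p ω θ w e) x = (propagator p ω θ x w (leftData q e)).2 := by
  rw [(lineSolution_eventuallyEq_left hx).deriv_eq]
  exact (hasDerivAt_propagator_fst x hp hω hθ).deriv

/-- On each side of the origin a `lineSolution` is given by a propagated datum. -/
theorem exists_propagator_eq (hp : 4 < p) (hω : 0 < ω) (hθ : |θ| < 1) {x : ℝ} (hx : x ≠ 0) :
    ∃ e' : CauchyData, (e' = e ∨ e' = leftData q e) ∧
      lineSolution q p ω θ w e =ᶠ[𝓝 x] (fun x => (propagator p ω θ x w e').1) ∧
      deriv (lineSolution q p ω θ w e) =ᶠ[𝓝 x] fun x => (propagator p ω θ x w e').2 := by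
  rcases lt_or_gt_of_ne hx with h | h
  · refine ⟨leftData q e, Or.inr rfl, lineSolution_eventuallyEq_left h, ?_⟩
    filter_upwards [gt_mem_nhds h] with y hy
    exact deriv_lineSolution_left hp hω hθ hy
  · refine ⟨e, Or.inl rfl, lineSolution_eventuallyEq_right h, ?_⟩
    filter_upwards [lt_mem_nhds h] with y hy
    exact deriv_lineSolution_right hp hω hθ hy

theorem wronskian_lineSolution (hp : 4 < p) (hω : 0 < ω) (hθ : |θ| < 1) (e' : CauchyData)
    {x : ℝ} (hx : x ≠ 0) :
    wronskian (lineSolution q p ω θ w e) (lineSolution q p ω θ w e') x = dataWronskian e e' := by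
  unfold wronskian
  rcases lt_or_gt_of_ne hx with h | h
  · rw [deriv_lineSolution_left hp hω hθ h, deriv_lineSolution_left hp hω hθ h,
      (lineSolution_eventuallyEq_left h).eq_of_nhds, (lineSolution_eventuallyEq_left h).eq_of_nhds,
      ← dataWronskian_leftData q, ← dataWronskian_propagator hp hω hθ w _ _ x]
    rfl
  · rw [deriv_lineSolution_right hp hω hθ h, deriv_lineSolution_right hp hω hθ h,
      (lineSolution_eventuallyEq_right h).eq_of_nhds,
      (lineSolution_eventuallyEq_right h).eq_of_nhds, ← dataWronskian_propagator hp hω hθ w _ _ x]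
    rfl

theorem star_lineSolution (hp : 4 < p) (hω : 0 < ω) (hθ : |θ| < 1) (hw : star w = w) (x : ℝ) :
    star (lineSolution q p ω θ w e x) = lineSolution q p ω θ w (star e) x := by
  have h : star (leftData q e) = leftData q (star e) := by
    refine Prod.ext rfl ?_
    simp only [leftData, Prod.snd_star, Prod.fst_star, star_sub, star_smul]
    simp
  unfold lineSolution
  split_ifs
  · rw [← propagator_star hp hω hθ x hw, Prod.fst_star]
  · rw [← h, ← propagator_star hp hω hθ x hw, Prod.fst_star]

theorem continuous_propagator (hp : 4 < p) (hω : 0 < ω) (hθ : |θ| < 1) (e : CauchyData) :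
    Continuous fun x => propagator p ω θ x w e :=
  continuous_iff_continuousAt.2 fun x => (solvesAt_propagator hp hω hθ w e x).continuousAt

theorem isGeneralizedEigenfunction_lineSolution (hp : 4 < p) (hω : 0 < ω) (hθ : |θ| < 1) {σ ξ : ℝ}
    (hpot : ∀ x, σ * solitaryWave q p σ ω x ^ p = potential p ω θ x) (e : CauchyData) :
    IsGeneralizedEigenfunction q p σ ω ξ (lineSolution q p ω θ ((ξ : ℂ) ^ 2) e) where
  continuous := by
    refine Continuous.if_le (continuous_propagator hp hω hθ e).fst
      (continuous_propagator hp hω hθ _).fst continuous_const continuous_id ?_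
    rintro x rfl
    simp [propagator_zero, leftData]
  differentiableAt x hx := by
    obtain ⟨e', -, h1, -⟩ := exists_propagator_eq (q := q) (w := (ξ : ℂ) ^ 2) (e := e) hp hω hθ hx
    exact ((hasDerivAt_propagator_fst x hp hω hθ).congr_of_eventuallyEq h1).differentiableAt
  differentiableAt_deriv x hx := by
    obtain ⟨e', -, -, h2⟩ := exists_propagator_eq (q := q) (w := (ξ : ℂ) ^ 2) (e := e) hp hω hθ hx
    exact ((hasDerivAt_propagator_snd x hp hω hθ).congr_of_eventuallyEq h2).differentiableAt
  jump := by
    refine ⟨e.2, (leftData q e).2, ?_, ?_, ?_⟩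
    · have h := ((continuous_propagator (w := (ξ : ℂ) ^ 2) hp hω hθ e).snd.tendsto 0).mono_left
        (nhdsWithin_le_nhds (s := Ioi 0))
      rw [propagator_zero] at h
      refine h.congr' ?_
      filter_upwards [self_mem_nhdsWithin] with x hx
      exact (deriv_lineSolution_right hp hω hθ hx).symm
    · have h := ((continuous_propagator (w := (ξ : ℂ) ^ 2) hp hω hθ (leftData q e)).snd.tendsto
        0).mono_left (nhdsWithin_le_nhds (s := Iio 0))
      rw [propagator_zero] at h
      refine h.congr' ?_
      filter_upwards [self_mem_nhdsWithin] with x hx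
      exact (deriv_lineSolution_left hp hω hθ hx).symm
    · ext i
      simp [leftData, lineSolution, propagator_zero]
  equation x hx := by
    obtain ⟨e', -, h1, h2⟩ := exists_propagator_eq (q := q) (w := (ξ : ℂ) ^ 2) (e := e) hp hω hθ hx
    unfold matrixHamiltonian
    rw [h2.deriv_eq, (hasDerivAt_propagator_snd x hp hω hθ).deriv, h1.eq_of_nhds, hpot]
    set u := (propagator p ω θ x ((ξ : ℂ) ^ 2) e').1
    ext i
    fin_cases i
    · simp [symbol, coupling_apply_zero, potentialMatrix, dotProduct,
        Fin.sum_univ_two]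
      ring
    · simp [symbol, coupling_apply_one, potentialMatrix, dotProduct,
        Fin.sum_univ_two]
      ring

end Line

/-! ### The solitary wave potential -/

/-- The signed value `σ e^{-2a}`, where `a` is the shift in the solitary wave. -/
def nome (q σ ω : ℝ) : ℝ :=
  if 0 < σ then (1 - √(2 * ω) / |q|) / (1 + √(2 * ω) / |q|)
  else -((1 - |q| / √(2 * ω)) / (1 + |q| / √(2 * ω)))

theorem exp_neg_two_mul_artanh {t : ℝ} (h0 : 0 < t) (h1 : t < 1) :
    Real.exp (-(2 * Real.artanh t)) = (1 - t) / (1 + t) := by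
  rw [Real.artanh_eq_half_log ⟨by linarith, h1.le⟩]
  have h2 : 0 < (1 + t) / (1 - t) := div_pos (by linarith) (by linarith)
  rw [show -(2 * (1 / 2 * Real.log ((1 + t) / (1 - t)))) = -Real.log ((1 + t) / (1 - t)) by ring,
    Real.exp_neg, Real.exp_log h2, inv_div]

theorem frequencySet_pos {q σ ω : ℝ} (h : ω ∈ frequencySet q σ) : 0 < ω := by
  unfold frequencySet at h
  split_ifs at h
  · exact h.1
  · exact lt_of_le_of_lt (by positivity) h

theorem frequency_ratio_pos {q σ ω : ℝ} (hq : q < 0) (hσ : 0 < σ) (h : ω ∈ frequencySet q σ) :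
    0 < √(2 * ω) / |q| ∧ √(2 * ω) / |q| < 1 := by
  have hω := frequencySet_pos h
  have hq' : 0 < |q| := abs_pos.2 hq.ne
  rw [frequencySet, if_pos hσ] at h
  refine ⟨by positivity, (div_lt_one hq').2 ?_⟩
  rw [Real.sqrt_lt' hq', sq_abs]
  linarith [h.2]

theorem frequency_ratio_neg {q σ ω : ℝ} (hq : q < 0) (hσ : ¬ 0 < σ) (h : ω ∈ frequencySet q σ) :
    0 < |q| / √(2 * ω) ∧ |q| / √(2 * ω) < 1 := by
  have hω := frequencySet_pos h
  have hq' : 0 < |q| := abs_pos.2 hq.ne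
  have hs : 0 < √(2 * ω) := by positivity
  rw [frequencySet, if_neg hσ, mem_Ioi] at h
  refine ⟨by positivity, (div_lt_one hs).2 ?_⟩
  rw [Real.lt_sqrt hq'.le, sq_abs]
  linarith

theorem abs_nome_lt_one {q σ ω : ℝ} (hq : q < 0) (h : ω ∈ frequencySet q σ) :
    |nome q σ ω| < 1 := by
  have key : ∀ t : ℝ, 0 < t → t < 1 → |(1 - t) / (1 + t)| < 1 := by
    intro t h0 h1
    rw [abs_of_nonneg (div_nonneg (by linarith) (by linarith)), div_lt_one (by linarith)]
    linarith
  unfold nome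
  split_ifs with hσ
  · obtain ⟨h0, h1⟩ := frequency_ratio_pos hq hσ h
    exact key _ h0 h1
  · obtain ⟨h0, h1⟩ := frequency_ratio_neg hq hσ h
    rw [abs_neg]
    exact key _ h0 h1

theorem continuousAt_nome {q σ ω : ℝ} (hq : q < 0) (h : ω ∈ frequencySet q σ) :
    ContinuousAt (nome q σ) ω := by
  have hω := frequencySet_pos h
  have hq' : 0 < |q| := abs_pos.2 hq.ne
  have hs : 0 < √(2 * ω) := by positivity
  unfold nome
  split_ifs with hσ
  · refine ContinuousAt.div (by fun_prop) (by fun_prop) ?_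
    positivity
  · have h1 : ContinuousAt (fun ω : ℝ => |q| / √(2 * ω)) ω :=
      ContinuousAt.div (by fun_prop) (by fun_prop) hs.ne'
    refine (ContinuousAt.div (by fun_prop) (by fun_prop) ?_).neg
    positivity

/-- With `y` the argument of the profile and `a` its shift, `2y = κ|x| + 2a`, and `sinh⁻² y` and
`cosh⁻² y` equal `4e^{-2y} / (1 ∓ e^{-2y})²`. Since `σ e^{-2a}` is the nome, one rational expression
in `θ e^{-κ|x|}` covers both signs. -/
theorem potential_eq {q p σ ω : ℝ} (hq : q < 0) (hp : 4 < p) (hσ : σ = 1 ∨ σ = -1)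
    (h : ω ∈ frequencySet q σ) (x : ℝ) :
    σ * solitaryWave q p σ ω x ^ p = potential p ω (nome q σ ω) x := by
  have hω := frequencySet_pos h
  have hp0 : 0 < p := by linarith
  have hrate : 2 * (p * √(ω / 2) * |x|) = potentialRate p ω * |x| := by
    have : √(2 * ω) = 2 * √(ω / 2) := by
      rw [show 2 * ω = 2 ^ 2 * (ω / 2) by ring, Real.sqrt_mul (by positivity),
        Real.sqrt_sq (by norm_num)]
    rw [potentialRate, this]
    ring
  have hpow : ∀ S : ℝ, 0 < S → (((p + 2) * ω / 2) ^ (1 / p) * S ^ (-(2 / p))) ^ p =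
      (p + 2) * ω / 2 * (S ^ 2)⁻¹ := by
    intro S hS
    rw [Real.mul_rpow (by positivity) (by positivity), ← Real.rpow_mul (by positivity),
      ← Real.rpow_mul hS.le, one_div, inv_mul_cancel₀ hp0.ne', Real.rpow_one,
      show -(2 / p) * p = -2 by field_simp, Real.rpow_neg hS.le, Real.rpow_two]
  have hrx : 0 ≤ p * √(ω / 2) * |x| := by positivity
  unfold solitaryWave potential nome
  rcases hσ with rfl | rfl
  · obtain ⟨h0, h1⟩ := frequency_ratio_pos hq one_pos h
    simp only [zero_lt_one, if_true]
    set t := √(2 * ω) / |q|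
    have ha : 0 < Real.artanh t := Real.artanh_pos ⟨h0, h1⟩
    set y := p * √(ω / 2) * |x| + Real.artanh t with hy
    have hy0 : 0 < y := by positivity
    have hE : (1 - t) / (1 + t) * Real.exp (-(potentialRate p ω * |x|)) = Real.exp (-y) ^ 2 := by
      rw [← exp_neg_two_mul_artanh h0 h1, ← hrate, ← Real.exp_add, ← Real.exp_nat_mul, hy]
      push_cast
      ring_nf
    rw [hpow _ (Real.sinh_pos_iff.2 hy0), hE, Real.sinh_eq, Real.exp_neg]
    have he : 1 < Real.exp y := Real.one_lt_exp_iff.2 hy0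
    set e := Real.exp y
    have h3 : e ^ 2 - 1 ≠ 0 := by nlinarith
    have h4 : e ≠ 0 := by positivity
    have h5 : e - e⁻¹ ≠ 0 := by
      rw [sub_ne_zero]
      intro h
      have h7 := mul_inv_cancel₀ h4
      rw [← h] at h7
      nlinarith
    have h6 : 1 - e⁻¹ ^ 2 ≠ 0 := by
      have : 1 - e⁻¹ ^ 2 = (e - e⁻¹) * e⁻¹ := by field_simp
      rw [this]
      positivity
    field_simp
  · obtain ⟨h0, h1⟩ := frequency_ratio_neg hq (by norm_num) h
    simp only [Left.neg_pos_iff, not_lt.2 zero_le_one, if_false]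
    set t := |q| / √(2 * ω)
    set y := p * √(ω / 2) * |x| + Real.artanh t with hy
    have hE : -((1 - t) / (1 + t)) * Real.exp (-(potentialRate p ω * |x|)) =
        -Real.exp (-y) ^ 2 := by
      rw [← exp_neg_two_mul_artanh h0 h1, ← hrate, neg_mul, ← Real.exp_add, ← Real.exp_nat_mul, hy]
      push_cast
      ring_nf
    rw [hpow _ (Real.cosh_pos y), hE, Real.cosh_eq, Real.exp_neg]
    set e := Real.exp y
    have h4 : 0 < e := Real.exp_pos y
    have h6 : 1 - -e⁻¹ ^ 2 = (e + e⁻¹) * e⁻¹ := by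
      field_simp
      ring
    have h7 : 0 < e + e⁻¹ := by positivity
    rw [h6]
    field_simp

/-! ### Symmetries of the Frobenius solutions -/

theorem frobeniusDenominator_star (p ω : ℝ) (lam z : ℂ) (n : ℕ) (i : Fin 2) :
    star (frobeniusDenominator p ω lam z n i) =
      frobeniusDenominator p ω (star lam) (star z) n i := by
  have h := congrFun (symbol_star ω (z ^ 2)) i
  rw [Pi.star_apply, star_pow] at h
  simp only [frobeniusDenominator, star_sub, star_pow, h]
  simp

theorem solutionCoeff_star (p ω θ : ℝ) (lam z : ℂ) (c₀ : Fin 2 → ℂ) (n : ℕ) :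
    star (solutionCoeff p ω θ lam z c₀ n) =
      solutionCoeff p ω θ (star lam) (star z) (star c₀) n := by
  induction n using Nat.strong_induction_on with
  | _ n ih =>
    unfold solutionCoeff at ih ⊢
    cases n with
    | zero => simp only [frobeniusCoeff_zero]
    | succ n =>
      simp only [frobeniusCoeff_succ]
      rw [star_mul', star_sum]
      congr 1
      · ext i
        simp only [Pi.star_apply, star_inv₀, frobeniusDenominator_star]
      · refine Finset.sum_congr rfl fun j hj => ?_
        rw [star_smul, coupling_star, ih j (Finset.mem_range.1 hj)]
        simp

theorem solutionCoeff_neg (p ω θ : ℝ) (lam z : ℂ) (c₀ : Fin 2 → ℂ) :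
    solutionCoeff p ω θ lam (-z) c₀ = solutionCoeff p ω θ lam z c₀ := by
  simp only [solutionCoeff, frobeniusDenominator, neg_sq]

theorem expSeries_star (κ : ℝ) (c : ℕ → Fin 2 → ℂ) (k : ℕ) (x : ℝ) :
    star (expSeries κ c k x) = expSeries κ (fun n => star (c n)) k x := by
  unfold expSeries
  rw [tsum_star]
  refine tsum_congr fun n => ?_
  rw [star_smul]
  simp [-Complex.ofReal_exp]

theorem frobeniusData_star (p ω θ : ℝ) (lam z : ℂ) (c₀ : Fin 2 → ℂ) (x : ℝ) :
    star (frobeniusData p ω θ lam z c₀ x) =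
      frobeniusData p ω θ (star lam) (star z) (star c₀) x := by
  have he : star (Complex.exp (lam * x)) = Complex.exp (star lam * x) := by
    simp [← Complex.exp_conj]
  refine Prod.ext ?_ ?_
  · simp only [frobeniusData, Prod.fst_star, star_smul, expSeries_star, solutionCoeff_star, he]
  · simp only [frobeniusData, Prod.snd_star, star_smul, star_add, expSeries_star,
      solutionCoeff_star, he]

theorem frobeniusData_neg (p ω θ : ℝ) (lam z : ℂ) (c₀ : Fin 2 → ℂ) :
    frobeniusData p ω θ lam (-z) c₀ = frobeniusData p ω θ lam z c₀ := by
  unfold frobeniusData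
  rw [solutionCoeff_neg]

/-! ### Bounds for the Frobenius solutions -/

/-- The remainder `∂ₓᵏ (e^{-lam x} f - c₀)` of a Frobenius solution `f`. -/
def remainder (p ω θ : ℝ) (lam z : ℂ) (c₀ : Fin 2 → ℂ) (k : ℕ) (x : ℝ) : Fin 2 → ℂ :=
  expSeries (potentialRate p ω) (solutionCoeff p ω θ lam z c₀) k x - if k = 0 then c₀ else 0

theorem exists_remainder_bound {p ρ₀ : ℝ} (hp : 4 < p) (hρ0 : 0 ≤ ρ₀) (hρ1 : ρ₀ < 1) :
    ∃ K, 0 < K ∧ ∀ ω θ μ : ℝ, 0 < ω → |θ| ≤ ρ₀ → 0 < μ → ∀ (lam z : ℂ) (c₀ : Fin 2 → ℂ),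
      IsFrobeniusExponent p ω μ lam z c₀ → ∀ k ≤ 1, ∀ x, 0 ≤ x →
      ‖remainder p ω θ lam z c₀ k x‖ ≤
        K * √ω / μ * potentialRate p ω ^ k * Real.exp (-(potentialRate p ω * x)) ∧
      ∀ D, 0 < D → (∀ n : ℕ, D ≤ ‖frobeniusDenominator p ω lam z (n + 1) 0‖) →
        ‖remainder p ω θ lam z c₀ k x 0‖ ≤
          K * ω / D * potentialRate p ω ^ k * Real.exp (-(potentialRate p ω * x)) := by
  obtain ⟨B, hB, hbound⟩ := exists_solutionCoeff_bound hp hρ0 hρ1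
  set ρ := (1 + ρ₀) / 2 with hρ
  have hρ' : 0 ≤ ρ := by positivity
  have hρ1' : ρ < 1 := by rw [hρ]; linarith
  set S : ℕ → ℝ := fun k => ∑' n : ℕ, (n : ℝ) ^ k * ρ ^ n with hS
  have hS0 : ∀ k, 0 ≤ S k := fun k => tsum_nonneg fun n => by positivity
  refine ⟨B * (S 0 + S 1 + 1), mul_pos hB (by linarith [hS0 0, hS0 1]), ?_⟩
  intro ω θ μ hω hθ hμ lam z c₀ h k hk x hx
  obtain ⟨hb0, hb1, hb2⟩ := hbound ω θ μ hω hθ hμ lam z c₀ h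
  have hκ := potentialRate_pos hp hω
  have hSk : S k ≤ S 0 + S 1 + 1 := by
    interval_cases k <;> linarith [hS0 0, hS0 1]
  have hc0 : solutionCoeff p ω θ lam z c₀ 0 = c₀ := frobeniusCoeff_zero _ _ _ _
  constructor
  · have h1 := norm_expSeries_sub_le hκ.le hρ' hρ1' (by positivity) hb1 k hx
    rw [hc0] at h1
    refine h1.trans ?_
    calc B * √ω / μ * potentialRate p ω ^ k * S k * Real.exp (-(potentialRate p ω * x))
        ≤ B * √ω / μ * potentialRate p ω ^ k * (S 0 + S 1 + 1) *
          Real.exp (-(potentialRate p ω * x)) := by gcongr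
      _ = _ := by ring
  · intro D hD hDle
    have h1 := norm_expSeries_sub_le (c := fun n => solutionCoeff p ω θ lam z c₀ n 0)
      hκ.le hρ' hρ1' (by positivity) (hb2 D hD hDle) k hx
    have h2 : remainder p ω θ lam z c₀ k x 0 =
        expSeries (potentialRate p ω) (fun n => solutionCoeff p ω θ lam z c₀ n 0) k x -
          if k = 0 then solutionCoeff p ω θ lam z c₀ 0 0 else 0 := by
      rw [remainder, Pi.sub_apply, expSeries_apply hκ.le hρ' hρ1' hB.le hb0 k hx, hc0]
      congr 1
      split_ifs <;> rfl
    rw [h2]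
    refine h1.trans ?_
    calc B * ω / D * potentialRate p ω ^ k * S k * Real.exp (-(potentialRate p ω * x))
        ≤ B * ω / D * potentialRate p ω ^ k * (S 0 + S 1 + 1) *
          Real.exp (-(potentialRate p ω * x)) := by gcongr
      _ = _ := by ring

/-- Every coefficient is holomorphic because no denominator vanishes on `U`. The plain coefficient
bound involves neither `z` nor `μ`, so the series converges uniformly although `μ` may vary with
`z`. -/
theorem differentiableOn_remainder {p ω θ : ℝ} (hp : 4 < p) (hω : 0 < ω) (hθ : |θ| < 1)
    {lam : ℂ → ℂ} {c₀ : Fin 2 → ℂ} {U : Set ℂ} (hU : IsOpen U) (hlam : DifferentiableOn ℂ lam U)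
    (h : ∀ z ∈ U, ∃ μ, 0 < μ ∧ IsFrobeniusExponent p ω μ (lam z) z c₀) (k : ℕ) {x : ℝ}
    (hx : 0 ≤ x) : DifferentiableOn ℂ (fun z => remainder p ω θ (lam z) z c₀ k x) U := by
  obtain ⟨B, hB, hbound⟩ := exists_solutionCoeff_bound hp (abs_nonneg θ) hθ
  have hκ := potentialRate_pos hp hω
  have hρ : 0 ≤ (1 + |θ|) / 2 := by positivity
  have hρ1 : (1 + |θ|) / 2 < 1 := by linarith
  have hden : ∀ n i, DifferentiableOn ℂ
      (fun z => (frobeniusDenominator p ω (lam z) z (n + 1) i)⁻¹) U := by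
    intro n i
    refine DifferentiableOn.inv ?_ fun z hz => ?_
    · unfold frobeniusDenominator
      have : DifferentiableOn ℂ (fun z : ℂ => symbol ω (z ^ 2) i) U := by
        unfold symbol
        fin_cases i <;> simp <;> fun_prop
      fun_prop
    · obtain ⟨μ, hμ, hf⟩ := h z hz
      have h1 := hf.denominator n i
      have h2 : 0 < ((n : ℝ) + 1) * potentialRate p ω *
        (((n : ℝ) + 1) * potentialRate p ω + μ) / 6 := by positivity
      exact norm_pos_iff.1 (h2.trans_le h1)
  have hcoef : ∀ n, DifferentiableOn ℂ (fun z => solutionCoeff p ω θ (lam z) z c₀ n) U :=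
    fun n => differentiableOn_frobeniusCoeff
      (d := fun z n i => (frobeniusDenominator p ω (lam z) z n i)⁻¹) hden n
  unfold remainder expSeries
  refine DifferentiableOn.sub_const ?_ _
  refine Complex.differentiableOn_tsum_of_summable_norm
    (u := fun n : ℕ => B * potentialRate p ω ^ k * ((n : ℝ) ^ k * ((1 + |θ|) / 2) ^ n)) ?_ ?_ hU ?_
  · exact (summable_pow_mul_geometric_of_norm_lt_one k
      (by rwa [Real.norm_of_nonneg hρ] : ‖(1 + |θ|) / 2‖ < 1)).mul_left _
  · exact fun n => (hcoef n).fun_const_smul _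
  · intro n z hz
    obtain ⟨μ, hμ, hf⟩ := h z hz
    have := norm_expSeries_term_le hκ.le (ε := 0) hρ hB.le
      (hbound ω θ μ hω le_rfl hμ (lam z) z c₀ hf).1 k n (x := x) (by simpa using hx)
    simpa using! this

/-! ### Wronskians of Frobenius solutions -/

theorem tendsto_remainder {p ω θ μ : ℝ} (hp : 4 < p) (hω : 0 < ω) (hθ : |θ| < 1) (hμ : 0 < μ)
    {lam z : ℂ} {c₀ : Fin 2 → ℂ} (h : IsFrobeniusExponent p ω μ lam z c₀) {k : ℕ} (hk : k ≤ 1) :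
    Tendsto (remainder p ω θ lam z c₀ k) atTop (𝓝 0) := by
  obtain ⟨K, -, hb⟩ := exists_remainder_bound hp (abs_nonneg θ) hθ
  have hκ := potentialRate_pos hp hω
  have hexp : Tendsto (fun x : ℝ => K * √ω / μ * potentialRate p ω ^ k *
      Real.exp (-(potentialRate p ω * x))) atTop (𝓝 0) := by
    have h1 : Tendsto (fun x : ℝ => Real.exp (-(potentialRate p ω * x))) atTop (𝓝 0) :=
      Real.tendsto_exp_neg_atTop_nhds_zero.comp (tendsto_id.const_mul_atTop hκ)
    simpa using h1.const_mul (K * √ω / μ * potentialRate p ω ^ k)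
  refine squeeze_zero_norm' ?_ hexp
  filter_upwards [eventually_ge_atTop 0] with x hx
  exact (hb ω θ μ hω le_rfl hμ lam z c₀ h k hk x hx).1

theorem tendsto_apply_remainder {p ω θ μ : ℝ} (hp : 4 < p) (hω : 0 < ω) (hθ : |θ| < 1)
    (hμ : 0 < μ) {lam z : ℂ} {c₀ : Fin 2 → ℂ} (h : IsFrobeniusExponent p ω μ lam z c₀) (i : Fin 2) :
    Tendsto (fun x => expSeries (potentialRate p ω) (solutionCoeff p ω θ lam z c₀) 0 x i)
        atTop (𝓝 (c₀ i)) ∧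
      Tendsto (fun x => expSeries (potentialRate p ω) (solutionCoeff p ω θ lam z c₀) 1 x i)
        atTop (𝓝 0) := by
  have h0 := (tendsto_pi_nhds.1 (tendsto_remainder hp hω hθ hμ h (zero_le_one))) i
  have h1 := (tendsto_pi_nhds.1 (tendsto_remainder hp hω hθ hμ h le_rfl)) i
  constructor
  · simpa [remainder] using h0.add_const (c₀ i)
  · simpa [remainder] using h1

/-- The Wronskian is constant and equals `e^{(λ+λ')x}` times a bracket converging to `(λ - λ') c₀ ·
c₀'`. Its value is read off at infinity: either the exponential is identically `1`, or it is bounded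
by `1` while the bracket tends to `0`. -/
theorem dataWronskian_frobeniusData {p ω θ μ μ' : ℝ} (hp : 4 < p) (hω : 0 < ω) (hθ : |θ| < 1)
    (hμ : 0 < μ) (hμ' : 0 < μ') {lam lam' z z' : ℂ} {c₀ c₀' : Fin 2 → ℂ}
    (h : IsFrobeniusExponent p ω μ lam z c₀) (h' : IsFrobeniusExponent p ω μ' lam' z' c₀')
    (hz : z' ^ 2 = z ^ 2) (hre : (lam + lam').re ≤ 0)
    (hL : lam + lam' = 0 ∨ c₀ 0 * c₀' 0 + c₀ 1 * c₀' 1 = 0) :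
    dataWronskian (frobeniusData p ω θ lam z c₀ 0) (frobeniusData p ω θ lam' z' c₀' 0) =
      (lam - lam') * (c₀ 0 * c₀' 0 + c₀ 1 * c₀' 1) := by
  set F := frobeniusData p ω θ lam z c₀
  set F' := frobeniusData p ω θ lam' z' c₀'
  set g := fun (k : ℕ) (x : ℝ) (i : Fin 2) =>
    expSeries (potentialRate p ω) (solutionCoeff p ω θ lam z c₀) k x i with hg
  set g' := fun (k : ℕ) (x : ℝ) (i : Fin 2) =>
    expSeries (potentialRate p ω) (solutionCoeff p ω θ lam' z' c₀') k x i with hg'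
  set br : ℝ → ℂ := fun x =>
    (lam * g 0 x 0 + g 1 x 0) * g' 0 x 0 + (lam * g 0 x 1 + g 1 x 1) * g' 0 x 1 -
    (g 0 x 0 * (lam' * g' 0 x 0 + g' 1 x 0) + g 0 x 1 * (lam' * g' 0 x 1 + g' 1 x 1)) with hbr
  have hF : ∀ x, 0 ≤ x → SolvesAt p ω θ (z ^ 2) F x := fun x hx =>
    hasDerivAt_frobeniusData hp hω hθ hμ h hx
  have hF' : ∀ x, 0 ≤ x → SolvesAt p ω θ (z ^ 2) F' x := fun x hx => by
    rw [← hz]; exact hasDerivAt_frobeniusData hp hω hθ hμ' h' hx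
  have hW : ∀ x : ℝ, 0 ≤ x →
      dataWronskian (F 0) (F' 0) = Complex.exp ((lam + lam') * x) * br x := by
    intro x hx
    rw [← dataWronskian_const hF hF' hx, dataWronskian_eq, add_mul, Complex.exp_add]
    simp only [F, F', frobeniusData, Pi.smul_apply, Pi.add_apply, smul_eq_mul, hbr, hg, hg']
    ring
  have ht : Tendsto br atTop (𝓝 ((lam - lam') * (c₀ 0 * c₀' 0 + c₀ 1 * c₀' 1))) := by
    have t := fun i => tendsto_apply_remainder hp hω hθ hμ h i
    have t' := fun i => tendsto_apply_remainder hp hω hθ hμ' h' i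
    have := (((((t 0).1.const_mul lam).add (t 0).2).mul (t' 0).1).add
      ((((t 1).1.const_mul lam).add (t 1).2).mul (t' 1).1)).sub
      (((t 0).1.mul (((t' 0).1.const_mul lam').add (t' 0).2)).add
      ((t 1).1.mul (((t' 1).1.const_mul lam').add (t' 1).2)))
    convert this using 2
    ring
  rcases hL with h0 | h0
  · refine tendsto_nhds_unique (tendsto_const_nhds.congr' ?_) ht
    filter_upwards [eventually_ge_atTop 0] with x hx
    rw [hW x hx, h0]
    simp
  · rw [h0, mul_zero] at ht ⊢
    refine norm_eq_zero.1 (le_antisymm ?_ (norm_nonneg _))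
    refine ge_of_tendsto (tendsto_zero_iff_norm_tendsto_zero.1 ht) ?_
    filter_upwards [eventually_ge_atTop 0] with x hx
    rw [hW x hx, norm_mul, Complex.norm_exp]
    refine mul_le_of_le_one_left (norm_nonneg _) (Real.exp_le_one_iff.2 ?_)
    simpa using mul_nonpos_of_nonpos_of_nonneg hre hx

/-! ### A damped system with an exponentially decaying coupling -/

theorem inner_damped_le {a c l : ℂ} {ν : ℝ} (hl : ν ≤ l.re) :
    inner ℝ a (-l * a + c) ≤ -ν * ‖a‖ ^ 2 + ‖a‖ * ‖c‖ := by
  have h1 : inner ℝ a (-l * a) = -l.re * ‖a‖ ^ 2 := by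
    rw [Complex.inner, ← Complex.normSq_eq_norm_sq, Complex.normSq_apply]
    simp
    ring
  rw [inner_add_right, h1]
  have h2 := real_inner_le_norm a c
  nlinarith [sq_nonneg ‖a‖]

/-- The damping contributes a nonnegative quadratic form, even with the cross term by which `c`
forces `a`. What remains is of the size of the potential times the energy. -/
theorem energy_algebra {ν M : ℝ} (hν : 0 ≤ ν) (hM : 0 ≤ M) (r₁ r₂ r₃ r₄ : ℝ) :
    -2 * ν * (r₁ ^ 2 - r₁ * r₂ + r₂ ^ 2 + r₃ ^ 2) +
      M * (2 * ((r₂ + r₃ + r₄) * (r₁ + (r₄ + r₃)))) ≤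
      M * (6 * (r₁ ^ 2 + r₂ ^ 2 + r₃ ^ 2 + r₄ ^ 2)) := by
  have e3 : 0 ≤ r₁ ^ 2 - r₁ * r₂ + r₂ ^ 2 + r₃ ^ 2 := by
    linarith [sq_nonneg (r₁ - r₂), sq_nonneg r₁, sq_nonneg r₂, sq_nonneg r₃]
  have e4 : 2 * ((r₂ + r₃ + r₄) * (r₁ + (r₄ + r₃))) ≤
      6 * (r₁ ^ 2 + r₂ ^ 2 + r₃ ^ 2 + r₄ ^ 2) := by
    linarith [sq_nonneg (r₂ - r₁), sq_nonneg (r₂ - r₄), sq_nonneg (r₂ - r₃),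
      sq_nonneg (r₃ - r₁), sq_nonneg (r₃ - r₄), sq_nonneg (r₄ - r₁), sq_nonneg r₁, sq_nonneg r₂]
  have e5 := mul_nonneg hν e3
  have e6 := mul_le_mul_of_nonneg_left e4 hM
  linarith

/-- A damped linear system for `(a, c, β, b)` with coupling of size `A e^{-κx}`; the function `b` is
undamped. -/
structure IsDampedSystem (a b c β : ℝ → ℂ) (V : ℝ → ℝ) (l₁ l₂ l₃ : ℂ) (p ν κ A : ℝ) : Prop where
  re_one : ν ≤ l₁.re
  re_two : ν ≤ l₂.re
  re_three : ν ≤ l₃.re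
  hasDerivAt_a : ∀ x, 0 ≤ x → HasDerivAt a (-l₁ * a x + c x) x
  hasDerivAt_c : ∀ x, 0 ≤ x → HasDerivAt c (-l₂ * c x + V x * ((p + 2) * a x + p * b x)) x
  hasDerivAt_β : ∀ x, 0 ≤ x → HasDerivAt β (-l₃ * β x + V x * (p * a x + (p + 2) * b x)) x
  hasDerivAt_b : ∀ x, 0 ≤ x → HasDerivAt b (β x) x
  coupling_le : ∀ x, 0 ≤ x → |V x| ≤ A * Real.exp (-(κ * x))

namespace IsDampedSystem

variable {a b c β : ℝ → ℂ} {V : ℝ → ℝ} {l₁ l₂ l₃ : ℂ} {p ν κ A : ℝ}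

/-- Weighting `c` and `β` by `1/ν` puts all components on one scale. The energy then grows at a rate
bounded by a multiple of `e^{-κx}`, which is integrable, so its total growth is a fixed factor. -/
theorem energy_bound (hp : 0 ≤ p) (hν : 0 < ν) (hκ : 0 < κ) (hA : 0 ≤ A)
    (h : IsDampedSystem a b c β V l₁ l₂ l₃ p ν κ A) (x : ℝ) (hx : 0 ≤ x) :
    ‖a x‖ ^ 2 + (‖c x‖ / ν) ^ 2 + (‖β x‖ / ν) ^ 2 + ‖b x + β x / l₃‖ ^ 2 ≤
      (‖a 0‖ ^ 2 + (‖c 0‖ / ν) ^ 2 + (‖β 0‖ / ν) ^ 2 + ‖b 0 + β 0 / l₃‖ ^ 2) *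
        Real.exp (6 * (2 * p + 2) / ν * A / κ) := by
  obtain ⟨h₁, h₂, h₃, ha, hc, hβ, hb, hV⟩ := h
  have hl3 : ν ≤ ‖l₃‖ := h₃.trans (Complex.re_le_norm _)
  have hl30 : l₃ ≠ 0 := norm_pos_iff.1 (hν.trans_le hl3)
  -- The undamped `b` is driven directly by `β`. Adding `β / l₃` cancels this drive, and `d'`
  -- contains only the exponentially small coupling.
  set d : ℝ → ℂ := fun x => b x + β x / l₃ with hd
  have hdd : ∀ x, 0 ≤ x → HasDerivAt d (V x * (p * a x + (p + 2) * b x) / l₃) x := by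
    intro x hx
    refine ((hb x hx).add ((hβ x hx).div_const l₃)).congr_deriv ?_
    field_simp
    ring
  set E : ℝ → ℝ := fun x => ‖a x‖ ^ 2 + (‖c x‖ ^ 2 + ‖β x‖ ^ 2) / ν ^ 2 + ‖d x‖ ^ 2 with hE
  set E' : ℝ → ℝ := fun x => 2 * inner ℝ (a x) (-l₁ * a x + c x) +
    (2 * inner ℝ (c x) (-l₂ * c x + V x * ((p + 2) * a x + p * b x)) +
      2 * inner ℝ (β x) (-l₃ * β x + V x * (p * a x + (p + 2) * b x))) / ν ^ 2 +
    2 * inner ℝ (d x) (V x * (p * a x + (p + 2) * b x) / l₃) with hE'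
  have hEd : ∀ x, 0 ≤ x → HasDerivAt E (E' x) x := fun x hx =>
    ((ha x hx).norm_sq.add (((hc x hx).norm_sq.add (hβ x hx).norm_sq).div_const _)).add
      (hdd x hx).norm_sq
  have hE0 : ∀ x, 0 ≤ E x := fun x => by positivity
  set C := 6 * (2 * p + 2) / ν with hC
  have hC0 : 0 ≤ C := by positivity
  have hle : ∀ x, 0 ≤ x → E' x ≤ C * (A * Real.exp (-(κ * x))) * E x := by
    intro x hx
    have n2 : ‖(p : ℂ) + 2‖ = p + 2 := by
      rw [show (p : ℂ) + 2 = ((p + 2 : ℝ) : ℂ) by push_cast; rfl, Complex.norm_real,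
        Real.norm_of_nonneg (by linarith)]
    have n1 : ‖(p : ℂ)‖ = p := by rw [Complex.norm_real, Real.norm_of_nonneg hp]
    set r₁ := ‖a x‖ with hr1
    set r₂ := ‖c x‖ / ν with hr2
    set r₃ := ‖β x‖ / ν with hr3
    set r₄ := ‖d x‖ with hr4
    have r1 : 0 ≤ r₁ := norm_nonneg _
    have r2 : 0 ≤ r₂ := by positivity
    have r3 : 0 ≤ r₃ := by positivity
    have r4 : 0 ≤ r₄ := norm_nonneg _
    have ec : ‖c x‖ = ν * r₂ := by rw [hr2]; field_simp
    have eβ : ‖β x‖ = ν * r₃ := by rw [hr3]; field_simp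
    have hbx : ‖b x‖ ≤ r₄ + r₃ := by
      have e : b x = d x - β x / l₃ := by simp [hd]
      rw [e]
      refine (norm_sub_le _ _).trans ?_
      rw [norm_div, hr3]
      gcongr
    set G := (2 * p + 2) * (r₁ + (r₄ + r₃)) with hG
    have g1 : ‖(p + 2) * a x + p * b x‖ ≤ G := by
      refine (norm_add_le _ _).trans ?_
      rw [norm_mul, norm_mul, n1, n2, ← hr1]
      nlinarith [norm_nonneg (b x)]
    have g2 : ‖p * a x + (p + 2) * b x‖ ≤ G := by
      refine (norm_add_le _ _).trans ?_
      rw [norm_mul, norm_mul, n1, n2, ← hr1]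
      nlinarith [norm_nonneg (b x)]
    have hG0 : 0 ≤ G := by positivity
    set W := A * Real.exp (-(κ * x)) with hW
    have hW0 : 0 ≤ W := by positivity
    have v1 : ‖V x * ((p + 2) * a x + p * b x)‖ ≤ W * G := by
      rw [norm_mul, Complex.norm_real, Real.norm_eq_abs]
      exact mul_le_mul (hV x hx) g1 (norm_nonneg _) hW0
    have v2 : ‖V x * (p * a x + (p + 2) * b x)‖ ≤ W * G := by
      rw [norm_mul, Complex.norm_real, Real.norm_eq_abs]
      exact mul_le_mul (hV x hx) g2 (norm_nonneg _) hW0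
    have v3 : ‖V x * (p * a x + (p + 2) * b x) / l₃‖ ≤ W * G / ν := by
      rw [norm_div]
      gcongr
    have i1 := inner_damped_le (a := a x) (c := c x) h₁
    have i2 := (inner_damped_le (a := c x) (c := V x * ((p + 2) * a x + p * b x)) h₂).trans
      (add_le_add_right (mul_le_mul_of_nonneg_left v1 (norm_nonneg _)) _)
    have i3 := (inner_damped_le (a := β x) (c := V x * (p * a x + (p + 2) * b x)) h₃).trans
      (add_le_add_right (mul_le_mul_of_nonneg_left v2 (norm_nonneg _)) _)
    have i4 := (real_inner_le_norm (d x) (V x * (p * a x + (p + 2) * b x) / l₃)).trans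
      (mul_le_mul_of_nonneg_left v3 (norm_nonneg _))
    rw [← hr1, ec] at i1
    rw [ec] at i2
    rw [eβ] at i3
    rw [← hr4] at i4
    have hEx : E x = r₁ ^ 2 + r₂ ^ 2 + r₃ ^ 2 + r₄ ^ 2 := by
      simp only [hE, ec, eβ, ← hr1, ← hr4]
      field_simp
      ring
    have step : E' x ≤ 2 * (-ν * r₁ ^ 2 + r₁ * (ν * r₂)) +
        (2 * (-ν * (ν * r₂) ^ 2 + ν * r₂ * (W * G)) +
          2 * (-ν * (ν * r₃) ^ 2 + ν * r₃ * (W * G))) / ν ^ 2 + 2 * (r₄ * (W * G / ν)) := by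
      simp only [hE']
      gcongr
    refine step.trans ?_
    have e1 : 2 * (-ν * r₁ ^ 2 + r₁ * (ν * r₂)) +
        (2 * (-ν * (ν * r₂) ^ 2 + ν * r₂ * (W * G)) +
          2 * (-ν * (ν * r₃) ^ 2 + ν * r₃ * (W * G))) / ν ^ 2 + 2 * (r₄ * (W * G / ν)) =
        -2 * ν * (r₁ ^ 2 - r₁ * r₂ + r₂ ^ 2 + r₃ ^ 2) +
          (2 * p + 2) / ν * W * (2 * ((r₂ + r₃ + r₄) * (r₁ + (r₄ + r₃)))) := by
      rw [hG]
      field_simp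
      ring
    have e2 : C * W * E x = (2 * p + 2) / ν * W * (6 * (r₁ ^ 2 + r₂ ^ 2 + r₃ ^ 2 + r₄ ^ 2)) := by
      rw [hC, hEx]; ring
    rw [e1, e2]
    exact energy_algebra hν.le (by positivity) r₁ r₂ r₃ r₄
  -- The integrating factor for the growth rate `C A e^{-κx}`: it is at least `1`, and at `x = 0` it
  -- is the constant in the claim.
  set Φ : ℝ → ℝ := fun x => E x * Real.exp (C * A / κ * Real.exp (-(κ * x))) with hΦ
  have hΦd : ∀ x, 0 ≤ x → HasDerivAt Φ ((E' x - C * (A * Real.exp (-(κ * x))) * E x) *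
      Real.exp (C * A / κ * Real.exp (-(κ * x)))) x := by
    intro x hx
    have h1 : HasDerivAt (fun x : ℝ => Real.exp (-(κ * x))) (Real.exp (-(κ * x)) * (-κ)) x := by
      simpa using (((hasDerivAt_id x).const_mul κ).neg).exp
    refine ((hEd x hx).mul ((h1.const_mul (C * A / κ)).exp)).congr_deriv ?_
    field_simp
    ring
  have hanti : AntitoneOn Φ (Ici 0) := by
    refine antitoneOn_of_deriv_nonpos (convex_Ici 0)
      (fun x hx => (hΦd x hx).continuousAt.continuousWithinAt)
      (fun x hx => (hΦd x (interior_subset hx)).differentiableAt.differentiableWithinAt) ?_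
    intro x hx
    rw [(hΦd x (interior_subset hx)).deriv]
    exact mul_nonpos_of_nonpos_of_nonneg (by linarith [hle x (interior_subset hx)])
      (Real.exp_pos _).le
  have h1 := hanti (mem_Ici.2 le_rfl) (mem_Ici.2 hx) hx
  have h2 : E x ≤ Φ x := by
    refine le_mul_of_one_le_right (hE0 x) (Real.one_le_exp ?_)
    positivity
  have h3 : Φ 0 = E 0 * Real.exp (C * A / κ) := by simp [hΦ]
  have h4 : ∀ x, ‖a x‖ ^ 2 + (‖c x‖ / ν) ^ 2 + (‖β x‖ / ν) ^ 2 + ‖b x + β x / l₃‖ ^ 2 = E x := by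
    intro x
    simp only [hE, hd]
    ring
  rw [h4, h4, ← h3]
  exact h2.trans h1

theorem norm_coupling_le (hp : 0 ≤ p) {R x : ℝ} (ha : ‖a x‖ ≤ R) (hb : ‖b x‖ ≤ R) :
    ‖(p + 2) * a x + p * b x‖ ≤ (2 * p + 2) * R ∧
      ‖p * a x + (p + 2) * b x‖ ≤ (2 * p + 2) * R := by
  have n2 : ‖(p : ℂ) + 2‖ = p + 2 := by
    rw [show (p : ℂ) + 2 = ((p + 2 : ℝ) : ℂ) by push_cast; rfl, Complex.norm_real,
      Real.norm_of_nonneg (by linarith)]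
  have n1 : ‖(p : ℂ)‖ = p := by rw [Complex.norm_real, Real.norm_of_nonneg hp]
  constructor <;>
  · refine (norm_add_le _ _).trans ?_
    rw [norm_mul, norm_mul, n1, n2]
    nlinarith

end IsDampedSystem

theorem norm_sub_le_of_exp_deriv {d d' : ℝ → ℂ} {κ M : ℝ} (hκ : 0 < κ)
    (hd : ∀ x, 0 ≤ x → HasDerivAt d (d' x) x)
    (hd' : ∀ x, 0 ≤ x → ‖d' x‖ ≤ M * Real.exp (-(κ * x))) {x y : ℝ} (hx : 0 ≤ x) (hxy : x ≤ y) :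
    ‖d y - d x‖ ≤ M / κ * Real.exp (-(κ * x)) := by
  have hM : 0 ≤ M := nonneg_of_mul_nonneg_left ((norm_nonneg _).trans (hd' x hx)) (Real.exp_pos _)
  have hB : ∀ s : ℝ, HasDerivAt (fun s : ℝ => M / κ *
      (Real.exp (-(κ * x)) - Real.exp (-(κ * s)))) (M * Real.exp (-(κ * s))) s := by
    intro s
    have h1 : HasDerivAt (fun x : ℝ => Real.exp (-(κ * x))) (Real.exp (-(κ * s)) * (-κ)) s := by
      simpa using (((hasDerivAt_id s).const_mul κ).neg).exp
    refine ((h1.const_sub (Real.exp (-(κ * x)))).const_mul (M / κ)).congr_deriv ?_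
    field_simp
  have key := image_norm_le_of_norm_deriv_right_le_deriv_boundary (a := x) (b := y)
    (f := fun s => d s - d x) (f' := d')
    (fun s hs => ((hd s (hx.trans hs.1)).sub_const _).continuousAt.continuousWithinAt)
    (fun s hs => ((hd s (hx.trans hs.1)).sub_const _).hasDerivWithinAt) (by simp) hB
    (fun s hs => hd' s (hx.trans hs.1)) (⟨hxy, le_rfl⟩ : y ∈ Icc x y)
  refine key.trans ?_
  gcongr
  linarith [Real.exp_pos (-(κ * y))]

-- A bootstrap. The energy bounds `a` and `b` uniformly, hence the coupling terms are of size
-- `e^{-κx}`. Damping then gives `c` and `β` a factor `μ⁻¹`, and one more damped integration gives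
-- `a` a factor `μ⁻²`. Only increments of `b` can be small, since `b` has a nonzero limit in the
-- application.
set_option maxHeartbeats 800000 in
theorem exists_damped_bound {p μ₀ κ₀ A₀ K : ℝ} (hp : 0 ≤ p) (hμ₀ : 0 < μ₀) (hκ₀ : 0 < κ₀)
    (hA₀ : 0 ≤ A₀) (hK : 0 ≤ K) : ∃ K', 0 < K' ∧
      ∀ (a b c β : ℝ → ℂ) (V : ℝ → ℝ) (l₁ l₂ l₃ : ℂ) (μ κ A γ : ℝ), μ₀ ≤ μ → κ₀ ≤ κ → 0 ≤ A →
      A ≤ A₀ → 0 ≤ γ → γ ≤ μ / 8 → γ ≤ κ → IsDampedSystem a b c β V l₁ l₂ l₃ p (4 / 5 * μ) κ A →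
      ‖a 0‖ ≤ K / μ ^ 2 → ‖c 0‖ ≤ K / μ → ‖β 0‖ ≤ K / μ → ‖b 0‖ ≤ K → ∀ x, 0 ≤ x →
        ‖a x‖ ≤ K' / μ ^ 2 * Real.exp (-γ * x) ∧ ‖c x‖ ≤ K' / μ * Real.exp (-γ * x) ∧
        ‖β x‖ ≤ K' / μ * Real.exp (-γ * x) ∧
        ∀ y, x ≤ y → ‖b y - b x‖ ≤ K' / μ * Real.exp (-γ * x) := by
  set t := 5 / 4 / μ₀ ^ 2 with ht
  set E₁ := (K / μ₀ ^ 2) ^ 2 + (K * t) ^ 2 + (K * t) ^ 2 + (K + K * t) ^ 2 with hE₁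
  set E₂ := E₁ * Real.exp (6 * (2 * p + 2) / (4 / 5 * μ₀) * A₀ / κ₀) with hE₂
  set R := 2 * √E₂ with hR
  set H := A₀ * ((2 * p + 2) * R) with hH
  have hH0 : 0 ≤ H := by positivity
  set K₁ := K + 2 * H with hK₁
  have hK₁0 : 0 ≤ K₁ := by positivity
  refine ⟨K + 2 * K₁ + K₁ + (5 / 4 * H / κ₀ + 2 * (K₁ * (5 / 4) / μ₀)) + 1, by positivity, ?_⟩
  intro a b c β V l₁ l₂ l₃ μ κ A γ hμμ hκκ hA hAA hγ hγμ hγκ hsys ha0 hc0 hβ0 hb0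
  have hμ : 0 < μ := hμ₀.trans_le hμμ
  have hκ : 0 < κ := hκ₀.trans_le hκκ
  have hν : 0 < 4 / 5 * μ := by positivity
  have hl3 : 4 / 5 * μ ≤ ‖l₃‖ := hsys.re_three.trans (Complex.re_le_norm _)
  have hl3p : 0 < ‖l₃‖ := hν.trans_le hl3
  have hdiv : ∀ y : ℂ, ‖y‖ ≤ K / μ → ‖y‖ / (4 / 5 * μ) ≤ K * t := by
    intro y hy
    rw [div_le_iff₀ hν]
    refine hy.trans ?_
    rw [div_le_iff₀ hμ, ht]
    have : 1 ≤ μ ^ 2 / μ₀ ^ 2 := by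
      rw [one_le_div (by positivity)]
      gcongr
    calc K = K * 1 := (mul_one K).symm
      _ ≤ K * (μ ^ 2 / μ₀ ^ 2) := by gcongr
      _ = _ := by field_simp
  have hinit : ‖a 0‖ ^ 2 + (‖c 0‖ / (4 / 5 * μ)) ^ 2 + (‖β 0‖ / (4 / 5 * μ)) ^ 2 +
      ‖b 0 + β 0 / l₃‖ ^ 2 ≤ E₁ := by
    have i1 : ‖a 0‖ ≤ K / μ₀ ^ 2 := ha0.trans (by gcongr)
    have i4 : ‖b 0 + β 0 / l₃‖ ≤ K + K * t := by
      refine (norm_add_le _ _).trans (add_le_add hb0 ?_)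
      rw [norm_div]
      exact (div_le_div_of_nonneg_left (norm_nonneg _) hν hl3).trans (hdiv _ hβ0)
    have i2 := hdiv _ hc0
    have i3 := hdiv _ hβ0
    rw [hE₁]
    gcongr
  have hE : ∀ x, 0 ≤ x → ‖a x‖ ^ 2 + (‖c x‖ / (4 / 5 * μ)) ^ 2 + (‖β x‖ / (4 / 5 * μ)) ^ 2 +
      ‖b x + β x / l₃‖ ^ 2 ≤ E₂ := by
    intro x hx
    refine (hsys.energy_bound hp hν hκ hA x hx).trans ?_
    rw [hE₂]
    gcongr
  have hbd : ∀ x, 0 ≤ x → ‖a x‖ ≤ R ∧ ‖b x‖ ≤ R := by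
    intro x hx
    have h1 := hE x hx
    have q1 : ‖a x‖ ≤ √E₂ := Real.le_sqrt_of_sq_le (by
      have : 0 ≤ (‖c x‖ / (4 / 5 * μ)) ^ 2 + (‖β x‖ / (4 / 5 * μ)) ^ 2 + ‖b x + β x / l₃‖ ^ 2 := by
        positivity
      linarith)
    have q3 : ‖β x‖ / (4 / 5 * μ) ≤ √E₂ := Real.le_sqrt_of_sq_le (by
      have : 0 ≤ ‖a x‖ ^ 2 + (‖c x‖ / (4 / 5 * μ)) ^ 2 + ‖b x + β x / l₃‖ ^ 2 := by positivity
      linarith)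
    have q4 : ‖b x + β x / l₃‖ ≤ √E₂ := Real.le_sqrt_of_sq_le (by
      have : 0 ≤ ‖a x‖ ^ 2 + (‖c x‖ / (4 / 5 * μ)) ^ 2 + (‖β x‖ / (4 / 5 * μ)) ^ 2 := by positivity
      linarith)
    have q5 : ‖β x / l₃‖ ≤ √E₂ := by
      rw [norm_div]
      exact (div_le_div_of_nonneg_left (norm_nonneg _) hν hl3).trans q3
    refine ⟨q1.trans (by rw [hR]; linarith [Real.sqrt_nonneg E₂]), ?_⟩
    have e : b x = (b x + β x / l₃) - β x / l₃ := by ring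
    rw [e, hR]
    exact (norm_sub_le _ _).trans (by linarith)
  have hsrc : ∀ x, 0 ≤ x → ‖V x * ((p + 2) * a x + p * b x)‖ ≤ H * Real.exp (-(κ * x)) ∧
      ‖V x * (p * a x + (p + 2) * b x)‖ ≤ H * Real.exp (-(κ * x)) := by
    intro x hx
    obtain ⟨g1, g2⟩ := IsDampedSystem.norm_coupling_le hp (hbd x hx).1 (hbd x hx).2
    have hV : |V x| ≤ A₀ * Real.exp (-(κ * x)) :=
      (hsys.coupling_le x hx).trans (by gcongr)
    have e : H * Real.exp (-(κ * x)) = A₀ * Real.exp (-(κ * x)) * ((2 * p + 2) * R) := by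
      rw [hH]; ring
    rw [e, norm_mul, norm_mul, Complex.norm_real, Real.norm_eq_abs]
    exact ⟨mul_le_mul hV g1 (norm_nonneg _) (by positivity),
      mul_le_mul hV g2 (norm_nonneg _) (by positivity)⟩
  have hexp : ∀ x, 0 ≤ x → Real.exp (-(κ * x)) ≤ Real.exp (-γ * x) := fun x hx =>
    Real.exp_le_exp.2 (by nlinarith)
  have hγν : μ / 2 ≤ 4 / 5 * μ - γ := by linarith
  have hγν' : γ < 4 / 5 * μ := by linarith
  have hquot : ∀ y, 0 ≤ y → y / (4 / 5 * μ - γ) ≤ 2 * y / μ := by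
    intro y hy
    calc y / (4 / 5 * μ - γ) ≤ y / (μ / 2) := by gcongr
      _ = 2 * y / μ := by field_simp
  have hcb : ∀ x, 0 ≤ x → ‖c x‖ ≤ K₁ / μ * Real.exp (-γ * x) := by
    intro x hx
    refine (norm_le_of_damped hγν' hsys.re_two hH0 hsys.hasDerivAt_c
      (fun x hx => (hsrc x hx).1.trans (mul_le_mul_of_nonneg_left (hexp x hx) hH0)) x hx).trans ?_
    gcongr
    calc ‖c 0‖ + H / (4 / 5 * μ - γ) ≤ K / μ + 2 * H / μ := add_le_add hc0 (hquot H hH0)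
      _ = K₁ / μ := by rw [hK₁]; ring
  have hβb : ∀ x, 0 ≤ x → ‖β x‖ ≤ K₁ / μ * Real.exp (-γ * x) := by
    intro x hx
    refine (norm_le_of_damped hγν' hsys.re_three hH0 hsys.hasDerivAt_β
      (fun x hx => (hsrc x hx).2.trans (mul_le_mul_of_nonneg_left (hexp x hx) hH0)) x hx).trans ?_
    gcongr
    calc ‖β 0‖ + H / (4 / 5 * μ - γ) ≤ K / μ + 2 * H / μ := add_le_add hβ0 (hquot H hH0)
      _ = K₁ / μ := by rw [hK₁]; ring
  have hab : ∀ x, 0 ≤ x → ‖a x‖ ≤ (K + 2 * K₁) / μ ^ 2 * Real.exp (-γ * x) := by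
    intro x hx
    refine (norm_le_of_damped hγν' hsys.re_one (by positivity) hsys.hasDerivAt_a hcb x hx).trans ?_
    gcongr
    calc ‖a 0‖ + K₁ / μ / (4 / 5 * μ - γ) ≤ K / μ ^ 2 + 2 * (K₁ / μ) / μ :=
          add_le_add ha0 (hquot _ (by positivity))
      _ = _ := by field_simp
  have hl30 : l₃ ≠ 0 := norm_pos_iff.1 hl3p
  have hbb : ∀ x, 0 ≤ x → ∀ y, x ≤ y → ‖b y - b x‖ ≤
      (5 / 4 * H / κ₀ + 2 * (K₁ * (5 / 4) / μ₀)) / μ * Real.exp (-γ * x) := by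
    intro x hx y hxy
    set d : ℝ → ℂ := fun x => b x + β x / l₃ with hd
    have hdd : ∀ x, 0 ≤ x → HasDerivAt d (V x * (p * a x + (p + 2) * b x) / l₃) x := by
      intro x hx
      refine ((hsys.hasDerivAt_b x hx).add ((hsys.hasDerivAt_β x hx).div_const l₃)).congr_deriv ?_
      field_simp
      ring
    have key2 : ‖d y - d x‖ ≤ 5 / 4 * H / κ₀ / μ * Real.exp (-γ * x) := by
      have key := norm_sub_le_of_exp_deriv (M := H / (4 / 5 * μ)) hκ hdd (fun s hs => by
        rw [norm_div, div_mul_eq_mul_div]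
        exact div_le_div₀ (by positivity) (hsrc s hs).2 hν hl3) hx hxy
      refine key.trans ?_
      calc H / (4 / 5 * μ) / κ * Real.exp (-(κ * x))
          ≤ H / (4 / 5 * μ) / κ₀ * Real.exp (-γ * x) :=
            mul_le_mul (div_le_div_of_nonneg_left (by positivity) hκ₀ hκκ) (hexp x hx)
              (Real.exp_pos _).le (by positivity)
        _ = _ := by field_simp
    have hβl : ∀ s, x ≤ s → ‖β s / l₃‖ ≤ K₁ * (5 / 4) / μ₀ / μ * Real.exp (-γ * x) := by
      intro s hs
      rw [norm_div]
      have h1 := hβb s (hx.trans hs)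
      have h2 : Real.exp (-γ * s) ≤ Real.exp (-γ * x) := Real.exp_le_exp.2 (by nlinarith)
      calc ‖β s‖ / ‖l₃‖ ≤ (K₁ / μ * Real.exp (-γ * x)) / (4 / 5 * μ₀) := by
            refine div_le_div₀ (by positivity) (h1.trans (by gcongr)) (by positivity) ?_
            exact le_trans (by gcongr) hl3
        _ = _ := by field_simp
    have e : b y - b x = (d y - d x) - β y / l₃ + β x / l₃ := by simp only [hd]; ring
    rw [e]
    refine (norm_add_le _ _).trans ((add_le_add_left (norm_sub_le _ _) _).trans ?_)
    calc ‖d y - d x‖ + ‖β y / l₃‖ + ‖β x / l₃‖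
        ≤ 5 / 4 * H / κ₀ / μ * Real.exp (-γ * x) +
          K₁ * (5 / 4) / μ₀ / μ * Real.exp (-γ * x) + K₁ * (5 / 4) / μ₀ / μ * Real.exp (-γ * x) :=
          add_le_add (add_le_add key2 (hβl y hxy)) (hβl x le_rfl)
      _ = _ := by ring
  intro x hx
  have hx0 := Real.exp_pos (-γ * x)
  have hq : 0 ≤ 5 / 4 * H / κ₀ + 2 * (K₁ * (5 / 4) / μ₀) := by positivity
  refine ⟨(hab x hx).trans ?_, (hcb x hx).trans ?_, (hβb x hx).trans ?_, fun y hy =>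
    (hbb x hx y hy).trans ?_⟩ <;>
  exact mul_le_mul_of_nonneg_right
    (div_le_div_of_nonneg_right (by linarith) (by positivity)) hx0.le

/-! ### The seed of the growing solution -/

theorem potentialRate_le {p ω ω' : ℝ} (hp : 4 < p) (h : ω ≤ ω') :
    potentialRate p ω ≤ potentialRate p ω' := by
  unfold potentialRate
  gcongr

/-- Remainder bounds which are uniform for `ω` in a compact interval. -/
theorem exists_uniform_remainder_bound {p ρ₀ ω₂ : ℝ} (hp : 4 < p) (hρ0 : 0 ≤ ρ₀) (hρ1 : ρ₀ < 1)
    (hω₂ : 0 < ω₂) :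
    ∃ K, 0 < K ∧ ∀ ω θ ξ : ℝ, 0 < ω → ω ≤ ω₂ → |θ| ≤ ρ₀ → ∀ z : ℂ, ∀ k ≤ 1, ∀ x, 0 ≤ x →
      (‖z - ξ‖ ≤ √ω / 10 → ‖remainder p ω θ (Complex.I * z) z ![1, 0] k x‖ ≤
        K / decayRate ω ξ * Real.exp (-(potentialRate p ω * x))) ∧
      (‖z - ξ‖ ≤ decayRate ω ξ / 16 →
        ‖remainder p ω θ (-complexRate ω z) z ![0, 1] k x‖ ≤
          K / decayRate ω ξ * Real.exp (-(potentialRate p ω * x)) ∧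
        ‖remainder p ω θ (-complexRate ω z) z ![0, 1] k x 0‖ ≤
          K / decayRate ω ξ ^ 2 * Real.exp (-(potentialRate p ω * x))) := by
  obtain ⟨K, hK, hb⟩ := exists_remainder_bound hp hρ0 hρ1
  set κ := potentialRate p ω₂ with hκ
  have hκ0 : 0 < κ := potentialRate_pos hp hω₂
  refine ⟨(K * √ω₂ + 2 * (K * ω₂)) * (1 + κ), by positivity, ?_⟩
  intro ω θ ξ hω hωω hθ z k hk x hx
  have hμ := decayRate_pos hω ξ
  have hκ1 := potentialRate_pos hp hω
  have hκk : potentialRate p ω ^ k ≤ 1 + κ := by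
    have := potentialRate_le hp hωω
    interval_cases k
    · simpa using hκ0.le
    · simp only [pow_one]; linarith
  have hs : √ω ≤ √ω₂ := Real.sqrt_le_sqrt hωω
  have main : K * √ω / decayRate ω ξ * potentialRate p ω ^ k *
        Real.exp (-(potentialRate p ω * x)) ≤
      (K * √ω₂ + 2 * (K * ω₂)) * (1 + κ) / decayRate ω ξ *
        Real.exp (-(potentialRate p ω * x)) := by
    refine mul_le_mul_of_nonneg_right ?_ (Real.exp_pos _).le
    calc K * √ω / decayRate ω ξ * potentialRate p ω ^ k
        = K * √ω * potentialRate p ω ^ k / decayRate ω ξ := by ring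
      _ ≤ (K * √ω₂ + 2 * (K * ω₂)) * (1 + κ) / decayRate ω ξ := by
          refine div_le_div_of_nonneg_right (mul_le_mul ?_ hκk (by positivity) (by positivity))
            hμ.le
          have h1 : K * √ω ≤ K * √ω₂ := by gcongr
          have h2 : 0 ≤ 2 * (K * ω₂) := by positivity
          linarith
  refine ⟨fun hz => ?_, fun hz => ⟨?_, ?_⟩⟩
  · exact ((hb ω θ _ hω hθ hμ _ _ _ (isFrobeniusExponent_oscillating hp hω hz) k hk x
      hx).1).trans main
  · exact ((hb ω θ _ hω hθ hμ _ _ _ (isFrobeniusExponent_decaying hp hω hz) k hk x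
      hx).1).trans main
  · have h := (hb ω θ _ hω hθ hμ _ _ _ (isFrobeniusExponent_decaying hp hω hz) k hk x hx).2
      (decayRate ω ξ ^ 2 / 2) (by positivity) (decaying_denominator_lower hp hω hz)
    refine h.trans (mul_le_mul_of_nonneg_right ?_ (Real.exp_pos _).le)
    calc K * ω / (decayRate ω ξ ^ 2 / 2) * potentialRate p ω ^ k
        = 2 * (K * ω) * potentialRate p ω ^ k / decayRate ω ξ ^ 2 := by field_simp
      _ ≤ (K * √ω₂ + 2 * (K * ω₂)) * (1 + κ) / decayRate ω ξ ^ 2 := by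
          refine div_le_div_of_nonneg_right (mul_le_mul ?_ hκk (by positivity) (by positivity))
            (by positivity)
          have h1 : K * ω ≤ K * ω₂ := by gcongr
          have h2 : 0 ≤ K * √ω₂ := by positivity
          linarith

/-- Cauchy data at the origin of the decaying solution. -/
def decayingData (p ω θ : ℝ) (z : ℂ) : CauchyData :=
  frobeniusData p ω θ (-complexRate ω z) z ![0, 1] 0

theorem decayingData_eq (p ω θ : ℝ) (z : ℂ) :
    decayingData p ω θ z =
      (![0, 1] + remainder p ω θ (-complexRate ω z) z ![0, 1] 0 0,
        -complexRate ω z • (![0, 1] + remainder p ω θ (-complexRate ω z) z ![0, 1] 0 0) +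
          remainder p ω θ (-complexRate ω z) z ![0, 1] 1 0) := by
  simp only [decayingData, frobeniusData, remainder, if_true, one_ne_zero, if_false, sub_zero,
    add_sub_cancel, Complex.ofReal_zero, mul_zero, Complex.exp_zero, one_smul]

/-- The normalizing factor `f'(0)² / m² + f(0)²` of the decaying solution `f`. -/
def seedNorm (p ω θ : ℝ) (z : ℂ) : ℂ :=
  ((decayingData p ω θ z).2 0 ^ 2 + (decayingData p ω θ z).2 1 ^ 2) / complexRate ω z ^ 2 +
    ((decayingData p ω θ z).1 0 ^ 2 + (decayingData p ω θ z).1 1 ^ 2)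

/-- Cauchy data at the origin of the growing solution. -/
def growingData (p ω θ : ℝ) (z : ℂ) : CauchyData :=
  ((-2 / (complexRate ω z * seedNorm p ω θ z)) • (decayingData p ω θ z).2,
    (2 / seedNorm p ω θ z * complexRate ω z) • (decayingData p ω θ z).1)

/-- With `f` the decaying solution, `m` the complex rate and `D` the seed norm, the data
`-2f'(0)/(mD)` and `2m f(0)/D` have Wronskian `-(2m/D)(f'(0)²/m² + f(0)²)` with `f`, and the bracket
is exactly `D`. No conjugation occurs, so the data stay holomorphic in `z`. -/
theorem dataWronskian_growingData {p ω θ : ℝ} {z : ℂ} (hm : complexRate ω z ≠ 0)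
    (hD : seedNorm p ω θ z ≠ 0) :
    dataWronskian (decayingData p ω θ z) (growingData p ω θ z) = -2 * complexRate ω z := by
  have e : seedNorm p ω θ z = ((decayingData p ω θ z).2 0 ^ 2 + (decayingData p ω θ z).2 1 ^ 2) /
      complexRate ω z ^ 2 +
    ((decayingData p ω θ z).1 0 ^ 2 + (decayingData p ω θ z).1 1 ^ 2) := rfl
  rw [dataWronskian_eq]
  simp only [growingData, Pi.smul_apply, smul_eq_mul]
  set F := decayingData p ω θ z
  set m := complexRate ω z
  set D := seedNorm p ω θ z
  have h2 : D * m ^ 2 = F.2 0 ^ 2 + F.2 1 ^ 2 + m ^ 2 * (F.1 0 ^ 2 + F.1 1 ^ 2) := by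
    rw [e]
    field_simp
  have key : F.2 0 * (-2 / (m * D) * F.2 0) + F.2 1 * (-2 / (m * D) * F.2 1) -
      (F.1 0 * (2 / D * m * F.1 0) + F.1 1 * (2 / D * m * F.1 1)) =
      -2 / (m * D) * (F.2 0 ^ 2 + F.2 1 ^ 2 + m ^ 2 * (F.1 0 ^ 2 + F.1 1 ^ 2)) := by
    field_simp
    ring
  rw [key, ← h2]
  field_simp

theorem complexRate_ne_zero {ω ξ : ℝ} (hω : 0 < ω) {z : ℂ}
    (hz : ‖z - ξ‖ ≤ decayRate ω ξ / 16) : complexRate ω z ≠ 0 := by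
  intro h
  have h1 := (complexRate_bounds hω hz).1
  have h2 := decayRate_pos hω ξ
  rw [h, Complex.zero_re] at h1
  linarith

theorem le_norm_complexRate {ω ξ : ℝ} (hω : 0 < ω) {z : ℂ}
    (hz : ‖z - ξ‖ ≤ decayRate ω ξ / 16) : 9 / 10 * decayRate ω ξ ≤ ‖complexRate ω z‖ :=
  (complexRate_bounds hω hz).1.trans (Complex.re_le_norm _)

theorem differentiableOn_decayingData {p ω θ ξ : ℝ} (hp : 4 < p) (hω : 0 < ω) (hθ : |θ| < 1) :
    DifferentiableOn ℂ (decayingData p ω θ) (Metric.ball (ξ : ℂ) (decayRate ω ξ / 16)) := by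
  have hball : ∀ z ∈ Metric.ball (ξ : ℂ) (decayRate ω ξ / 16), ‖z - ξ‖ ≤ decayRate ω ξ / 16 :=
    fun z hz => (mem_ball_iff_norm.1 hz).le
  have hm : DifferentiableOn ℂ (fun z => -complexRate ω z)
      (Metric.ball (ξ : ℂ) (decayRate ω ξ / 16)) := fun z hz =>
    (complexRate_differentiableAt hω (hball z hz)).neg.differentiableWithinAt
  have hr := fun k => differentiableOn_remainder (θ := θ) (c₀ := ![0, 1]) hp hω hθ
    Metric.isOpen_ball hm
    (fun z hz => ⟨_, decayRate_pos hω ξ, isFrobeniusExponent_decaying hp hω (hball z hz)⟩) k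
    (le_refl (0 : ℝ))
  have e : decayingData p ω θ = fun z => (![0, 1] + remainder p ω θ (-complexRate ω z) z ![0, 1] 0 0,
        -complexRate ω z • (![0, 1] + remainder p ω θ (-complexRate ω z) z ![0, 1] 0 0) +
          remainder p ω θ (-complexRate ω z) z ![0, 1] 1 0) := funext (decayingData_eq p ω θ)
  rw [e]
  exact ((hr 0).const_add _).prodMk ((hm.smul ((hr 0).const_add _)).add (hr 1))

theorem differentiableOn_seedNorm {p ω θ ξ : ℝ} (hp : 4 < p) (hω : 0 < ω) (hθ : |θ| < 1) :
    DifferentiableOn ℂ (seedNorm p ω θ) (Metric.ball (ξ : ℂ) (decayRate ω ξ / 16)) := by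
  have hF := differentiableOn_decayingData (ξ := ξ) hp hω hθ
  have h1 := fun i => differentiableOn_pi.1 hF.fst i
  have h2 := fun i => differentiableOn_pi.1 hF.snd i
  have hball : ∀ z ∈ Metric.ball (ξ : ℂ) (decayRate ω ξ / 16), ‖z - ξ‖ ≤ decayRate ω ξ / 16 :=
    fun z hz => (mem_ball_iff_norm.1 hz).le
  have hm : DifferentiableOn ℂ (fun z => complexRate ω z ^ 2)
      (Metric.ball (ξ : ℂ) (decayRate ω ξ / 16)) := fun z hz =>
    ((complexRate_differentiableAt hω (hball z hz)).pow 2).differentiableWithinAt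
  unfold seedNorm
  exact ((((h2 0).pow 2).add ((h2 1).pow 2)).div hm fun z hz =>
    pow_ne_zero 2 (complexRate_ne_zero hω (hball z hz))).add (((h1 0).pow 2).add ((h1 1).pow 2))

theorem star_complexRate_ofReal {ω : ℝ} (hω : 0 < ω) (ξ : ℝ) :
    star (complexRate ω ξ) = complexRate ω ξ := by
  simp [complexRate_ofReal hω]

theorem star_decayingData {p ω θ : ℝ} (hω : 0 < ω) (ξ : ℝ) :
    star (decayingData p ω θ ξ) = decayingData p ω θ ξ := by
  rw [decayingData, frobeniusData_star, star_neg, star_complexRate_ofReal hω]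
  have : star (![0, 1] : Fin 2 → ℂ) = ![0, 1] := by ext i; fin_cases i <;> simp
  rw [this]
  simp

theorem complexRate_neg (ω : ℝ) (z : ℂ) : complexRate ω (-z) = complexRate ω z := by
  simp [complexRate]

theorem decayingData_neg (p ω θ : ℝ) (z : ℂ) :
    decayingData p ω θ (-z) = decayingData p ω θ z := by
  rw [decayingData, frobeniusData_neg, complexRate_neg]; rfl

theorem seedNorm_neg (p ω θ : ℝ) (z : ℂ) : seedNorm p ω θ (-z) = seedNorm p ω θ z := by
  rw [seedNorm, decayingData_neg, complexRate_neg]; rfl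

theorem growingData_neg (p ω θ : ℝ) (z : ℂ) : growingData p ω θ (-z) = growingData p ω θ z := by
  rw [growingData, decayingData_neg, seedNorm_neg, complexRate_neg]; rfl

theorem star_decayingData_apply {p ω θ : ℝ} (hω : 0 < ω) (ξ : ℝ) (i : Fin 2) :
    star ((decayingData p ω θ ξ).1 i) = (decayingData p ω θ ξ).1 i ∧
      star ((decayingData p ω θ ξ).2 i) = (decayingData p ω θ ξ).2 i := by
  have h := star_decayingData (p := p) (θ := θ) hω ξ
  exact ⟨congrFun (congrArg Prod.fst h) i, congrFun (congrArg Prod.snd h) i⟩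

theorem star_seedNorm {p ω θ : ℝ} (hω : 0 < ω) (ξ : ℝ) :
    star (seedNorm p ω θ ξ) = seedNorm p ω θ ξ := by
  have h := star_decayingData_apply (p := p) (θ := θ) hω ξ
  simp only [seedNorm, star_add, star_div₀, star_pow, (h _).1, (h _).2,
    star_complexRate_ofReal hω]

theorem star_growingData {p ω θ : ℝ} (hω : 0 < ω) (ξ : ℝ) :
    star (growingData p ω θ ξ) = growingData p ω θ ξ := by
  have h := star_decayingData_apply (p := p) (θ := θ) hω ξ
  have h0 := star_seedNorm (p := p) (θ := θ) hω ξ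
  have h1 := star_complexRate_ofReal hω ξ
  refine Prod.ext (funext fun i => ?_) (funext fun i => ?_)
  · simp only [growingData, Prod.fst_star, Pi.star_apply, Pi.smul_apply, smul_eq_mul, star_mul',
      star_div₀, (h _).2, h0, h1, star_neg, star_ofNat]
  · simp only [growingData, Prod.snd_star, Pi.star_apply, Pi.smul_apply, smul_eq_mul, star_mul',
      star_div₀, (h _).1, h0, h1, star_ofNat]

/-! ### A lower bound for the normalizing factor -/

/-- Here `u` is the remainder of `f₃` at the origin and `v` is its derivative divided by the complex
rate; for `u = v = 0` the seed norm is `1 + 1`. -/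
theorem norm_seed_sub_le {u₀ u₁ v₀ v₁ : ℂ} {t : ℝ} (h₀ : ‖u₀‖ ≤ t) (h₁ : ‖u₁‖ ≤ t)
    (h₂ : ‖v₀‖ ≤ t) (h₃ : ‖v₁‖ ≤ t) :
    ‖(v₀ - u₀) ^ 2 + (v₁ - (1 + u₁)) ^ 2 + (u₀ ^ 2 + (1 + u₁) ^ 2) - 2‖ ≤ 6 * t + 10 * t ^ 2 := by
  have ht : 0 ≤ t := (norm_nonneg _).trans h₀
  have e : (v₀ - u₀) ^ 2 + (v₁ - (1 + u₁)) ^ 2 + (u₀ ^ 2 + (1 + u₁) ^ 2) - 2 =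
      (v₀ - u₀) ^ 2 + (v₁ - u₁) ^ 2 + -2 * (v₁ - u₁) + u₀ ^ 2 + u₁ ^ 2 + 2 * u₁ := by ring
  have a₀ : ‖v₀ - u₀‖ ≤ 2 * t := (norm_sub_le _ _).trans (by linarith)
  have a₁ : ‖v₁ - u₁‖ ≤ 2 * t := (norm_sub_le _ _).trans (by linarith)
  rw [e]
  have hn : ‖(v₀ - u₀) ^ 2 + (v₁ - u₁) ^ 2 + -2 * (v₁ - u₁) + u₀ ^ 2 + u₁ ^ 2 + 2 * u₁‖ ≤
      ‖v₀ - u₀‖ ^ 2 + ‖v₁ - u₁‖ ^ 2 + 2 * ‖v₁ - u₁‖ + ‖u₀‖ ^ 2 + ‖u₁‖ ^ 2 + 2 * ‖u₁‖ := by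
    refine (norm_add_le _ _).trans (add_le_add ((norm_add_le _ _).trans (add_le_add
      ((norm_add_le _ _).trans (add_le_add ((norm_add_le _ _).trans (add_le_add
      ((norm_add_le _ _).trans (add_le_add ?_ ?_)) ?_)) ?_)) ?_)) ?_) <;> simp
  refine hn.trans ?_
  have b₀ : ‖v₀ - u₀‖ ^ 2 ≤ (2 * t) ^ 2 := by gcongr
  have b₁ : ‖v₁ - u₁‖ ^ 2 ≤ (2 * t) ^ 2 := by gcongr
  have b₂ : ‖u₀‖ ^ 2 ≤ t ^ 2 := by gcongr
  have b₃ : ‖u₁‖ ^ 2 ≤ t ^ 2 := by gcongr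
  linarith

/-- The normalizing factor is close to `2` at high energy, and bounded in general. -/
theorem exists_norm_seedNorm_sub_le {p ρ₀ ω₁ ω₂ : ℝ} (hp : 4 < p) (hρ0 : 0 ≤ ρ₀) (hρ1 : ρ₀ < 1)
    (hω₁ : 0 < ω₁) (hω₂ : 0 < ω₂) :
    ∃ K, 0 < K ∧ ∀ ω θ ξ : ℝ, ω₁ ≤ ω → ω ≤ ω₂ → |θ| ≤ ρ₀ → ∀ z : ℂ,
      ‖z - ξ‖ ≤ decayRate ω ξ / 16 →
      ‖seedNorm p ω θ z - 2‖ ≤ 6 * (K / decayRate ω ξ) + 10 * (K / decayRate ω ξ) ^ 2 := by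
  obtain ⟨K, hK, hb⟩ := exists_uniform_remainder_bound hp hρ0 hρ1 hω₂
  have hs₁ : 0 < √ω₁ := Real.sqrt_pos.2 hω₁
  refine ⟨K + K / √ω₁, by positivity, fun ω θ ξ h₁ h₂ hθ z hz => ?_⟩
  have hω : 0 < ω := hω₁.trans_le h₁
  have hμ := decayRate_pos hω ξ
  have hm0 := complexRate_ne_zero hω hz
  have hs : √ω₁ ≤ ‖complexRate ω z‖ := by
    have := Real.sqrt_le_sqrt h₁
    linarith [le_norm_complexRate hω hz, decayRate_lower hω ξ]
  have hr := fun k (hk : k ≤ 1) => ((hb ω θ ξ hω h₂ hθ z k hk 0 le_rfl).2 hz).1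
  simp only [mul_zero, neg_zero, Real.exp_zero, mul_one] at hr
  set m := complexRate ω z with hm
  set u := remainder p ω θ (-m) z ![0, 1] 0 0 with hu
  set v := remainder p ω θ (-m) z ![0, 1] 1 0 with hv
  have hT : K / decayRate ω ξ ≤ (K + K / √ω₁) / decayRate ω ξ := by
    gcongr
    linarith [show 0 ≤ K / √ω₁ by positivity]
  have hu' : ∀ i, ‖u i‖ ≤ (K + K / √ω₁) / decayRate ω ξ := fun i =>
    (norm_le_pi_norm u i).trans ((hr 0 zero_le_one).trans hT)
  have hv' : ∀ i, ‖m⁻¹ * v i‖ ≤ (K + K / √ω₁) / decayRate ω ξ := by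
    intro i
    rw [norm_mul, norm_inv]
    calc ‖m‖⁻¹ * ‖v i‖ ≤ (√ω₁)⁻¹ * (K / decayRate ω ξ) :=
          mul_le_mul (inv_anti₀ hs₁ hs) ((norm_le_pi_norm v i).trans (hr 1 le_rfl))
            (norm_nonneg _) (by positivity)
      _ = K / √ω₁ / decayRate ω ξ := by field_simp
      _ ≤ _ := by
        gcongr
        linarith
  have e : seedNorm p ω θ z = (m⁻¹ * v 0 - u 0) ^ 2 + (m⁻¹ * v 1 - (1 + u 1)) ^ 2 +
      (u 0 ^ 2 + (1 + u 1) ^ 2) := by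
    rw [seedNorm, decayingData_eq, ← hm, ← hu, ← hv]
    simp only [Pi.add_apply, Pi.smul_apply, smul_eq_mul, Matrix.cons_val_zero, Matrix.cons_val_one,
      zero_add]
    field_simp
    ring
  rw [e]
  exact norm_seed_sub_le (hu' 0) (hu' 1) (hv' 0) (hv' 1)

/-- At real `ξ` the data are real, so the seed norm is a sum of nonnegative squares in which nothing
cancels. -/
theorem norm_sq_decayingData_le {p ω θ : ℝ} (hω : 0 < ω) (ξ : ℝ) :
    ‖decayingData p ω θ ξ‖ ^ 2 ≤ (1 + decayRate ω ξ ^ 2) * ‖seedNorm p ω θ ξ‖ := by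
  have h := star_decayingData_apply (p := p) (θ := θ) hω ξ
  have hμ := decayRate_pos hω ξ
  have hreal : ∀ y : ℂ, star y = y → ∃ r : ℝ, y = r ∧ ‖y‖ = |r| := by
    intro y hy
    obtain ⟨r, hr⟩ := Complex.conj_eq_iff_real.1 hy
    exact ⟨r, hr, by rw [hr, Complex.norm_real, Real.norm_eq_abs]⟩
  obtain ⟨a₀, ha₀, na₀⟩ := hreal _ (h 0).1
  obtain ⟨a₁, ha₁, na₁⟩ := hreal _ (h 1).1
  obtain ⟨b₀, hb₀, nb₀⟩ := hreal _ (h 0).2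
  obtain ⟨b₁, hb₁, nb₁⟩ := hreal _ (h 1).2
  set μ := decayRate ω ξ with hμd
  have e : seedNorm p ω θ ξ = (((b₀ ^ 2 + b₁ ^ 2) / μ ^ 2 + (a₀ ^ 2 + a₁ ^ 2) : ℝ) : ℂ) := by
    rw [seedNorm, ha₀, ha₁, hb₀, hb₁, complexRate_ofReal hω]
    push_cast
    rfl
  rw [e, Complex.norm_real, Real.norm_of_nonneg (by positivity)]
  have expand : (1 + μ ^ 2) * ((b₀ ^ 2 + b₁ ^ 2) / μ ^ 2 + (a₀ ^ 2 + a₁ ^ 2)) =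
      (b₀ ^ 2 + b₁ ^ 2) / μ ^ 2 + (b₀ ^ 2 + b₁ ^ 2) + (a₀ ^ 2 + a₁ ^ 2) +
        μ ^ 2 * (a₀ ^ 2 + a₁ ^ 2) := by
    field_simp
    ring
  rw [expand]
  have p1 : 0 ≤ (b₀ ^ 2 + b₁ ^ 2) / μ ^ 2 := by positivity
  have p2 : 0 ≤ μ ^ 2 * (a₀ ^ 2 + a₁ ^ 2) := by positivity
  have q0 := sq_nonneg a₀
  have q1 := sq_nonneg a₁
  have q2 := sq_nonneg b₀
  have q3 := sq_nonneg b₁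
  set S := (b₀ ^ 2 + b₁ ^ 2) / μ ^ 2 + (b₀ ^ 2 + b₁ ^ 2) + (a₀ ^ 2 + a₁ ^ 2) +
        μ ^ 2 * (a₀ ^ 2 + a₁ ^ 2) with hS
  have hS0 : 0 ≤ S := by positivity
  have hle : ‖decayingData p ω θ ξ‖ ≤ √S := by
    rw [Prod.norm_def, max_le_iff]
    constructor <;> refine (pi_norm_le_iff_of_nonneg (Real.sqrt_nonneg _)).2 fun i => ?_ <;>
      fin_cases i
    · exact na₀.trans_le (Real.le_sqrt_of_sq_le (by rw [sq_abs]; linarith))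
    · exact na₁.trans_le (Real.le_sqrt_of_sq_le (by rw [sq_abs]; linarith))
    · exact nb₀.trans_le (Real.le_sqrt_of_sq_le (by rw [sq_abs]; linarith))
    · exact nb₁.trans_le (Real.le_sqrt_of_sq_le (by rw [sq_abs]; linarith))
  calc ‖decayingData p ω θ ξ‖ ^ 2 ≤ √S ^ 2 := by gcongr
    _ = S := Real.sq_sqrt hS0

/-- At real energies in a bounded range, the Cauchy data of the decaying solution stay away
from zero. -/
theorem exists_le_norm_decayingData {p ρ₀ ω₁ ω₂ : ℝ} (hp : 4 < p) (hρ0 : 0 ≤ ρ₀) (hρ1 : ρ₀ < 1)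
    (hω₁ : 0 < ω₁) (hω₂ : 0 < ω₂) (M : ℝ) :
    ∃ d, 0 < d ∧ ∀ ω θ ξ : ℝ, ω₁ ≤ ω → ω ≤ ω₂ → |θ| ≤ ρ₀ → decayRate ω ξ ≤ M →
      d ≤ ‖decayingData p ω θ ξ‖ := by
  obtain ⟨K, hK, hb⟩ := exists_uniform_remainder_bound hp hρ0 hρ1 hω₂
  have hs₁ : 0 < √ω₁ := Real.sqrt_pos.2 hω₁
  have hρ' : 0 < 1 - ρ₀ := by linarith
  -- Chosen so that `κX ≥ K/√ω₁`. By `e^{-t} ≤ 1/t`, the remainder at `X` is then at most `1/2`, and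
  -- `f₃` is visibly nonzero there.
  set X := K / (5 * ω₁) with hX
  have hX0 : 0 ≤ X := by positivity
  set L := 1 + M ^ 2 + 4 * ω₂ + 2 * (p + 2) * ω₂ / (1 - ρ₀) ^ 2 * (2 * p + 2) with hL
  refine ⟨Real.exp (-(M * X)) / 2 / Real.exp (L * X), by positivity, ?_⟩
  intro ω θ ξ h₁ h₂ hθ hM
  have hω : 0 < ω := hω₁.trans_le h₁
  have hμ := decayRate_pos hω ξ
  have hθ1 : |θ| < 1 := hθ.trans_lt hρ1
  have hz : ‖(ξ : ℂ) - ξ‖ ≤ decayRate ω ξ / 16 := by simp; positivity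
  set e := frobeniusData p ω θ (-complexRate ω ξ) ξ ![0, 1] with he
  have hsol : ∀ x, 0 ≤ x → SolvesAt p ω θ ((ξ : ℂ) ^ 2) e x := fun x hx =>
    hasDerivAt_frobeniusData hp hω hθ1 hμ (isFrobeniusExponent_decaying hp hω hz) hx
  have hξ : ‖(ξ : ℂ) ^ 2‖ ≤ M ^ 2 := by
    rw [norm_pow, Complex.norm_real, Real.norm_eq_abs]
    have := (abs_le_decayRate hω ξ).trans hM
    gcongr
  -- Grönwall from `0` to `X`, read as a lower bound for the data at `0`; `L` bounds the system
  -- uniformly when `|ξ| ≤ M`.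
  have hgron := norm_le_gronwallBound_of_norm_deriv_right_le (f := e) (δ := ‖e 0‖) (K := L) (ε := 0)
    (a := 0) (b := X) (fun x hx => (hsol x hx.1).continuousAt.continuousWithinAt)
    (fun x hx => (hsol x hx.1).hasDerivWithinAt) le_rfl
    (fun x hx => by
      rw [add_zero]
      refine (norm_systemOp_apply_le hp hω hθ hρ1 x _ _).trans ?_
      rw [hL]
      have : 0 ≤ 2 * (p + 2) := by linarith
      gcongr) X ⟨hX0, le_rfl⟩
  rw [gronwallBound_ε0, sub_zero] at hgron
  have hrem := ((hb ω θ ξ hω h₂ hθ ξ 0 zero_le_one X hX0).2 hz).1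
  have hsmall : K / decayRate ω ξ * Real.exp (-(potentialRate p ω * X)) ≤ 1 / 2 := by
    have k1 : K / decayRate ω ξ ≤ K / (2 * √ω₁) := by
      have := Real.sqrt_le_sqrt h₁
      have := decayRate_lower hω ξ
      gcongr
      linarith
    have k2 : K / √ω₁ ≤ potentialRate p ω * X := by
      have h5 := potentialRate_lower hp hω
      have h6 := Real.sqrt_le_sqrt h₁
      calc K / √ω₁ = 5 * √ω₁ * X := by
            rw [hX]
            field_simp
            rw [Real.sq_sqrt hω₁.le]
        _ ≤ _ := by gcongr; linarith
    have k3 : Real.exp (-(potentialRate p ω * X)) ≤ √ω₁ / K := by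
      calc Real.exp (-(potentialRate p ω * X)) ≤ Real.exp (-(K / √ω₁)) :=
            Real.exp_le_exp.2 (by linarith)
        _ = (Real.exp (K / √ω₁))⁻¹ := Real.exp_neg _
        _ ≤ (K / √ω₁)⁻¹ := inv_anti₀ (by positivity) (by linarith [Real.add_one_le_exp (K / √ω₁)])
        _ = _ := inv_div _ _
    calc K / decayRate ω ξ * Real.exp (-(potentialRate p ω * X))
        ≤ K / (2 * √ω₁) * (√ω₁ / K) := mul_le_mul k1 k3 (Real.exp_pos _).le (by positivity)
      _ = 1 / 2 := by field_simp
  have hlow : Real.exp (-(M * X)) / 2 ≤ ‖e X‖ := by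
    have e1 : (e X).1 1 = Complex.exp (-complexRate ω ξ * X) *
        (1 + remainder p ω θ (-complexRate ω ξ) ξ ![0, 1] 0 X 1) := by
      simp [he, frobeniusData, remainder]
    have e2 : ‖(e X).1 1‖ ≤ ‖e X‖ := (norm_le_pi_norm _ 1).trans (norm_fst_le _)
    refine le_trans ?_ e2
    rw [e1, norm_mul, Complex.norm_exp, complexRate_ofReal hω]
    have e3 : 1 / 2 ≤ ‖1 + remainder p ω θ (-(decayRate ω ξ : ℂ)) ξ ![0, 1] 0 X 1‖ := by
      rw [complexRate_ofReal hω] at hrem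
      have t1 := (norm_le_pi_norm (remainder p ω θ (-(decayRate ω ξ : ℂ)) ξ ![0, 1] 0 X) 1).trans
        (hrem.trans hsmall)
      have t2 := norm_sub_norm_le (1 : ℂ) (-remainder p ω θ (-(decayRate ω ξ : ℂ)) ξ ![0, 1] 0 X 1)
      rw [norm_neg, norm_one, sub_neg_eq_add] at t2
      linarith
    have e4 : Real.exp (-(M * X)) ≤ Real.exp ((-(decayRate ω ξ : ℂ) * X).re) := by
      apply Real.exp_le_exp.2
      simp
      nlinarith
    calc Real.exp (-(M * X)) / 2 = Real.exp (-(M * X)) * (1 / 2) := by ring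
      _ ≤ _ := mul_le_mul e4 e3 (by norm_num) (Real.exp_pos _).le
  rw [div_le_iff₀ (Real.exp_pos _)]
  exact hlow.trans hgron

/-- The normalizing factor is bounded below on complex discs of radius proportional to `μ`. -/
theorem exists_le_norm_seedNorm {p ρ₀ ω₁ ω₂ : ℝ} (hp : 4 < p) (hρ0 : 0 ≤ ρ₀) (hρ1 : ρ₀ < 1)
    (hω₁ : 0 < ω₁) (hω₂ : 0 < ω₂) :
    ∃ c d, 0 < c ∧ c ≤ 1 / 32 ∧ 0 < d ∧ ∀ ω θ ξ : ℝ, ω₁ ≤ ω → ω ≤ ω₂ → |θ| ≤ ρ₀ → ∀ z : ℂ,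
      ‖z - ξ‖ ≤ c * decayRate ω ξ → d ≤ ‖seedNorm p ω θ z‖ := by
  obtain ⟨K, hK, hb⟩ := exists_norm_seedNorm_sub_le hp hρ0 hρ1 hω₁ hω₂
  obtain ⟨d₀, hd₀, hlow⟩ := exists_le_norm_decayingData hp hρ0 hρ1 hω₁ hω₂ (20 * K)
  have hs₁ : 0 < √ω₁ := Real.sqrt_pos.2 hω₁
  set T := K / (2 * √ω₁) with hT
  have hT0 : 0 < T := by positivity
  set B := 2 + (6 * T + 10 * T ^ 2) with hB
  have hB0 : 0 < B := by positivity
  set d₁ := d₀ ^ 2 / (1 + (20 * K) ^ 2) with hd₁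
  have hd₁0 : 0 < d₁ := by positivity
  -- The Schwarz lemma on the disc of radius `μ/16` with oscillation `3B` has slope `48B/μ`; times
  -- `d₁ μ / (96B)` this is `d₁/2`, half of the lower bound on the real axis.
  refine ⟨min (1 / 32) (d₁ / (96 * B)), min 1 (d₁ / 2), by positivity, min_le_left _ _,
    by positivity, ?_⟩
  intro ω θ ξ h₁ h₂ hθ z hz
  have hω : 0 < ω := hω₁.trans_le h₁
  have hμ := decayRate_pos hω ξ
  have hz' : ‖z - ξ‖ < decayRate ω ξ / 16 := by
    have : min (1 / 32) (d₁ / (96 * B)) * decayRate ω ξ ≤ 1 / 32 * decayRate ω ξ :=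
      mul_le_mul_of_nonneg_right (min_le_left _ _) hμ.le
    linarith
  -- Above this threshold the deviation from `2` is at most `6/20 + 10/400 < 1`. Below it the energy
  -- is bounded and the lower bound on the data applies.
  rcases le_or_gt (20 * K) (decayRate ω ξ) with hbig | hsmall
  · refine (min_le_left _ _).trans ?_
    have h := hb ω θ ξ h₁ h₂ hθ z hz'.le
    have ht : K / decayRate ω ξ ≤ 1 / 20 := by
      rw [div_le_iff₀ hμ]; linarith
    have ht0 : 0 ≤ K / decayRate ω ξ := by positivity
    have t2 := norm_sub_norm_le (2 : ℂ) (2 - seedNorm p ω θ z)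
    rw [sub_sub_cancel, norm_sub_rev (2 : ℂ), Complex.norm_ofNat] at t2
    nlinarith
  · refine (min_le_right _ _).trans ?_
    have hBall : ∀ y ∈ Metric.ball (ξ : ℂ) (decayRate ω ξ / 16), ‖seedNorm p ω θ y‖ ≤ B := by
      intro y hy
      have h := hb ω θ ξ h₁ h₂ hθ y (mem_ball_iff_norm.1 hy).le
      have ht : K / decayRate ω ξ ≤ T := by
        have := Real.sqrt_le_sqrt h₁
        have := decayRate_lower hω ξ
        rw [hT]
        gcongr
        linarith
      have h2 : ‖seedNorm p ω θ y‖ ≤ ‖seedNorm p ω θ y - 2‖ + ‖(2 : ℂ)‖ := by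
        simpa using norm_add_le (seedNorm p ω θ y - 2) 2
      rw [Complex.norm_ofNat] at h2
      have h3 : 6 * (K / decayRate ω ξ) + 10 * (K / decayRate ω ξ) ^ 2 ≤ 6 * T + 10 * T ^ 2 := by
        gcongr
      rw [hB]
      linarith
    have hc : (ξ : ℂ) ∈ Metric.ball (ξ : ℂ) (decayRate ω ξ / 16) :=
      Metric.mem_ball_self (by positivity)
    have hmaps : MapsTo (seedNorm p ω θ) (Metric.ball (ξ : ℂ) (decayRate ω ξ / 16))
        (Metric.closedBall (seedNorm p ω θ ξ) (3 * B)) := by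
      intro y hy
      rw [mem_closedBall_iff_norm]
      have := norm_sub_le (seedNorm p ω θ y) (seedNorm p ω θ ξ)
      linarith [hBall y hy, hBall _ hc]
    have hS := Complex.dist_le_div_mul_dist_of_mapsTo_ball
      (differentiableOn_seedNorm hp hω (hθ.trans_lt hρ1)) hmaps (mem_ball_iff_norm.2 hz')
    rw [dist_eq_norm, dist_eq_norm] at hS
    have hS' : ‖seedNorm p ω θ z - seedNorm p ω θ ξ‖ ≤ d₁ / 2 := by
      refine hS.trans ?_
      have : ‖z - ξ‖ ≤ d₁ / (96 * B) * decayRate ω ξ :=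
        hz.trans (mul_le_mul_of_nonneg_right (min_le_right _ _) hμ.le)
      calc 3 * B / (decayRate ω ξ / 16) * ‖z - ξ‖
          ≤ 3 * B / (decayRate ω ξ / 16) * (d₁ / (96 * B) * decayRate ω ξ) := by gcongr
        _ = d₁ / 2 := by field_simp; norm_num
    have hreal : d₁ ≤ ‖seedNorm p ω θ ξ‖ := by
      rw [hd₁, div_le_iff₀ (by positivity)]
      have h1 := hlow ω θ ξ h₁ h₂ hθ hsmall.le
      calc d₀ ^ 2 ≤ ‖decayingData p ω θ ξ‖ ^ 2 := by gcongr
        _ ≤ (1 + decayRate ω ξ ^ 2) * ‖seedNorm p ω θ ξ‖ := norm_sq_decayingData_le hω ξ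
        _ ≤ (1 + (20 * K) ^ 2) * ‖seedNorm p ω θ ξ‖ := by gcongr
        _ = _ := mul_comm _ _
    have t2 := norm_sub_norm_le (seedNorm p ω θ ξ) (seedNorm p ω θ ξ - seedNorm p ω θ z)
    rw [sub_sub_cancel, norm_sub_rev] at t2
    linarith

/-! ### The growing solution -/

/-- Size of the initial values of the damped system satisfied by the growing solution. -/
theorem exists_growingData_bound {p ρ₀ ω₁ ω₂ d : ℝ} (hp : 4 < p) (hρ0 : 0 ≤ ρ₀) (hρ1 : ρ₀ < 1)
    (hω₁ : 0 < ω₁) (hω₂ : 0 < ω₂) (hd : 0 < d) :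
    ∃ K, 0 < K ∧ ∀ ω θ ξ : ℝ, ω₁ ≤ ω → ω ≤ ω₂ → |θ| ≤ ρ₀ → ∀ z : ℂ,
      ‖z - ξ‖ ≤ decayRate ω ξ / 16 → d ≤ ‖seedNorm p ω θ z‖ →
      ‖(growingData p ω θ z).1 0‖ ≤ K / decayRate ω ξ ^ 2 ∧
      ‖(growingData p ω θ z).1 1‖ ≤ K ∧
      ‖(growingData p ω θ z).2 0 - Complex.I * z * (growingData p ω θ z).1 0‖ ≤
        K / decayRate ω ξ ∧
      ‖(growingData p ω θ z).2 1 - complexRate ω z * (growingData p ω θ z).1 1‖ ≤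
        K / decayRate ω ξ := by
  obtain ⟨K, hK, hb⟩ := exists_uniform_remainder_bound hp hρ0 hρ1 hω₂
  have hs₁ : 0 < √ω₁ := Real.sqrt_pos.2 hω₁
  set τ := 1 / √ω₁ with hτ
  have hτ0 : 0 < τ := by positivity
  set K₁ := 3 / d * (K * (2 + τ)) with hK₁
  set K₂ := 3 / d * (2 * (1 + K * τ) + K * τ ^ 2) with hK₂
  set K₃ := 2 / d * 2 * K + 2 * K₁ with hK₃
  set K₄ := 2 / d * K with hK₄
  have p1 : 0 < K₁ := by positivity
  have p2 : 0 < K₂ := by positivity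
  have p3 : 0 < K₃ := by positivity
  have p4 : 0 < K₄ := by positivity
  refine ⟨K₁ + K₂ + K₃ + K₄, by positivity, fun ω θ ξ h₁ h₂ hθ z hz hD => ?_⟩
  have hω : 0 < ω := hω₁.trans_le h₁
  have hμ := decayRate_pos hω ξ
  have hm0 := complexRate_ne_zero hω hz
  have hml := le_norm_complexRate hω hz
  have hmu := (complexRate_bounds hω hz).2.1
  have hzμ : ‖z‖ ≤ 2 * decayRate ω ξ := by
    have h1 : ‖z‖ ≤ ‖z - ξ‖ + ‖(ξ : ℂ)‖ := by simpa using norm_add_le (z - ξ) ξ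
    rw [Complex.norm_real, Real.norm_eq_abs] at h1
    linarith [abs_le_decayRate hω ξ]
  have hμτ : 1 ≤ τ * decayRate ω ξ := by
    have h3 := Real.sqrt_le_sqrt h₁
    have h4 := decayRate_lower hω ξ
    rw [hτ, one_div, ← div_eq_inv_mul, one_le_div hs₁]
    linarith
  have hr := fun k (hk : k ≤ 1) => ((hb ω θ ξ hω h₂ hθ z k hk 0 le_rfl).2 hz)
  simp only [mul_zero, neg_zero, Real.exp_zero, mul_one] at hr
  have hD0 : seedNorm p ω θ z ≠ 0 := norm_pos_iff.1 (hd.trans_le hD)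
  have e1 : (decayingData p ω θ z).1 = ![0, 1] + remainder p ω θ (-complexRate ω z) z ![0, 1] 0 0 :=
    congrArg Prod.fst (decayingData_eq p ω θ z)
  have e2 : (decayingData p ω θ z).2 = -complexRate ω z •
      (![0, 1] + remainder p ω θ (-complexRate ω z) z ![0, 1] 0 0) +
          remainder p ω θ (-complexRate ω z) z ![0, 1] 1 0 :=
    congrArg Prod.snd (decayingData_eq p ω θ z)
  simp only [growingData, e1, e2]
  set μ := decayRate ω ξ with hμd
  set m := complexRate ω z with hm
  set D := seedNorm p ω θ z
  set u := remainder p ω θ (-m) z ![0, 1] 0 0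
  set v := remainder p ω θ (-m) z ![0, 1] 1 0
  obtain ⟨hu, hu0⟩ := hr 0 zero_le_one
  obtain ⟨hv, hv0⟩ := hr 1 le_rfl
  have hu1 := (norm_le_pi_norm u 1).trans hu
  have hv1 := (norm_le_pi_norm v 1).trans hv
  have hsn : ‖-2 / (m * D)‖ ≤ 3 / d / μ := by
    rw [norm_div, norm_neg, Complex.norm_ofNat, norm_mul]
    calc 2 / (‖m‖ * ‖D‖) ≤ 2 / (9 / 10 * μ * d) := by gcongr
      _ = 20 / 9 / d / μ := by field_simp; norm_num
      _ ≤ 3 / d / μ := by gcongr; norm_num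
  have hDn : ‖2 / D‖ ≤ 2 / d := by
    rw [norm_div, Complex.norm_ofNat]
    gcongr
  simp only [Pi.add_apply, Pi.smul_apply, smul_eq_mul, Matrix.cons_val_zero, Matrix.cons_val_one,
      zero_add]
  have hμi : 1 / μ ≤ τ := by rw [div_le_iff₀ hμ]; exact hμτ
  have A1 : ‖-2 / (m * D) * (-m * u 0 + v 0)‖ ≤ K₁ / μ ^ 2 := by
    have t : ‖-m * u 0 + v 0‖ ≤ K * (2 + τ) / μ := by
      refine (norm_add_le _ _).trans ?_
      rw [norm_mul, norm_neg]
      calc ‖m‖ * ‖u 0‖ + ‖v 0‖ ≤ 2 * μ * (K / μ ^ 2) + K / μ ^ 2 := by gcongr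
        _ = K * (2 + 1 / μ) / μ := by field_simp
        _ ≤ _ := by gcongr
    rw [norm_mul]
    calc _ ≤ 3 / d / μ * (K * (2 + τ) / μ) := by gcongr
      _ = _ := by rw [hK₁]; field_simp
  have A2 : ‖-2 / (m * D) * (-m * (1 + u 1) + v 1)‖ ≤ K₂ := by
    have t : ‖-m * (1 + u 1) + v 1‖ ≤ (2 * (1 + K * τ) + K * τ ^ 2) * μ := by
      refine (norm_add_le _ _).trans ?_
      rw [norm_mul, norm_neg]
      have t1 : ‖1 + u 1‖ ≤ 1 + K / μ := (norm_add_le _ _).trans (by rw [norm_one]; gcongr)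
      calc ‖m‖ * ‖1 + u 1‖ + ‖v 1‖ ≤ 2 * μ * (1 + K / μ) + K / μ := by gcongr
        _ = (2 * (1 + K * (1 / μ)) + K * (1 / μ) ^ 2) * μ := by field_simp
        _ ≤ _ := by gcongr
    rw [norm_mul]
    calc _ ≤ 3 / d / μ * ((2 * (1 + K * τ) + K * τ ^ 2) * μ) := by gcongr
      _ = _ := by rw [hK₂]; field_simp
  have A3 : ‖2 / D * m * u 0 - Complex.I * z * (-2 / (m * D) * (-m * u 0 + v 0))‖ ≤ K₃ / μ := by
    refine (norm_sub_le _ _).trans ?_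
    rw [norm_mul, norm_mul (2 / D), norm_mul (Complex.I * z), norm_mul Complex.I, Complex.norm_I,
      one_mul]
    calc _ ≤ 2 / d * (2 * μ) * (K / μ ^ 2) + 2 * μ * (K₁ / μ ^ 2) := by gcongr
      _ = _ := by rw [hK₃]; field_simp
  -- The leading parts of `f'(0)` and `m f(0)` cancel by the choice of data, leaving only the
  -- derivative of the remainder of `f₃`.
  have A4 : ‖2 / D * m * (1 + u 1) - m * (-2 / (m * D) * (-m * (1 + u 1) + v 1))‖ ≤ K₄ / μ := by
    have e : 2 / D * m * (1 + u 1) - m * (-2 / (m * D) * (-m * (1 + u 1) + v 1)) =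
        2 / D * v 1 := by
      field_simp
      ring
    rw [e, norm_mul]
    calc _ ≤ 2 / d * (K / μ) := by gcongr
      _ = _ := by rw [hK₄]; field_simp
  refine ⟨A1.trans ?_, A2.trans (by linarith), A3.trans ?_, A4.trans ?_⟩ <;>
    exact div_le_div_of_nonneg_right (by linarith) (by positivity)

/-- The damped system satisfied by `e^{-mx}` times a solution. -/
theorem isDampedSystem_propagator {p ω θ ρ₀ ξ : ℝ} (hp : 4 < p) (hω : 0 < ω) (hθ : |θ| ≤ ρ₀)
    (hρ1 : ρ₀ < 1) {z : ℂ} (hz : ‖z - ξ‖ ≤ decayRate ω ξ / 16) (e : CauchyData) :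
    IsDampedSystem
      (fun x => Complex.exp (-complexRate ω z * x) * (propagator p ω θ x (z ^ 2) e).1 0)
      (fun x => Complex.exp (-complexRate ω z * x) * (propagator p ω θ x (z ^ 2) e).1 1)
      (fun x => Complex.exp (-complexRate ω z * x) * ((propagator p ω θ x (z ^ 2) e).2 0 -
        Complex.I * z * (propagator p ω θ x (z ^ 2) e).1 0))
      (fun x => Complex.exp (-complexRate ω z * x) * ((propagator p ω θ x (z ^ 2) e).2 1 -
        complexRate ω z * (propagator p ω θ x (z ^ 2) e).1 1))
      (potential p ω θ) (complexRate ω z - Complex.I * z) (complexRate ω z + Complex.I * z)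
      (2 * complexRate ω z) p (4 / 5 * decayRate ω ξ) (potentialRate p ω)
      (2 * (p + 2) * ω / (1 - ρ₀) ^ 2) := by
  have hθ1 : |θ| < 1 := hθ.trans_lt hρ1
  have hm := complexRate_sq ω z
  set m := complexRate ω z with hmd
  have hE := fun x => hasDerivAt_cexp_mul (-m) x
  have h1 := fun x i => hasDerivAt_pi.1
    (hasDerivAt_propagator_fst (w := z ^ 2) (e := e) x hp hω hθ1) i
  have h2 := fun x i => hasDerivAt_pi.1
    (hasDerivAt_propagator_snd (w := z ^ 2) (e := e) x hp hω hθ1) i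
  constructor
  · exact (complexRate_re_add hω hz).2
  · exact (complexRate_re_add hω hz).1
  · have := (complexRate_bounds hω hz).1
    have h3 := decayRate_pos hω ξ
    rw [← hmd] at this
    simp
    linarith
  · intro x _
    refine ((hE x).mul (h1 x 0)).congr_deriv ?_
    ring
  · intro x _
    refine ((hE x).mul ((h2 x 0).sub ((h1 x 0).const_mul (Complex.I * z)))).congr_deriv ?_
    simp [symbol, coupling_apply_zero]
    linear_combination (-z ^ 2 * Complex.exp (-(m * x)) * (propagator p ω θ x (z ^ 2) e).1 0) *
      Complex.I_sq
  · intro x _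
    refine ((hE x).mul ((h2 x 1).sub ((h1 x 1).const_mul m))).congr_deriv ?_
    simp [symbol, coupling_apply_one]
    linear_combination (-Complex.exp (-(m * x)) * (propagator p ω θ x (z ^ 2) e).1 1) * hm
  · intro x _
    refine ((hE x).mul (h1 x 1)).congr_deriv ?_
    ring
  · intro x hx
    have := abs_potential_le hp hω hθ hρ1 x
    rwa [abs_of_nonneg hx] at this

/-- The Wronskian with the decaying solution fixes the limit of the growing solution. -/
theorem tendsto_growing {p ω θ ξ : ℝ} (hp : 4 < p) (hω : 0 < ω) (hθ : |θ| < 1) {z : ℂ}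
    (hz : ‖z - ξ‖ ≤ decayRate ω ξ / 16) (hD : seedNorm p ω θ z ≠ 0) {a b c β : ℝ → ℂ}
    (ha : a = fun x : ℝ => Complex.exp (-complexRate ω z * x) *
      (propagator p ω θ x (z ^ 2) (growingData p ω θ z)).1 0)
    (hb : b = fun x : ℝ => Complex.exp (-complexRate ω z * x) *
      (propagator p ω θ x (z ^ 2) (growingData p ω θ z)).1 1)
    (hc : c = fun x : ℝ => Complex.exp (-complexRate ω z * x) *
      ((propagator p ω θ x (z ^ 2) (growingData p ω θ z)).2 0 -
        Complex.I * z * (propagator p ω θ x (z ^ 2) (growingData p ω θ z)).1 0))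
    (hβ : β = fun x : ℝ => Complex.exp (-complexRate ω z * x) *
      ((propagator p ω θ x (z ^ 2) (growingData p ω θ z)).2 1 -
        complexRate ω z * (propagator p ω θ x (z ^ 2) (growingData p ω θ z)).1 1))
    (ta : Tendsto a atTop (𝓝 0)) (tc : Tendsto c atTop (𝓝 0)) (tβ : Tendsto β atTop (𝓝 0)) :
    Tendsto b atTop (𝓝 1) := by
  have hm0 := complexRate_ne_zero hω hz
  have hμ := decayRate_pos hω ξ
  have hf := isFrobeniusExponent_decaying hp hω hz
  have t0 := tendsto_apply_remainder hp hω hθ hμ hf 0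
  have t1 := tendsto_apply_remainder hp hω hθ hμ hf 1
  have hW : ∀ x, 0 ≤ x → dataWronskian (frobeniusData p ω θ (-complexRate ω z) z ![0, 1] x)
      (propagator p ω θ x (z ^ 2) (growingData p ω θ z)) = -2 * complexRate ω z := by
    intro x hx
    have := dataWronskian_const (e' := fun x => propagator p ω θ x (z ^ 2) (growingData p ω θ z))
      (fun x hx => hasDerivAt_frobeniusData hp hω hθ hμ hf hx)
      (fun x _ => solvesAt_propagator hp hω hθ (z ^ 2) (growingData p ω θ z) x) hx
    rw [this, propagator_zero]
    exact dataWronskian_growingData hm0 hD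
  set m := complexRate ω z with hm
  set g := expSeries (potentialRate p ω) (solutionCoeff p ω θ (-m) z ![0, 1]) 0 with hg
  set g' := expSeries (potentialRate p ω) (solutionCoeff p ω θ (-m) z ![0, 1]) 1 with hg'
  -- The Wronskian identity arranged as an equation for `b`. The factors `e^{-mx}` of the decaying
  -- solution are exactly those that define `a`, `b`, `c`, `β`.
  have hid : ∀ x, 0 ≤ x → b x * (-2 * m * g x 1 + g' x 1) =
      -2 * m - (-m * g x 0 + g' x 0) * a x + g x 0 * (c x + Complex.I * z * a x) + g x 1 * β x := by
    intro x hx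
    have h := hW x hx
    rw [dataWronskian_eq] at h
    simp only [frobeniusData, Pi.smul_apply, Pi.add_apply, smul_eq_mul, ← hg, ← hg'] at h
    rw [ha, hb, hc, hβ]
    simp only
    linear_combination h
  have hden : Tendsto (fun x => -2 * m * g x 1 + g' x 1) atTop (𝓝 (-2 * m)) := by
    have := (t1.1.const_mul (-2 * m)).add t1.2
    simpa using this
  have hnum : Tendsto (fun x => -2 * m - (-m * g x 0 + g' x 0) * a x +
      g x 0 * (c x + Complex.I * z * a x) + g x 1 * β x) atTop (𝓝 (-2 * m)) := by
    have := (((((t0.1.const_mul (-m)).add t0.2).mul ta).const_sub (-2 * m)).add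
      (t0.1.mul (tc.add (ta.const_mul (Complex.I * z))))).add (t1.1.mul tβ)
    simpa using this
  have h2m : -2 * m ≠ 0 := mul_ne_zero (by norm_num) hm0
  have hq := hnum.div hden h2m
  rw [div_self h2m] at hq
  refine hq.congr' ?_
  filter_upwards [eventually_ge_atTop 0, hden.eventually_ne h2m] with x hx hne
  rw [Pi.div_apply, ← hid x hx, mul_div_cancel_right₀ _ hne]

/-- The remainder `∂ₓᵏ (e^{-mx} f - (0, 1))` of the growing solution `f`. -/
def growingRemainder (p ω θ : ℝ) (k : ℕ) (x : ℝ) (z : ℂ) : Fin 2 → ℂ :=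
  if k = 0 then
    Complex.exp (-complexRate ω z * x) • (propagator p ω θ x (z ^ 2) (growingData p ω θ z)).1 -
      ![0, 1]
  else
    Complex.exp (-complexRate ω z * x) • ((propagator p ω θ x (z ^ 2) (growingData p ω θ z)).2 -
      complexRate ω z • (propagator p ω θ x (z ^ 2) (growingData p ω θ z)).1)

theorem tendsto_zero_of_exp_bound {f : ℝ → ℂ} {K γ : ℝ} (hγ : 0 < γ)
    (h : ∀ x, 0 ≤ x → ‖f x‖ ≤ K * Real.exp (-γ * x)) : Tendsto f atTop (𝓝 0) := by
  have h1 : Tendsto (fun x : ℝ => K * Real.exp (-γ * x)) atTop (𝓝 0) := by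
    have : Tendsto (fun x : ℝ => Real.exp (-(γ * x))) atTop (𝓝 0) :=
      Real.tendsto_exp_neg_atTop_nhds_zero.comp (tendsto_id.const_mul_atTop hγ)
    simpa using this.const_mul K
  refine squeeze_zero_norm' ?_ h1
  filter_upwards [eventually_ge_atTop 0] with x hx
  exact h x hx

/-- The damped system is used with rate `√ω/4`, admissible because `μ ≥ 2√ω` makes it at most `μ/8`.
The Wronskian supplies the limit `1` of the second component, so a bound on increments becomes a
bound on the remainder. -/
theorem exists_growingRemainder_bound {p ρ₀ ω₁ ω₂ : ℝ} (hp : 4 < p) (hρ0 : 0 ≤ ρ₀) (hρ1 : ρ₀ < 1)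
    (hω₁ : 0 < ω₁) (hω₂ : 0 < ω₂) :
    ∃ c K, 0 < c ∧ c ≤ 1 / 32 ∧ 0 < K ∧ ∀ ω θ ξ : ℝ, ω₁ ≤ ω → ω ≤ ω₂ → |θ| ≤ ρ₀ → ∀ z : ℂ,
      ‖z - ξ‖ ≤ c * decayRate ω ξ → seedNorm p ω θ z ≠ 0 ∧ ∀ k ≤ 1, ∀ x, 0 ≤ x →
        ‖growingRemainder p ω θ k x z‖ ≤ K / decayRate ω ξ * Real.exp (-(√ω / 4) * x) := by
  obtain ⟨c₀, d, hc0, hc32, hd, hseed⟩ := exists_le_norm_seedNorm hp hρ0 hρ1 hω₁ hω₂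
  obtain ⟨K, hK, hdata⟩ := exists_growingData_bound hp hρ0 hρ1 hω₁ hω₂ hd
  have hs₁ : 0 < √ω₁ := Real.sqrt_pos.2 hω₁
  have hρ' : 0 < 1 - ρ₀ := by linarith
  obtain ⟨K', hK', hdamp⟩ := exists_damped_bound (p := p) (μ₀ := 2 * √ω₁) (κ₀ := 5 * √ω₁)
    (A₀ := 2 * (p + 2) * ω₂ / (1 - ρ₀) ^ 2) (K := K) (by linarith) (by positivity) (by positivity)
    (by positivity) hK.le
  refine ⟨c₀, 5 * K' + K' / √ω₁, hc0, hc32, by positivity, fun ω θ ξ h₁ h₂ hθ z hz => ?_⟩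
  have hω : 0 < ω := hω₁.trans_le h₁
  have hμ := decayRate_pos hω ξ
  have hsω : 0 < √ω := Real.sqrt_pos.2 hω
  have hss := Real.sqrt_le_sqrt h₁
  have hz16 : ‖z - ξ‖ ≤ decayRate ω ξ / 16 := by nlinarith
  have hDl := hseed ω θ ξ h₁ h₂ hθ z hz
  have hD0 : seedNorm p ω θ z ≠ 0 := norm_pos_iff.1 (hd.trans_le hDl)
  refine ⟨hD0, ?_⟩
  obtain ⟨i1, i2, i3, i4⟩ := hdata ω θ ξ h₁ h₂ hθ z hz16 hDl
  have hsys := isDampedSystem_propagator hp hω hθ hρ1 hz16 (growingData p ω θ z)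
  have hlow := decayRate_lower hω ξ
  have hκl := potentialRate_lower hp hω
  have hmu := (complexRate_bounds hω hz16).2.1
  have hzμ : ‖z‖ ≤ 2 * decayRate ω ξ := by
    have h1 : ‖z‖ ≤ ‖z - ξ‖ + ‖(ξ : ℂ)‖ := by simpa using norm_add_le (z - ξ) ξ
    rw [Complex.norm_real, Real.norm_eq_abs] at h1
    linarith [abs_le_decayRate hω ξ]
  have hb := hdamp _ _ _ _ _ _ _ _ (decayRate ω ξ) _ _ (√ω / 4) (by linarith) (by linarith)
    (by positivity) (by gcongr) (by positivity) (by linarith) (by linarith) hsys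
    (by simpa [propagator_zero] using i1) (by simpa [propagator_zero] using i3)
    (by simpa [propagator_zero] using i4) (by simpa [propagator_zero] using i2)
  have hlim := tendsto_growing hp hω (hθ.trans_lt hρ1) hz16 hD0 rfl rfl rfl rfl
    (tendsto_zero_of_exp_bound (by positivity) fun x hx => (hb x hx).1)
    (tendsto_zero_of_exp_bound (by positivity) fun x hx => (hb x hx).2.1)
    (tendsto_zero_of_exp_bound (by positivity) fun x hx => (hb x hx).2.2.1)
  intro k hk x hx
  obtain ⟨b1, b2, b3, b4⟩ := hb x hx
  -- Sends the far endpoint of the increment of `b` to infinity, where `b` tends to `1`.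
  have b5 := le_of_tendsto ((hlim.sub_const _).norm)
    ((eventually_ge_atTop x).mono fun y hy => b4 y hy)
  set E := Complex.exp (-complexRate ω z * x)
  set P := propagator p ω θ x (z ^ 2) (growingData p ω θ z)
  set m := complexRate ω z
  set μ := decayRate ω ξ
  set X := Real.exp (-(√ω / 4) * x)
  have hX : 0 < X := Real.exp_pos _
  have hKs : 0 < K' / √ω₁ := by positivity
  have hK1 : K' / μ * X ≤ (5 * K' + K' / √ω₁) / μ * X :=
    mul_le_mul_of_nonneg_right (div_le_div_of_nonneg_right (by linarith) hμ.le) hX.le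
  have hK5 : 5 * K' / μ * X ≤ (5 * K' + K' / √ω₁) / μ * X :=
    mul_le_mul_of_nonneg_right (div_le_div_of_nonneg_right (by linarith) hμ.le) hX.le
  have hn : 0 ≤ (5 * K' + K' / √ω₁) / μ * X := by positivity
  refine (pi_norm_le_iff_of_nonneg hn).2 fun i => ?_
  rcases Nat.le_one_iff_eq_zero_or_eq_one.1 hk with rfl | rfl
  · fin_cases i
    · have h32 : ‖E * P.1 0‖ ≤ (5 * K' + K' / √ω₁) / μ * X := by
        refine b1.trans (mul_le_mul_of_nonneg_right ?_ hX.le)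
        calc K' / μ ^ 2 = K' / μ / μ := by field_simp
          _ ≤ K' / √ω₁ / μ := by
            gcongr
            linarith
          _ ≤ _ := div_le_div_of_nonneg_right (by linarith) hμ.le
      simpa [growingRemainder, E, P, m] using h32
    · have : ‖E * P.1 1 - 1‖ ≤ (5 * K' + K' / √ω₁) / μ * X := by
        rw [norm_sub_rev]
        exact b5.trans hK1
      simpa [growingRemainder, E, P, m] using this
  · fin_cases i
    · have : ‖E * (P.2 0 - m * P.1 0)‖ ≤ (5 * K' + K' / √ω₁) / μ * X := by
        -- The damped variable was `f' - iz f`, whereas the derivative of the remainder is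
        -- `e^{-mx}(f' - m f)`. The difference costs a factor of order `μ`, which the bound `μ⁻²` on
        -- `a` can afford.
        have e : E * (P.2 0 - m * P.1 0) = E * (P.2 0 - Complex.I * z * P.1 0) +
          (Complex.I * z - m) * (E * P.1 0) := by ring
        have h4 : ‖Complex.I * z - m‖ ≤ 4 * μ := by
          refine (norm_sub_le _ _).trans ?_
          rw [norm_mul, Complex.norm_I, one_mul]
          linarith
        rw [e]
        refine (norm_add_le _ _).trans ?_
        rw [norm_mul (Complex.I * z - m)]
        calc _ ≤ K' / μ * X + 4 * μ * (K' / μ ^ 2 * X) := by gcongr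
          _ = 5 * K' / μ * X := by field_simp; norm_num
          _ ≤ _ := hK5
      simpa [growingRemainder, E, P, m] using this
    · have : ‖E * (P.2 1 - m * P.1 1)‖ ≤ (5 * K' + K' / √ω₁) / μ * X := b3.trans hK1
      simpa [growingRemainder, E, P, m] using this

theorem differentiableOn_growingData {p ω θ ξ r : ℝ} (hp : 4 < p) (hω : 0 < ω) (hθ : |θ| < 1)
    (hr : r ≤ decayRate ω ξ / 16) (hD : ∀ z ∈ Metric.ball (ξ : ℂ) r, seedNorm p ω θ z ≠ 0) :
    DifferentiableOn ℂ (growingData p ω θ) (Metric.ball (ξ : ℂ) r) := by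
  have hsub := Metric.ball_subset_ball (x := (ξ : ℂ)) hr
  have hball : ∀ z ∈ Metric.ball (ξ : ℂ) r, ‖z - ξ‖ ≤ decayRate ω ξ / 16 :=
    fun z hz => (mem_ball_iff_norm.1 (hsub hz)).le
  have hm : DifferentiableOn ℂ (complexRate ω) (Metric.ball (ξ : ℂ) r) := fun z hz =>
    (complexRate_differentiableAt hω (hball z hz)).differentiableWithinAt
  have hF := (differentiableOn_decayingData (ξ := ξ) hp hω hθ).mono hsub
  have hS := (differentiableOn_seedNorm (ξ := ξ) hp hω hθ).mono hsub
  unfold growingData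
  have h1 := (differentiableOn_const (-2 : ℂ)).fun_div (hm.fun_mul hS)
    fun z hz => mul_ne_zero (complexRate_ne_zero hω (hball z hz)) (hD z hz)
  have h2 := ((differentiableOn_const (2 : ℂ)).fun_div hS hD).fun_mul hm
  exact (h1.fun_smul hF.snd).prodMk (h2.fun_smul hF.fst)

theorem differentiableOn_growingRemainder {p ω θ ξ r : ℝ} (hp : 4 < p) (hω : 0 < ω)
    (hθ : |θ| < 1) (hr : r ≤ decayRate ω ξ / 16)
    (hD : ∀ z ∈ Metric.ball (ξ : ℂ) r, seedNorm p ω θ z ≠ 0) (k : ℕ) (x : ℝ) :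
    DifferentiableOn ℂ (growingRemainder p ω θ k x) (Metric.ball (ξ : ℂ) r) := by
  have hsub := Metric.ball_subset_ball (x := (ξ : ℂ)) hr
  have hm : DifferentiableOn ℂ (complexRate ω) (Metric.ball (ξ : ℂ) r) := fun z hz =>
    (complexRate_differentiableAt hω (mem_ball_iff_norm.1 (hsub hz)).le).differentiableWithinAt
  have hG := differentiableOn_growingData hp hω hθ hr hD
  have hE : DifferentiableOn ℂ (fun z => Complex.exp (-complexRate ω z * x))
      (Metric.ball (ξ : ℂ) r) := (hm.neg.mul_const _).cexp
  have hP : DifferentiableOn ℂ (fun z => propagator p ω θ x (z ^ 2) (growingData p ω θ z))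
      (Metric.ball (ξ : ℂ) r) :=
    DifferentiableOn.clm_apply ((differentiable_propagator hp hω hθ x).comp
      (differentiable_id.pow 2)).differentiableOn hG
  unfold growingRemainder
  split_ifs
  · exact (hE.smul hP.fst).sub_const _
  · exact hE.smul (hP.snd.sub (hm.smul hP.fst))

theorem hasDerivAt_growingRemainder {p ω θ : ℝ} (hp : 4 < p) (hω : 0 < ω) (hθ : |θ| < 1) (z : ℂ)
    (x : ℝ) : HasDerivAt (fun x => growingRemainder p ω θ 0 x z) (growingRemainder p ω θ 1 x z) x := by
  have h1 := hasDerivAt_propagator_fst (w := z ^ 2) (e := growingData p ω θ z) x hp hω hθ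
  simp only [growingRemainder, if_true, one_ne_zero, if_false]
  refine (((hasDerivAt_cexp_mul (-complexRate ω z) x).smul h1).sub_const ![0, 1]).congr_deriv ?_
  ext i
  simp
  ring

theorem hasDerivAt_remainder {p ω θ μ : ℝ} (hp : 4 < p) (hω : 0 < ω) (hθ : |θ| < 1) (hμ : 0 < μ)
    {lam z : ℂ} {c₀ : Fin 2 → ℂ} (h : IsFrobeniusExponent p ω μ lam z c₀) {x : ℝ} (hx : 0 ≤ x) :
    HasDerivAt (remainder p ω θ lam z c₀ 0) (remainder p ω θ lam z c₀ 1 x) x := by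
  obtain ⟨B, hB, hbound⟩ := exists_solutionCoeff_bound hp (abs_nonneg θ) hθ
  obtain ⟨hb, -, -⟩ := hbound ω θ μ hω le_rfl hμ lam z c₀ h
  have hd := hasDerivAt_expSeries (potentialRate_pos hp hω) (by positivity)
    (by linarith : (1 + |θ|) / 2 < 1) hB.le hb 0 hx
  have e : remainder p ω θ lam z c₀ 0 = fun x =>
      expSeries (potentialRate p ω) (solutionCoeff p ω θ lam z c₀) 0 x - c₀ := by
    ext1 x
    simp [remainder]
  rw [e]
  simpa [remainder] using hd.sub_const c₀

theorem lineSolution_frobeniusData {q p ω θ μ : ℝ} (hp : 4 < p) (hω : 0 < ω) (hθ : |θ| < 1)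
    (hμ : 0 < μ) {lam z : ℂ} {c₀ : Fin 2 → ℂ} (h : IsFrobeniusExponent p ω μ lam z c₀)
    {x : ℝ} (hx : 0 ≤ x) :
    Complex.exp (-lam * x) • lineSolution q p ω θ (z ^ 2) (frobeniusData p ω θ lam z c₀ 0) x - c₀ =
      remainder p ω θ lam z c₀ 0 x := by
  have h1 := eq_propagator_of_solvesAt (w := z ^ 2) hp hω hθ
    (fun x hx => hasDerivAt_frobeniusData hp hω hθ hμ h hx) x hx
  rw [lineSolution, if_pos hx, ← h1, frobeniusData, remainder, smul_smul, ← Complex.exp_add,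
    if_pos rfl]
  simp

/-! ### Derivative bounds from holomorphy -/

/-- Derivatives in `x` are taken first, giving functions holomorphic in `z`; Cauchy's estimate on
discs of half the radius then produces all derivatives in `ξ`. Smoothness in `ξ` comes for free on
the union of the discs. -/
theorem derivativeBounds_of_holomorphic {R : ℝ → ℝ → Fin 2 → ℂ} {G : ℕ → ℝ → ℂ → Fin 2 → ℂ}
    {r : ℝ → ℝ} {E : ℕ → ℝ → ℝ → ℝ} {C : ℕ → ℕ → ℝ} {W : ℕ → ℕ → ℝ → ℝ → ℝ}
    (hr : ∀ ξ, 0 < r ξ)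
    (hG : ∀ k ≤ 1, ∀ x, 0 ≤ x → ∀ ξ : ℝ,
      DifferentiableOn ℂ (G k x) (Metric.ball (ξ : ℂ) (r ξ)))
    (hR : ∀ x, 0 ≤ x → ∀ ξ : ℝ, R x ξ = G 0 x ξ)
    (hG' : ∀ x, 0 ≤ x → ∀ ξ : ℝ, HasDerivAt (fun y => G 0 y ξ) (G 1 x ξ) x)
    (hE : ∀ k ≤ 1, ∀ x, 0 ≤ x → ∀ ξ : ℝ, ∀ z : ℂ, ‖z - ξ‖ ≤ r ξ / 2 → ‖G k x z‖ ≤ E k x ξ)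
    (hC : ∀ ℓ, ∀ k ≤ 1, ∀ x, 0 ≤ x → ∀ ξ,
      (ℓ.factorial : ℝ) * E k x ξ / (r ξ / 2) ^ ℓ ≤ C ℓ k * W ℓ k x ξ) :
    DerivativeBounds R C W := by
  have hR1 : ∀ x, 0 ≤ x → ∀ ξ : ℝ, HasDerivWithinAt (fun y => R y ξ) (G 1 x ξ) (Ici 0) x :=
    fun x hx ξ => (hG' x hx ξ).hasDerivWithinAt.congr (fun y hy => hR y hy ξ) (hR x hx ξ)
  have hderiv : ∀ k ≤ 1, ∀ x, 0 ≤ x → (fun ξ => derivX k R x ξ) = fun ξ : ℝ => G k x ξ := by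
    intro k hk x hx
    ext1 ξ
    unfold derivX
    rcases Nat.le_one_iff_eq_zero_or_eq_one.1 hk with rfl | rfl
    · rw [iteratedDerivWithin_zero]
      exact hR x hx ξ
    · rw [iteratedDerivWithin_one]
      exact (hR1 x hx ξ).derivWithin (uniqueDiffOn_Ici 0 x hx)
  set U : Set ℂ := ⋃ ξ : ℝ, Metric.ball (ξ : ℂ) (r ξ) with hU
  have hUo : IsOpen U := isOpen_iUnion fun ξ => Metric.isOpen_ball
  have hUR : ∀ x : ℝ, (x : ℂ) ∈ U := fun x => mem_iUnion.2 ⟨x, Metric.mem_ball_self (hr x)⟩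
  have hGU : ∀ k ≤ 1, ∀ x, 0 ≤ x → DifferentiableOn ℂ (G k x) U := by
    intro k hk x hx z hz
    obtain ⟨ξ, hξ⟩ := mem_iUnion.1 hz
    exact ((hG k hk x hx ξ).differentiableAt (Metric.isOpen_ball.mem_nhds hξ)).differentiableWithinAt
  refine ⟨fun ξ x hx => (hR1 x hx ξ).differentiableWithinAt, fun x hx k hk => ?_,
    fun x hx ξ ℓ k hk => ?_⟩
  · rw [hderiv k hk x hx]
    exact contDiff_comp_ofReal hUo (hGU k hk x hx) hUR
  · rw [hderiv k hk x hx]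
    refine (norm_iteratedDeriv_comp_ofReal_le hUo (hGU k hk x hx) hUR (half_pos (hr ξ)) ?_
      (fun z hz => hE k hk x hx ξ z (mem_closedBall_iff_norm.1 hz)) ℓ).trans (hC ℓ k hk x hx ξ)
    exact (Metric.closedBall_subset_ball (half_lt_self (hr ξ))).trans
      (subset_iUnion (fun ξ : ℝ => Metric.ball (ξ : ℂ) (r ξ)) ξ)

theorem DerivativeBounds.mono {R : ℝ → ℝ → Fin 2 → ℂ} {C C' : ℕ → ℕ → ℝ}
    {W : ℕ → ℕ → ℝ → ℝ → ℝ} (h : DerivativeBounds R C W) (hC : ∀ ℓ k, C ℓ k ≤ C' ℓ k)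
    (hW : ∀ ℓ k x ξ, 0 ≤ W ℓ k x ξ) : DerivativeBounds R C' W :=
  ⟨h.1, h.2.1, fun x hx ξ ℓ k hk => (h.2.2 x hx ξ ℓ k hk).trans
    (mul_le_mul_of_nonneg_right (hC ℓ k) (hW ℓ k x ξ))⟩

/-- The constants enter the bounds linearly. Convexity is what allows local choices of constants to
be averaged by a partition of unity. -/
theorem convex_setOf_derivativeBounds (R : ℝ → ℝ → Fin 2 → ℂ) (W : ℕ → ℕ → ℝ → ℝ → ℝ) :
    Convex ℝ {C : ℕ → ℕ → ℝ | DerivativeBounds R C W} := by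
  intro C hC C' hC' a b ha hb hab
  refine ⟨hC.1, hC.2.1, fun x hx ξ ℓ k hk => ?_⟩
  have h1 := mul_le_mul_of_nonneg_left (hC.2.2 x hx ξ ℓ k hk) ha
  have h2 := mul_le_mul_of_nonneg_left (hC'.2.2 x hx ξ ℓ k hk) hb
  set N := ‖iteratedDeriv ℓ (fun η => derivX k R x η) ξ‖
  calc N = a * N + b * N := by rw [← add_mul, hab, one_mul]
    _ ≤ a * (C ℓ k * W ℓ k x ξ) + b * (C' ℓ k * W ℓ k x ξ) := add_le_add h1 h2
    _ = _ := by
      simp only [Pi.add_apply, Pi.smul_apply, smul_eq_mul]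
      ring

theorem DerivativeBounds.comp_neg {R : ℝ → ℝ → Fin 2 → ℂ} {C : ℕ → ℕ → ℝ}
    {W : ℕ → ℕ → ℝ → ℝ → ℝ} (h : DerivativeBounds R C W)
    (hW : ∀ ℓ k x ξ, W ℓ k x (-ξ) = W ℓ k x ξ) :
    DerivativeBounds (fun x ξ => R x (-ξ)) C W := by
  have hd : ∀ k x, (fun ξ => derivX k (fun x ξ => R x (-ξ)) x ξ) = fun ξ => derivX k R x (-ξ) :=
    fun k x => rfl
  refine ⟨fun ξ => h.1 (-ξ), fun x hx k hk => ?_, fun x hx ξ ℓ k hk => ?_⟩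
  · rw [hd]
    exact (h.2.1 x hx k hk).comp contDiff_neg
  · rw [hd, iteratedDeriv_comp_neg ℓ (fun η => derivX k R x η), norm_smul, norm_pow, norm_neg,
      norm_one, one_pow, one_mul, ← hW]
    exact h.2.2 x hx (-ξ) ℓ k hk

/-! ### The four solutions -/

/-- The oscillating solution `f₁`. -/
def oscillatingSolution (q p σ ω x ξ : ℝ) : Fin 2 → ℂ :=
  lineSolution q p ω (nome q σ ω) ((ξ : ℂ) ^ 2)
    (frobeniusData p ω (nome q σ ω) (Complex.I * ξ) ξ ![1, 0] 0) x

/-- The decaying solution `f₃`. -/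
def decayingSolution (q p σ ω x ξ : ℝ) : Fin 2 → ℂ :=
  lineSolution q p ω (nome q σ ω) ((ξ : ℂ) ^ 2) (decayingData p ω (nome q σ ω) ξ) x

/-- The growing solution `f₄`. -/
def growingSolution (q p σ ω x ξ : ℝ) : Fin 2 → ℂ :=
  lineSolution q p ω (nome q σ ω) ((ξ : ℂ) ^ 2) (growingData p ω (nome q σ ω) ξ) x

/-! ### Derivative bounds for the oscillating, decaying and growing solutions -/

section Bounds

variable {q p σ ω ω₁ : ℝ}

theorem one_le_japaneseBracket (x : ℝ) : 1 ≤ japaneseBracket x :=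
  Real.one_le_sqrt.2 (by nlinarith [sq_nonneg x])

theorem decayRate_neg (ω ξ : ℝ) : decayRate ω (-ξ) = decayRate ω ξ := by simp [decayRate]

theorem min_decayRate (hω : 0 < ω) (ξ : ℝ) : min (√ω / 4) (decayRate ω ξ) = √ω / 4 :=
  min_eq_left (by linarith [decayRate_lower hω ξ, Real.sqrt_nonneg ω])

theorem exp_potentialRate_le (hp : 4 < p) (hω : 0 < ω) {γ x : ℝ} (hγ : γ ≤ √ω / 2) (hx : 0 ≤ x) :
    Real.exp (-(potentialRate p ω * x)) ≤ Real.exp (-γ * x) := by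
  apply Real.exp_le_exp.2
  have h : γ ≤ potentialRate p ω := by
    linarith [potentialRate_lower hp hω, Real.sqrt_nonneg ω]
  linarith [mul_le_mul_of_nonneg_right h hx]

theorem derivativeBounds_oscillating {K : ℝ} (hp : 4 < p) (hω₁ : 0 < ω₁) (h₁ : ω₁ ≤ ω)
    (hθ : |nome q σ ω| < 1) (hK : 0 < K)
    (hb : ∀ (ξ : ℝ) (z : ℂ), ‖z - ξ‖ ≤ √ω / 10 → ∀ k ≤ 1, ∀ x, 0 ≤ x →
      ‖remainder p ω (nome q σ ω) (Complex.I * z) z ![1, 0] k x‖ ≤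
        K / decayRate ω ξ * Real.exp (-(potentialRate p ω * x))) :
    DerivativeBounds
      (fun x ξ => Complex.exp (-(Complex.I * x * ξ)) • oscillatingSolution q p σ ω x ξ - ![1, 0])
      (fun ℓ _ => ℓ.factorial * K / (√ω₁ / 20) ^ ℓ) (oscillatingWeight ω (√ω / 4)) := by
  have hω : 0 < ω := hω₁.trans_le h₁
  have hs₁ : 0 < √ω₁ := Real.sqrt_pos.2 hω₁
  have hs : √ω₁ ≤ √ω := Real.sqrt_le_sqrt h₁
  have hsω : 0 < √ω := Real.sqrt_pos.2 hω
  have hf : ∀ ξ : ℝ, IsFrobeniusExponent p ω (decayRate ω ξ) (Complex.I * (ξ : ℂ)) ξ ![1, 0] :=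
    fun ξ => isFrobeniusExponent_oscillating hp hω (by simp; positivity)
  refine derivativeBounds_of_holomorphic (r := fun _ => √ω / 10)
    (G := fun k x z => remainder p ω (nome q σ ω) (Complex.I * z) z ![1, 0] k x)
    (E := fun k x ξ => K / decayRate ω ξ * Real.exp (-(potentialRate p ω * x)))
    (fun ξ => by positivity) ?_ ?_ ?_ ?_ ?_
  · intro k hk x hx ξ
    exact differentiableOn_remainder hp hω hθ Metric.isOpen_ball (by fun_prop)
      (fun z hz => ⟨_, decayRate_pos hω ξ,
        isFrobeniusExponent_oscillating hp hω (mem_ball_iff_norm.1 hz).le⟩) k hx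
  · intro x hx ξ
    rw [← lineSolution_frobeniusData (q := q) hp hω hθ (decayRate_pos hω ξ) (hf ξ) hx,
      oscillatingSolution]
    congr 3
    ring
  · exact fun x hx ξ => hasDerivAt_remainder hp hω hθ (decayRate_pos hω ξ) (hf ξ) hx
  · exact fun k hk x hx ξ z hz => hb ξ z (hz.trans (by linarith)) k hk x hx
  · intro ℓ k hk x hx ξ
    have hμ := decayRate_pos hω ξ
    rw [oscillatingWeight, min_decayRate hω]
    have hj : 1 ≤ japaneseBracket x ^ (ℓ + 1) := one_le_pow₀ (one_le_japaneseBracket x)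
    have he := exp_potentialRate_le hp hω (γ := √ω / 4) (by linarith) hx
    calc (ℓ.factorial : ℝ) * (K / decayRate ω ξ * Real.exp (-(potentialRate p ω * x))) /
          (√ω / 10 / 2) ^ ℓ
        ≤ (ℓ.factorial : ℝ) * (K / decayRate ω ξ * Real.exp (-(√ω / 4) * x)) /
          (√ω₁ / 20) ^ ℓ := by
          rw [show √ω / 10 / 2 = √ω / 20 by ring]
          gcongr
      _ = ℓ.factorial * K / (√ω₁ / 20) ^ ℓ * ((decayRate ω ξ)⁻¹ * 1 *
          Real.exp (-(√ω / 4) * x)) := by field_simp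
      _ ≤ _ := by gcongr

/-- The factor `32^ℓ` comes from Cauchy discs of radius `μ/32`. The decay `e^{-κx}` exceeds both
required rates, as `κ ≥ 5√ω` while `2γ = √ω/2`. -/
theorem derivativeBounds_decaying {K : ℝ} (hp : 4 < p) (hω : 0 < ω)
    (hθ : |nome q σ ω| < 1) (hK : 0 < K)
    (hb : ∀ (ξ : ℝ) (z : ℂ), ‖z - ξ‖ ≤ decayRate ω ξ / 16 → ∀ k ≤ 1, ∀ x, 0 ≤ x →
      ‖remainder p ω (nome q σ ω) (-complexRate ω z) z ![0, 1] k x‖ ≤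
        K / decayRate ω ξ * Real.exp (-(potentialRate p ω * x))) :
    DerivativeBounds
      (fun x ξ => Real.exp (decayRate ω ξ * x) • decayingSolution q p σ ω x ξ - ![0, 1])
      (fun ℓ _ => ℓ.factorial * K * 32 ^ ℓ) (decayingWeight ω (√ω / 4)) := by
  have hf : ∀ ξ : ℝ, IsFrobeniusExponent p ω (decayRate ω ξ) (-complexRate ω ξ) ξ ![0, 1] :=
    fun ξ => isFrobeniusExponent_decaying hp hω (by
      simp only [sub_self, norm_zero]
      linarith [decayRate_pos hω ξ])
  have hsω : 0 < √ω := Real.sqrt_pos.2 hω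
  refine derivativeBounds_of_holomorphic (r := fun ξ => decayRate ω ξ / 16)
    (G := fun k x z => remainder p ω (nome q σ ω) (-complexRate ω z) z ![0, 1] k x)
    (E := fun k x ξ => K / decayRate ω ξ * Real.exp (-(potentialRate p ω * x)))
    (fun ξ => by linarith [decayRate_pos hω ξ]) ?_ ?_ ?_ ?_ ?_
  · intro k hk x hx ξ
    refine differentiableOn_remainder hp hω hθ Metric.isOpen_ball (fun z hz => ?_)
      (fun z hz => ⟨_, decayRate_pos hω ξ,
        isFrobeniusExponent_decaying hp hω (mem_ball_iff_norm.1 hz).le⟩) k hx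
    exact (complexRate_differentiableAt hω (mem_ball_iff_norm.1 hz).le).neg.differentiableWithinAt
  · intro x hx ξ
    rw [← lineSolution_frobeniusData (q := q) hp hω hθ (decayRate_pos hω ξ) (hf ξ) hx,
      decayingSolution, decayingData, complexRate_ofReal hω, neg_neg, ← Complex.ofReal_mul,
      ← Complex.ofReal_exp, Complex.coe_smul]
  · exact fun x hx ξ => hasDerivAt_remainder hp hω hθ (decayRate_pos hω ξ) (hf ξ) hx
  · exact fun k hk x hx ξ z hz => hb ξ z (hz.trans (by linarith [decayRate_pos hω ξ])) k hk x hx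
  · intro ℓ k hk x hx ξ
    have hμ := decayRate_pos hω ξ
    have main : ∀ γ, γ ≤ √ω / 2 →
        (ℓ.factorial : ℝ) * (K / decayRate ω ξ * Real.exp (-(potentialRate p ω * x))) /
          (decayRate ω ξ / 16 / 2) ^ ℓ ≤
        ℓ.factorial * K * 32 ^ ℓ * ((decayRate ω ξ)⁻¹ ^ (ℓ + 1) * Real.exp (-γ * x)) := by
      intro γ hγ
      have he := exp_potentialRate_le hp hω hγ hx
      calc (ℓ.factorial : ℝ) * (K / decayRate ω ξ * Real.exp (-(potentialRate p ω * x))) /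
          (decayRate ω ξ / 16 / 2) ^ ℓ
          ≤ (ℓ.factorial : ℝ) * (K / decayRate ω ξ * Real.exp (-γ * x)) /
          (decayRate ω ξ / 16 / 2) ^ ℓ := by gcongr
        _ = _ := by
          rw [show decayRate ω ξ / 16 / 2 = decayRate ω ξ / 32 by ring, div_pow, pow_succ, inv_pow]
          field_simp
    rw [decayingWeight]
    split_ifs with h0
    · obtain ⟨rfl, rfl⟩ : ℓ = 0 ∧ k = 0 := by omega
      simpa using main (√ω / 4) (by linarith)
    · exact main (2 * (√ω / 4)) (by linarith)

/-- For `ℓ ≥ 1`, Cauchy's estimate yields `μ^{-ℓ-1}` but the weight retains only `μ⁻²`; the surplus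
`μ^{-(ℓ-1)}` is absorbed by `μ ≥ √ω₁`. At `ℓ = 0` the truncated subtraction makes this factor `1`.
-/
theorem derivativeBounds_growing {c K : ℝ} (hp : 4 < p) (hω₁ : 0 < ω₁) (h₁ : ω₁ ≤ ω)
    (hθ : |nome q σ ω| < 1) (hK : 0 < K) (hc : 0 < c) (hc' : c ≤ 1 / 32)
    (hb : ∀ (ξ : ℝ) (z : ℂ), ‖z - ξ‖ ≤ c * decayRate ω ξ →
      seedNorm p ω (nome q σ ω) z ≠ 0 ∧ ∀ k ≤ 1, ∀ x, 0 ≤ x →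
        ‖growingRemainder p ω (nome q σ ω) k x z‖ ≤
          K / decayRate ω ξ * Real.exp (-(√ω / 4) * x)) :
    DerivativeBounds
      (fun x ξ => Real.exp (-(decayRate ω ξ * x)) • growingSolution q p σ ω x ξ - ![0, 1])
      (fun ℓ _ => ℓ.factorial * K * (2 / c) ^ ℓ * (1 / √ω₁) ^ (ℓ - 1))
      (growingWeight ω (√ω / 4)) := by
  have hω : 0 < ω := hω₁.trans_le h₁
  have hs₁ : 0 < √ω₁ := Real.sqrt_pos.2 hω₁
  have hs : √ω₁ ≤ √ω := Real.sqrt_le_sqrt h₁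
  have hsω : 0 < √ω := Real.sqrt_pos.2 hω
  refine derivativeBounds_of_holomorphic (r := fun ξ => c * decayRate ω ξ)
    (G := growingRemainder p ω (nome q σ ω))
    (E := fun k x ξ => K / decayRate ω ξ * Real.exp (-(√ω / 4) * x))
    (fun ξ => mul_pos hc (decayRate_pos hω ξ)) ?_ ?_ ?_ ?_ ?_
  · intro k hk x hx ξ
    have hμ := decayRate_pos hω ξ
    exact differentiableOn_growingRemainder hp hω hθ (by nlinarith)
      (fun z hz => (hb ξ z (mem_ball_iff_norm.1 hz).le).1) k x
  · intro x hx ξ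
    simp only [growingRemainder, if_true, growingSolution, lineSolution, if_pos hx]
    rw [complexRate_ofReal hω, ← Complex.ofReal_neg, ← Complex.ofReal_mul, ← Complex.ofReal_exp,
      Complex.coe_smul, neg_mul]
  · exact fun x hx ξ => hasDerivAt_growingRemainder hp hω hθ ξ x
  · exact fun k hk x hx ξ z hz => (hb ξ z (hz.trans (by
      have := mul_pos hc (decayRate_pos hω ξ)
      linarith))).2 k hk x hx
  · intro ℓ k hk x hx ξ
    have hμ := decayRate_pos hω ξ
    have hj : ∀ n, 1 ≤ japaneseBracket x ^ n := fun n => one_le_pow₀ (one_le_japaneseBracket x)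
    have hj2 := hj 2
    have hjl := hj (2 + ℓ)
    have hX := Real.exp_pos (-(√ω / 4) * x)
    rw [growingWeight, min_decayRate hω]
    cases ℓ with
    | zero =>
      simp only [Nat.factorial_zero, Nat.cast_one, one_mul, pow_zero, div_one, mul_one, if_true,
        zero_tsub]
      calc K / decayRate ω ξ * Real.exp (-(√ω / 4) * x)
          = K * ((decayRate ω ξ)⁻¹ * 1 * Real.exp (-(√ω / 4) * x)) := by field_simp
        _ ≤ _ := by gcongr
    | succ n =>
      rw [if_neg (Nat.succ_ne_zero n), Nat.add_sub_cancel]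
      have hμi : 1 / decayRate ω ξ ≤ 1 / √ω₁ := by
        gcongr
        linarith [decayRate_lower hω ξ]
      calc ((n + 1).factorial : ℝ) * (K / decayRate ω ξ * Real.exp (-(√ω / 4) * x)) /
            (c * decayRate ω ξ / 2) ^ (n + 1)
          = (n + 1).factorial * K * (2 / c) ^ (n + 1) * (1 / decayRate ω ξ) ^ n *
            ((decayRate ω ξ)⁻¹ ^ 2 * 1 * Real.exp (-(√ω / 4) * x)) := by
            rw [show c * decayRate ω ξ / 2 = (2 / c)⁻¹ * decayRate ω ξ by field_simp, mul_pow,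
              inv_pow, one_div, inv_pow, inv_pow]
            field_simp
            ring
        _ ≤ _ := by gcongr

end Bounds

/-! ### Assembly -/

/-- The four asymptotic bounds at the frequency `ω`, with constants `C`. -/
def AsymptoticBounds (q p σ ω : ℝ) (C : ℕ → ℕ → ℝ) : Prop :=
  DerivativeBounds
    (fun x ξ => Complex.exp (-(Complex.I * x * ξ)) • oscillatingSolution q p σ ω x ξ - ![1, 0])
    C (oscillatingWeight ω (√ω / 4)) ∧
  DerivativeBounds
    (fun x ξ => Real.exp (decayRate ω ξ * x) • decayingSolution q p σ ω x ξ - ![0, 1])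
    C (decayingWeight ω (√ω / 4)) ∧
  DerivativeBounds
    (fun x ξ => Real.exp (-(decayRate ω ξ * x)) • growingSolution q p σ ω x ξ - ![0, 1])
    C (growingWeight ω (√ω / 4))

theorem convex_setOf_asymptoticBounds (q p σ ω : ℝ) :
    Convex ℝ {C | AsymptoticBounds q p σ ω C} :=
  (convex_setOf_derivativeBounds _ _).inter
    ((convex_setOf_derivativeBounds _ _).inter (convex_setOf_derivativeBounds _ _))

/-- The constants can be chosen locally uniformly in the frequency. -/
theorem exists_eventually_asymptoticBounds {q p σ ω₀ : ℝ} (hq : q < 0) (hp : 4 < p)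
    (h₀ : ω₀ ∈ frequencySet q σ) : ∃ C, ∀ᶠ ω in 𝓝 ω₀, AsymptoticBounds q p σ ω C := by
  have hω₀ := frequencySet_pos h₀
  have hθ₀ := abs_nome_lt_one hq h₀
  set ρ := (1 + |nome q σ ω₀|) / 2 with hρ
  have hρ0 : 0 ≤ ρ := by positivity
  have hρ1 : ρ < 1 := by rw [hρ]; linarith
  set ω₁ := ω₀ / 2 with hω₁d
  set ω₂ := 2 * ω₀ with hω₂d
  have hω₁ : 0 < ω₁ := by positivity
  have hω₂ : 0 < ω₂ := by positivity
  obtain ⟨K, hK, hb⟩ := exists_uniform_remainder_bound hp hρ0 hρ1 hω₂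
  obtain ⟨c, K', hc, hc32, hK', hb'⟩ := exists_growingRemainder_bound hp hρ0 hρ1 hω₁ hω₂
  have hev : ∀ᶠ ω in 𝓝 ω₀, |nome q σ ω| < ρ :=
    (continuousAt_nome hq h₀).abs.eventually_lt_const (by rw [hρ]; linarith)
  refine ⟨fun ℓ _ => ℓ.factorial * K / (√ω₁ / 20) ^ ℓ + ℓ.factorial * K * 32 ^ ℓ +
    ℓ.factorial * K' * (2 / c) ^ ℓ * (1 / √ω₁) ^ (ℓ - 1), ?_⟩
  filter_upwards [hev, lt_mem_nhds (show ω₁ < ω₀ by linarith),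
    gt_mem_nhds (show ω₀ < ω₂ by linarith)] with ω hθ h₁ h₂
  have hω : 0 < ω := hω₁.trans h₁
  have hθ1 := hθ.trans hρ1
  have P : ∀ ξ, 0 < decayRate ω ξ := decayRate_pos hω
  have J : ∀ x, 0 < japaneseBracket x := fun x => zero_lt_one.trans_le (one_le_japaneseBracket x)
  have n1 : ∀ ℓ : ℕ, 0 ≤ ℓ.factorial * K / (√ω₁ / 20) ^ ℓ := fun ℓ => by positivity
  have n2 : ∀ ℓ : ℕ, 0 ≤ ℓ.factorial * K * 32 ^ ℓ := fun ℓ => by positivity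
  have n3 : ∀ ℓ : ℕ, 0 ≤ ℓ.factorial * K' * (2 / c) ^ ℓ * (1 / √ω₁) ^ (ℓ - 1) :=
    fun ℓ => by positivity
  refine ⟨(derivativeBounds_oscillating hp hω₁ h₁.le hθ1 hK fun ξ z hz k hk x hx =>
      (hb ω _ ξ hω h₂.le hθ.le z k hk x hx).1 hz).mono
        (fun ℓ _ => by linarith [n1 ℓ, n2 ℓ, n3 ℓ]) ?_,
    (derivativeBounds_decaying hp hω hθ1 hK fun ξ z hz k hk x hx =>
      ((hb ω _ ξ hω h₂.le hθ.le z k hk x hx).2 hz).1).mono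
        (fun ℓ _ => by linarith [n1 ℓ, n2 ℓ, n3 ℓ]) ?_,
    (derivativeBounds_growing hp hω₁ h₁.le hθ1 hK' hc hc32 fun ξ z hz =>
      hb' ω _ ξ h₁.le h₂.le hθ.le z hz).mono
        (fun ℓ _ => by linarith [n1 ℓ, n2 ℓ, n3 ℓ]) ?_⟩
  · intro ℓ k x ξ
    have := P ξ
    have := J x
    unfold oscillatingWeight
    positivity
  · intro ℓ k x ξ
    have := P ξ
    unfold decayingWeight
    split_ifs <;> positivity
  · intro ℓ k x ξ
    have := P ξ
    have := J x
    unfold growingWeight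
    split_ifs <;> positivity

/-- Near each frequency one family of constants serves all nearby frequencies, and at each frequency
the admissible families form a convex set; a partition of unity then selects them continuously, for
all `ℓ`, `k` at once. -/
theorem exists_continuousOn_asymptoticBounds {q p σ : ℝ} (hq : q < 0) (hp : 4 < p) :
    ∃ C : ℕ → ℕ → ℝ → ℝ, (∀ ℓ k, ContinuousOn (C ℓ k) (frequencySet q σ)) ∧
      ∀ ω ∈ frequencySet q σ, AsymptoticBounds q p σ ω fun ℓ k => C ℓ k ω := by
  classical
  obtain ⟨g, hg⟩ := exists_continuous_forall_mem_convex_of_local_const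
    (X := frequencySet q σ) (E := ℕ → ℕ → ℝ) (t := fun ω => {C | AsymptoticBounds q p σ ω C})
    (fun ω => convex_setOf_asymptoticBounds q p σ ω) (fun ω => by
      obtain ⟨C, hC⟩ := exists_eventually_asymptoticBounds hq hp ω.2
      exact ⟨C, continuous_subtype_val.continuousAt.eventually hC⟩)
  refine ⟨fun ℓ k ω => if h : ω ∈ frequencySet q σ then g ⟨ω, h⟩ ℓ k else 0, fun ℓ k => ?_,
    fun ω h => ?_⟩
  · rw [continuousOn_iff_continuous_domRestrict]
    refine ((continuous_apply k).comp ((continuous_apply ℓ).comp g.continuous)).congr fun ω => ?_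
    simp
  · simpa [h] using hg ⟨ω, h⟩

/-! ### Symmetries and Wronskians of the four solutions -/

section Symmetry

variable {q p σ ω : ℝ}

theorem star_oscillatingSolution (hp : 4 < p) (hω : 0 < ω) (hθ : |nome q σ ω| < 1) (x ξ : ℝ) :
    star (oscillatingSolution q p σ ω x ξ) = oscillatingSolution q p σ ω x (-ξ) := by
  have hv : star (![1, 0] : Fin 2 → ℂ) = ![1, 0] := by ext i; fin_cases i <;> simp
  have hn := frobeniusData_neg p ω (nome q σ ω) (-(Complex.I * ξ)) (ξ : ℂ) ![1, 0]
  rw [oscillatingSolution, oscillatingSolution, star_lineSolution hp hω hθ (by simp),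
    frobeniusData_star, hv]
  simp only [Complex.ofReal_neg, neg_sq, mul_neg, hn]
  simp

theorem decayingSolution_neg (q p σ ω x ξ : ℝ) :
    decayingSolution q p σ ω x (-ξ) = decayingSolution q p σ ω x ξ := by
  simp only [decayingSolution, Complex.ofReal_neg, neg_sq, decayingData_neg]

theorem growingSolution_neg (q p σ ω x ξ : ℝ) :
    growingSolution q p σ ω x (-ξ) = growingSolution q p σ ω x ξ := by
  simp only [growingSolution, Complex.ofReal_neg, neg_sq, growingData_neg]

theorem star_decayingSolution (hp : 4 < p) (hω : 0 < ω) (hθ : |nome q σ ω| < 1) (x ξ : ℝ) :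
    star (decayingSolution q p σ ω x ξ) = decayingSolution q p σ ω x ξ := by
  rw [decayingSolution, star_lineSolution hp hω hθ (by simp), star_decayingData hω]

theorem star_growingSolution (hp : 4 < p) (hω : 0 < ω) (hθ : |nome q σ ω| < 1) (x ξ : ℝ) :
    star (growingSolution q p σ ω x ξ) = growingSolution q p σ ω x ξ := by
  rw [growingSolution, star_lineSolution hp hω hθ (by simp), star_growingData hω]

theorem isFrobeniusExponent_oscillating_ofReal (hp : 4 < p) (hω : 0 < ω) (ξ : ℝ) :
    IsFrobeniusExponent p ω (decayRate ω ξ) (Complex.I * ξ) ξ ![1, 0] :=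
  isFrobeniusExponent_oscillating hp hω (by simp; positivity)

theorem isFrobeniusExponent_decaying_ofReal (hp : 4 < p) (hω : 0 < ω) (ξ : ℝ) :
    IsFrobeniusExponent p ω (decayRate ω ξ) (-complexRate ω ξ) ξ ![0, 1] :=
  isFrobeniusExponent_decaying hp hω (by
    simp only [sub_self, norm_zero]
    linarith [decayRate_pos hω ξ])

theorem oscillatingSolution_neg_eq (q p σ ω ξ : ℝ) :
    (fun x => oscillatingSolution q p σ ω x (-ξ)) =
      lineSolution q p ω (nome q σ ω) ((ξ : ℂ) ^ 2)
        (frobeniusData p ω (nome q σ ω) (Complex.I * (-ξ : ℝ)) (-ξ : ℝ) ![1, 0] 0) := by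
  unfold oscillatingSolution
  rw [Complex.ofReal_neg, neg_sq]

theorem wronskian_oscillating (hp : 4 < p) (hω : 0 < ω) (hθ : |nome q σ ω| < 1) (ξ : ℝ) {x : ℝ}
    (hx : x ≠ 0) :
    wronskian (fun y => oscillatingSolution q p σ ω y ξ)
      (fun y => oscillatingSolution q p σ ω y (-ξ)) x = 2 * Complex.I * ξ := by
  rw [oscillatingSolution_neg_eq]
  refine (wronskian_lineSolution hp hω hθ _ hx).trans ?_
  rw [dataWronskian_frobeniusData hp hω hθ (decayRate_pos hω ξ) (decayRate_pos hω (-ξ))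
    (isFrobeniusExponent_oscillating_ofReal hp hω ξ)
    (isFrobeniusExponent_oscillating_ofReal hp hω (-ξ)) (by simp) (by simp) (Or.inl (by simp))]
  simp
  ring

theorem wronskian_oscillating_decaying (hp : 4 < p) (hω : 0 < ω) (hθ : |nome q σ ω| < 1) (ξ : ℝ)
    {x : ℝ} (hx : x ≠ 0) :
    wronskian (fun y => oscillatingSolution q p σ ω y ξ)
      (fun y => decayingSolution q p σ ω y ξ) x = 0 := by
  refine (wronskian_lineSolution hp hω hθ _ hx).trans ?_
  rw [decayingData, dataWronskian_frobeniusData hp hω hθ (decayRate_pos hω ξ) (decayRate_pos hω ξ)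
    (isFrobeniusExponent_oscillating_ofReal hp hω ξ)
    (isFrobeniusExponent_decaying_ofReal hp hω ξ) rfl
    (by simp [complexRate_ofReal hω, (decayRate_pos hω ξ).le]) (Or.inr (by simp))]
  simp

theorem wronskian_decaying_growing (hp : 4 < p) (hω : 0 < ω) (hθ : |nome q σ ω| < 1) (ξ : ℝ)
    {x : ℝ} (hx : x ≠ 0) :
    wronskian (fun y => decayingSolution q p σ ω y ξ)
      (fun y => growingSolution q p σ ω y ξ) x = -2 * decayRate ω ξ := by
  -- Applied with both frequency bounds equal to `ω`, solely to know that the seed norm does not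
  -- vanish at real `ξ`.
  obtain ⟨c, K, hc, -, -, hb⟩ := exists_growingRemainder_bound hp (abs_nonneg (nome q σ ω)) hθ hω hω
  have hμ := decayRate_pos hω ξ
  have hD := (hb ω _ ξ le_rfl le_rfl le_rfl ξ (by simp; positivity)).1
  refine (wronskian_lineSolution hp hω hθ _ hx).trans ?_
  rw [dataWronskian_growingData ?_ hD, complexRate_ofReal hω]
  rw [complexRate_ofReal hω]
  exact_mod_cast hμ.ne'

end Symmetry

end

theorem lemma4p2 (q p σ : ℝ) (hq : q < 0) (hp : 4 < p) (hσ : σ = 1 ∨ σ = -1) :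
    ∃ f₁ f₂ f₃ f₄ : ℝ → ℝ → ℝ → Fin 2 → ℂ,
    ∃ γ : ℝ → ℝ, ∃ C : ℕ → ℕ → ℝ → ℝ,
      ContinuousOn γ (frequencySet q σ) ∧
      (∀ ℓ k, ContinuousOn (C ℓ k) (frequencySet q σ)) ∧
      ∀ ω ∈ frequencySet q σ,
        0 < γ ω ∧
        -- the four functions solve the generalized eigenvalue problem
        (∀ ξ : ℝ,
          IsGeneralizedEigenfunction q p σ ω ξ (fun x => f₁ ω x ξ) ∧
          IsGeneralizedEigenfunction q p σ ω ξ (fun x => f₂ ω x ξ) ∧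
          IsGeneralizedEigenfunction q p σ ω ξ (fun x => f₃ ω x ξ) ∧
          IsGeneralizedEigenfunction q p σ ω ξ (fun x => f₄ ω x ξ)) ∧
        -- asymptotics on the half line `x ≥ 0`
        DerivativeBounds
          (fun x ξ => Complex.exp (-(Complex.I * x * ξ)) • f₁ ω x ξ - ![1, 0])
          (fun ℓ k => C ℓ k ω) (oscillatingWeight ω (γ ω)) ∧
        DerivativeBounds
          (fun x ξ => Complex.exp (Complex.I * x * ξ) • f₂ ω x ξ - ![1, 0])
          (fun ℓ k => C ℓ k ω) (oscillatingWeight ω (γ ω)) ∧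
        DerivativeBounds
          (fun x ξ => Real.exp (decayRate ω ξ * x) • f₃ ω x ξ - ![0, 1])
          (fun ℓ k => C ℓ k ω) (decayingWeight ω (γ ω)) ∧
        DerivativeBounds
          (fun x ξ => Real.exp (-(decayRate ω ξ * x)) • f₄ ω x ξ - ![0, 1])
          (fun ℓ k => C ℓ k ω) (growingWeight ω (γ ω)) ∧
        -- symmetries
        (∀ x ξ : ℝ,
          f₁ ω x (-ξ) = star (f₁ ω x ξ) ∧ star (f₁ ω x ξ) = f₂ ω x ξ ∧
          f₂ ω x (-ξ) = star (f₂ ω x ξ) ∧ star (f₂ ω x ξ) = f₁ ω x ξ ∧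
          f₃ ω x (-ξ) = star (f₃ ω x ξ) ∧ star (f₃ ω x ξ) = f₃ ω x ξ ∧
          f₄ ω x (-ξ) = star (f₄ ω x ξ) ∧ star (f₄ ω x ξ) = f₄ ω x ξ) ∧
        -- Wronskians
        (∀ ξ x : ℝ, x ≠ 0 →
          wronskian (fun y => f₁ ω y ξ) (fun y => f₂ ω y ξ) x = 2 * Complex.I * ξ ∧
          wronskian (fun y => f₁ ω y ξ) (fun y => f₃ ω y ξ) x = 0 ∧
          wronskian (fun y => f₂ ω y ξ) (fun y => f₃ ω y ξ) x = 0 ∧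
          wronskian (fun y => f₃ ω y ξ) (fun y => f₄ ω y ξ) x = -2 * decayRate ω ξ) := by
  obtain ⟨C, hC, hbounds⟩ := exists_continuousOn_asymptoticBounds (σ := σ) hq hp
  -- `f₂` is `f₁` at `-ξ`, so its bounds follow by reflection. The rate `γ = √ω/4` is the one used
  -- for the damped system, and it lies below both `μ` and `κ`.
  refine ⟨fun ω x ξ => oscillatingSolution q p σ ω x ξ,
    fun ω x ξ => oscillatingSolution q p σ ω x (-ξ), fun ω x ξ => decayingSolution q p σ ω x ξ,
    fun ω x ξ => growingSolution q p σ ω x ξ, fun ω => √ω / 4, C, by fun_prop, hC, ?_⟩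
  intro ω hmem
  have hω := frequencySet_pos hmem
  have hθ := abs_nome_lt_one hq hmem
  have hpot := potential_eq hq hp hσ hmem
  obtain ⟨b1, b3, b4⟩ := hbounds ω hmem
  have hs := star_oscillatingSolution hp hω hθ
  refine ⟨by positivity, fun ξ => ⟨?_, ?_, ?_, ?_⟩, b1, ?_, b3, b4, fun x ξ => ?_,
    fun ξ x hx => ⟨?_, ?_, ?_, ?_⟩⟩
  · exact isGeneralizedEigenfunction_lineSolution hp hω hθ hpot _
  · simp only [oscillatingSolution_neg_eq]
    exact isGeneralizedEigenfunction_lineSolution hp hω hθ hpot _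
  · exact isGeneralizedEigenfunction_lineSolution hp hω hθ hpot _
  · exact isGeneralizedEigenfunction_lineSolution hp hω hθ hpot _
  · have h2 := b1.comp_neg fun ℓ k x ξ => by
      simp only [oscillatingWeight, decayRate_neg]
    convert h2 using 6
    simp
  · simp only [hs, neg_neg, decayingSolution_neg, growingSolution_neg,
      star_decayingSolution hp hω hθ, star_growingSolution hp hω hθ, and_self]
  · exact wronskian_oscillating hp hω hθ ξ hx
  · exact wronskian_oscillating_decaying hp hω hθ ξ hx
  · have h := wronskian_oscillating_decaying hp hω hθ (-ξ) hx
    simpa only [decayingSolution_neg] using h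
  · exact wronskian_decaying_growing hp hω hθ ξ hx
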